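/- **Setup.** Let $G$ be a finite planar bipartite graph embedded in a closed disk, with boundary vertices $1,\dots,n$ in counterclockwise order, all black and each on at most one edge (the boundary edge $b_i$); multiple edges are allowed. A *network* $N$ is such a graph with edges weighted by nonzero complex numbers. It has *excedance* $k$ if $k$ is the number of interior white vertices minus the number of interior black vertices. For $I\in\binom{[n]}{k}$ let $\Delta_I(N)=\sum_\pi\prod_{e\in\pi}\mathrm{wt}(e)$, summed over the sets $\pi$ of edges that use every interior vertex exactly once and use exactly the boundary vertices in $I$; let $\tilde X(N)=(\Delta_I(N))_{I}\in\mathbb C^{\binom nk}$, a point of the affine cone over $\mathrm{Gr}(k,n)$. Let $r\ge 1$, let $U$ be a complex vector space with basis $E_1,\dots,E_r$, and identify $\bigwedge^r U=\mathbb C$ by $E_1\wedge\dots\wedge E_r=1$. For $S\subset[r]$ let $E_S$ be the wedge of the $E_i$, $i\in S$, in ascending order. Let $\lambda\in\{0,\dots,r\}^n$ with $\sum_i\lambda_i=kr$, and $\mathcal W_\lambda(U)=\mathrm{Hom}_{\mathrm{SL}(U)}\bigl(\bigotimes_{i=1}^n\bigwedge^{\lambda_i}(U),\mathbb C\bigr)$.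 An *$r$-weblike subgraph* $W$ of $G$ of degree $\lambda$ is an assignment of multiplicities $m(e)\in\{0,\dots,r\}$ to the edges (edges of multiplicity $0$ are not in $W$) with sum $r$ around each interior vertex and with $m(b_i)=\lambda_i$ (read as $0$ if there is no edge $b_i$); its weight is $\mathrm{wt}(W)=\prod_e\mathrm{wt}(e)^{m(e)}$. A *tagging* $\mathcal O$ of $W$ directs the half-edges of $W$ so that each interior white vertex has exactly one outgoing half-edge, each interior black vertex has exactly one incoming half-edge, boundary edges leave the boundary, and there is no oriented cycle; an edge whose two halves disagree carries a tag on a chosen side (a pair tag if the halves point towards each other, a source tag if they point away from each other). Half-edges directed black to white carry $\bigwedge^{m(e)}(U)$, and those directed white to black carry $\bigwedge^{r-m(e)}(U)$. Composing exterior products at white vertices, signed shuffles at black vertices, the pairings $\bigwedge^a\otimes\bigwedge^{r-a}\to\bigwedge^r=\mathbb C$ at pair tags and the shuffles $\mathbb C=\bigwedge^r\to\bigwedge^a\otimes\bigwedge^{r-a}$ at source tags, with factors ordered by the embedding, gives a functional $\hat W(W,\mathcal O)$ on $\bigotimes_i\bigwedge^{\lambda_i}(U)$. For $\mathcal S=(S_1,\dots,S_n)$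 with $S_i\subset[r]$, $|S_i|=\lambda_i$, let $E_{\mathcal S}=E_{S_1}\otimes\dots\otimes E_{S_n}$, let $\mathrm{sign}(\mathcal S)$ be $(-1)$ to the number of inversions of the word obtained by writing the elements of $S_1,\dots,S_n$ in turn, each set in ascending order, and let $a(\mathcal S;W)$ be the number of labelings of the edges $e$ by subsets of $[r]$ of size $m(e)$ that are disjoint around each interior vertex and equal $S_i$ on $b_i$. Let $\mathrm{sign}(W,\mathcal O)\in\{\pm1\}$ be such that $\hat W(W,\mathcal O)(E_{\mathcal S})=\mathrm{sign}(\mathcal S)\,\mathrm{sign}(W,\mathcal O)\,a(\mathcal S;W)$ for all $\mathcal S$, and put $\mathbf W=\mathrm{sign}(W,\mathcal O)\,\hat W(W,\mathcal O)$ and $$\mathrm{Web}_r(N;\lambda)=\sum_{W\subset G,\ \lambda(W)=\lambda}\mathrm{wt}(W)\,\mathbf W .$$ **Theorem.** Let $N$ and $N'$ be networks with $n$ boundary vertices and excedance $k$. Every $r$-weblike subgraph of degree $\lambda$ of $N$ or of $N'$ has a tagging, and for each tagging $\mathcal{O}$ a sign $\mathrm{sign}(W,\mathcal O)$ as above exists.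 If $\tilde X(N)=\tilde X(N')$, then, for any choice of the taggings used to compute the two sides, $$\mathrm{Web}_r(N;\lambda)=\mathrm{Web}_r(N';\lambda)\in\mathcal W_\lambda(U).$$ So the map $N\mapsto\mathrm{Web}_r(N;\lambda)$ factors through $N\mapsto\tilde X(N)$. -/

import Mathlib

/-! ### Planar bipartite graphs in the disk -/

/-- The number of cycles of a permutation of a finite set, fixed points included. -/
noncomputable def cycleCount {α : Type} (σ : Equiv.Perm α) : ℕ :=
  Nat.card (Quotient (Equiv.Perm.SameCycle.setoid σ))

/-- The number of orbits of the group generated by two permutations. -/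
noncomputable def jointOrbitCount {α : Type} (σ τ : Equiv.Perm α) : ℕ :=
  Nat.card (MulAction.orbitRel.Quotient
    (Subgroup.closure ({σ, τ} : Set (Equiv.Perm α))) α)

open Classical in
/-- The boundary edges, listed in the order of the labels of their boundary vertices. -/
noncomputable def boundaryEdgeList {Edge Black : Type} [Fintype Edge] {n : ℕ}
    (black : Edge → Black ⊕ Fin n) : List Edge :=
  (List.finRange n).flatMap fun i =>
    (Finset.univ.filter fun e => black e = Sum.inr i).toList

open Classical in
/-- The rotation at the point at infinity. When the complement of the open disk is contracted to
a point of the sphere, the boundary edges are the edges at that point, and their counterclockwise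
order around it is the decreasing cyclic order of the labels (which increase counterclockwise
along the boundary of the disk). All other edges are fixed. -/
noncomputable def outerRotation {Edge Black : Type} [Fintype Edge] {n : ℕ}
    (black : Edge → Black ⊕ Fin n) : Equiv.Perm Edge :=
  (boundaryEdgeList black).reverse.formPerm

/-- A finite planar bipartite graph in the closed disk, all of whose boundary vertices are black,
with boundary vertices `0, …, n - 1` in counterclockwise order. Multiple edges are allowed.
Every edge has a white end, which is interior, and a black end, which is an interior black vertex
or a boundary vertex; a boundary vertex lies on at most one edge.

The embedding is recorded by its rotation system: `rotWhite e` and `rotBlack e` are the next edge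
counterclockwise after `e` around its white end and around its black end. That the rotation system
comes from an embedding in the disk is Euler's formula `V - E + F = 2 C` on the sphere (genus zero
for every connected component), the outside of the disk being contracted to one more vertex. For a
bipartite rotation system the faces are the cycles of the product of the two rotations. -/
structure DiskGraph (n : ℕ) where
  White : Type
  Black : Type
  Edge : Type
  [fintypeWhite : Fintype White]
  [fintypeBlack : Fintype Black]
  [fintypeEdge : Fintype Edge]
  white : Edge → White
  black : Edge → Black ⊕ Fin n
  boundary_unique : ∀ e e' i, black e = Sum.inr i → black e' = Sum.inr i → e = e'
  rotWhite : Equiv.Perm Edge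
  sameCycle_rotWhite : ∀ e e', rotWhite.SameCycle e e' ↔ white e = white e'
  rotBlack : Equiv.Perm Edge
  sameCycle_rotBlack : ∀ e e', rotBlack.SameCycle e e' ↔ black e = black e'
  planar :
    cycleCount rotWhite + cycleCount (rotBlack * outerRotation black)
        + cycleCount (rotWhite * (rotBlack * outerRotation black))
      = Fintype.card Edge + 2 * jointOrbitCount rotWhite (rotBlack * outerRotation black)

attribute [instance] DiskGraph.fintypeWhite DiskGraph.fintypeBlack DiskGraph.fintypeEdge

/-! ### Networks and boundary measurements -/

/-- A network: a planar bipartite graph in the disk with nonzero complex edge weights. -/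
structure DiskNetwork (n : ℕ) extends DiskGraph n where
  weight : Edge → ℂ
  weight_ne_zero : ∀ e, weight e ≠ 0

/-- `k` is the number of interior white vertices minus the number of interior black vertices. -/
def DiskNetwork.HasExcedance {n : ℕ} (N : DiskNetwork n) (k : ℕ) : Prop :=
  Fintype.card N.White = Fintype.card N.Black + k

/-- Dimer configurations (almost perfect matchings): every interior vertex is used exactly
once. -/
def DiskGraph.IsDimer {n : ℕ} (G : DiskGraph n) (π : Finset G.Edge) : Prop :=
  (∀ w : G.White, ∃! e, e ∈ π ∧ G.white e = w) ∧
    ∀ b : G.Black, ∃! e, e ∈ π ∧ G.black e = Sum.inl b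

/-- The boundary subset of `π` is `I`. -/
def DiskGraph.HasBoundary {n : ℕ} (G : DiskGraph n) (π : Finset G.Edge) (I : Finset (Fin n)) :
    Prop :=
  ∀ i, i ∈ I ↔ ∃ e ∈ π, G.black e = Sum.inr i

open Classical in
/-- The boundary measurement `Δ_I(N)`. -/
noncomputable def DiskNetwork.boundaryMeasurement {n : ℕ} (N : DiskNetwork n)
    (I : Finset (Fin n)) : ℂ :=
  ∑ π : Finset N.Edge with N.IsDimer π ∧ N.HasBoundary π I, ∏ e ∈ π, N.weight e

/-- The point `X̃(N)` of the affine cone over `Gr(k,n)`, given by its Plücker coordinates indexed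
by the `k`-element subsets of the set of boundary vertices. -/
noncomputable def DiskNetwork.conePoint {n : ℕ} (N : DiskNetwork n) (k : ℕ) :
    Set.powersetCard (Fin n) k → ℂ :=
  fun I => N.boundaryMeasurement (I : Finset (Fin n))

/-! ### Tensor invariants of fundamental representations -/

open scoped TensorProduct in
/-- `⋀^{λ_1}(U) ⊗ ⋯ ⊗ ⋀^{λ_n}(U)`. -/
abbrev FundamentalTensor (U : Type*) [AddCommGroup U] [Module ℂ U] {n : ℕ} (lam : Fin n → ℕ) :
    Type _ :=
  ⨂[ℂ] i, ⋀[ℂ]^(lam i) U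

/-- The space `W_λ(U)` of `SL(U)`-invariant linear functionals on the tensor product. -/
def tensorInvariants (U : Type*) [AddCommGroup U] [Module ℂ U] {n : ℕ} (lam : Fin n → ℕ) :
    Submodule ℂ (FundamentalTensor U lam →ₗ[ℂ] ℂ) where
  carrier := {f | ∀ g : SpecialLinearGroup ℂ U,
    f ∘ₗ PiTensorProduct.map (fun i => exteriorPower.map (lam i) ((g : U ≃ₗ[ℂ] U) : U →ₗ[ℂ] U))
      = f}
  add_mem' := fun {f f'} hf hf' g => by rw [LinearMap.add_comp, hf g, hf' g]
  zero_mem' := fun g => LinearMap.zero_comp _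
  smul_mem' := fun c f hf g => by rw [LinearMap.smul_comp, hf g]

/-- The tensor `E_𝒮 = E_{S_1} ⊗ ⋯ ⊗ E_{S_n}`, where `E_S` is the wedge of the basis vectors
labelled by `S` in ascending order. -/
noncomputable def basisTensor {U : Type*} [AddCommGroup U] [Module ℂ U] {r n : ℕ}
    (E : Module.Basis (Fin r) ℂ U) {lam : Fin n → ℕ}
    (S : ∀ i, Set.powersetCard (Fin r) (lam i)) : FundamentalTensor U lam :=
  PiTensorProduct.tprod ℂ fun i => E.exteriorPower (lam i) (S i)

/-! ### Signs, and matrix entries of the basic morphisms -/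

/-- The number of inversions of a word. -/
def inversions {r : ℕ} : List (Fin r) → ℕ
  | [] => 0
  | a :: l => l.countP (fun b => decide (b < a)) + inversions l

/-- The word obtained by writing the elements of each subset in ascending order. -/
def subsetWord {r : ℕ} (L : List (Finset (Fin r))) : List (Fin r) :=
  L.flatMap fun S => S.sort (· ≤ ·)

/-- The sign of a list of subsets: `1` or `-1` according to the parity of the number of inversions
of its word. -/
def subsetSign {r : ℕ} (L : List (Finset (Fin r))) : ℤ :=
  (-1) ^ inversions (subsetWord L)

/-- The number of inversions of the permutation that reverses the order of consecutive blocks of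
the given sizes, keeping the order inside each block. -/
def blockInversions : List ℕ → ℕ
  | [] => 0
  | a :: l => a * l.sum + blockInversions l

/-- Matrix entry of the exterior product map: the coefficient of `E_T` in
`E_{T_1} ∧ ⋯ ∧ E_{T_s}`. -/
noncomputable def wedgeEntry {U : Type*} [AddCommGroup U] [Module ℂ U] {r : ℕ}
    (E : Module.Basis (Fin r) ℂ U) (L : List (Finset (Fin r))) (T : Finset (Fin r)) : ℂ :=
  E.ExteriorAlgebra.repr (L.map E.ExteriorAlgebra).prod T

open Classical in
/-- Matrix entry of the shuffle map: the coefficient of `E_{T_s} ⊗ ⋯ ⊗ E_{T_1}` in the image of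
`E_T`, where `L = [T_s, …, T_1]`. This is the sign of the shuffle `(T_s, …, T_1)` of `T` times the
global sign of the block permutation `(b - a_s + 1, …, b, …, 1, …, a_1)`, and zero when `T` is not
the disjoint union of the `T_i`. -/
noncomputable def shuffleEntry {r : ℕ} (T : Finset (Fin r)) (L : List (Finset (Fin r))) : ℂ :=
  if L.Pairwise Disjoint ∧ (∀ x, x ∈ T ↔ ∃ S ∈ L, x ∈ S) then
    ((subsetSign L * (-1) ^ blockInversions (L.map Finset.card) : ℤ) : ℂ)
  else 0

open Classical in
/-- The elements that follow `e` in its cycle under `σ`, in order, without `e` itself. -/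
noncomputable def cycleAfter {α : Type} [Fintype α] (σ : Equiv.Perm α) (e : α) : List α :=
  (σ.toList e).tail

/-! ### Weblike subgraphs and their taggings -/

open Classical in
/-- The `r`-weblike subgraphs of `G` of degree `lam`. Such a subgraph is given by the
multiplicities of the edges of `G`, an edge outside the subgraph having multiplicity `0`; the
multiplicities around each interior vertex sum to `r`. The degree at a boundary vertex is the
multiplicity of its boundary edge (`0` if there is no such edge). -/
def DiskGraph.Weblike {n : ℕ} (G : DiskGraph n) (r : ℕ) (lam : Fin n → ℕ) : Type :=
  {m : G.Edge → Fin (r + 1) //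
    (∀ w : G.White, ∑ e with G.white e = w, (m e : ℕ) = r) ∧
    (∀ b : G.Black, ∑ e with G.black e = Sum.inl b, (m e : ℕ) = r) ∧
    ∀ i : Fin n, ∑ e with G.black e = Sum.inr i, (m e : ℕ) = lam i}

namespace DiskGraph.Weblike

variable {n r : ℕ} {G : DiskGraph n} {lam : Fin n → ℕ}

open Classical in
noncomputable instance : Fintype (G.Weblike r lam) :=
  Subtype.fintype _

/-- The multiplicity of an edge. -/
def mult (W : G.Weblike r lam) (e : G.Edge) : ℕ := (W.1 e : ℕ)

open Classical in
/-- The number `a(𝒮; W)` of consistent labelings of `W` with boundary label subsets `𝒮`: each edge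
is labelled by a subset of the colors whose size is the multiplicity of the edge, and the labels
are disjoint around each interior vertex. -/
noncomputable def labelingCount (W : G.Weblike r lam)
    (S : ∀ i, Set.powersetCard (Fin r) (lam i)) : ℕ :=
  Finset.card {l : G.Edge → Finset (Fin r) |
    (∀ e, (l e).card = W.mult e) ∧
    (∀ e e', e ≠ e' → G.white e = G.white e' → Disjoint (l e) (l e')) ∧
    (∀ e e' b, e ≠ e' → G.black e = Sum.inl b → G.black e' = Sum.inl b → Disjoint (l e) (l e')) ∧
    ∀ e i, G.black e = Sum.inr i → l e = (S i : Finset (Fin r))}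

/-- A choice of directions making every interior white vertex a wedge (one outgoing edge) and
every interior black vertex a shuffle (one incoming edge), along edges of `W`. All other edges at
a white vertex come in, all other edges at an interior black vertex go out, and every boundary
edge goes out of its boundary vertex.

The two halves of an edge may disagree. An edge (or half-edge) directed from black to white has
multiplicity `mult e`, and one directed from white to black has multiplicity `r - mult e`. -/
structure Directions (W : G.Weblike r lam) where
  out : G.White → G.Edge
  white_out : ∀ w, G.white (out w) = w
  mult_out_pos : ∀ w, 0 < W.mult (out w)
  inc : G.Black → G.Edge
  black_inc : ∀ b, G.black (inc b) = Sum.inl b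
  mult_inc_pos : ∀ b, 0 < W.mult (inc b)

namespace Directions

variable {W : G.Weblike r lam} (D : W.Directions)

/-- The half of `e` at its white end is directed out of the white vertex. -/
def WhiteToBlackAtWhite (e : G.Edge) : Prop := ∃ w, D.out w = e

/-- The half of `e` at its black end is directed into the black vertex. -/
def WhiteToBlackAtBlack (e : G.Edge) : Prop := ∃ b, D.inc b = e

/-- The directed edges between interior vertices, that is, the edges of `W` both of whose halves
have the same direction. -/
inductive Flow : G.White ⊕ G.Black → G.White ⊕ G.Black → Prop
  | whiteToBlack (e : G.Edge) (b : G.Black) : G.black e = Sum.inl b → 0 < W.mult e →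
      D.WhiteToBlackAtWhite e → D.WhiteToBlackAtBlack e → Flow (Sum.inl (G.white e)) (Sum.inr b)
  | blackToWhite (e : G.Edge) (b : G.Black) : G.black e = Sum.inl b → 0 < W.mult e →
      ¬ D.WhiteToBlackAtWhite e → ¬ D.WhiteToBlackAtBlack e →
      Flow (Sum.inr b) (Sum.inl (G.white e))

end Directions

/-- A tagging of `W`: directions without oriented cycles, and a side for each tag. An edge is
tagged exactly when its halves disagree: it carries a pair tag when they point towards each other,
and a source tag when they point away from each other. If `blackFirst e` is true, the half at the
black end lies to the left of the tag of `e` when the tag points north, and otherwise the half at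
the white end does; the value is immaterial at untagged edges. -/
structure Tagging (W : G.Weblike r lam) extends W.Directions where
  acyclic : ∀ v, ¬ Relation.TransGen toDirections.Flow v v
  blackFirst : G.Edge → Bool

namespace Tagging

variable {W : G.Weblike r lam} {U : Type*} [AddCommGroup U] [Module ℂ U]

open Classical in
/-- Multiplicity of the half-edge of `e` at its black end. -/
noncomputable def blackHalfMult (O : W.Tagging) (e : G.Edge) : ℕ :=
  if O.WhiteToBlackAtBlack e then r - W.mult e else W.mult e

open Classical in
/-- Multiplicity of the half-edge of `e` at its white end. -/
noncomputable def whiteHalfMult (O : W.Tagging) (e : G.Edge) : ℕ :=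
  if O.WhiteToBlackAtWhite e then r - W.mult e else W.mult e

open Classical in
/-- The matrix entry contributed by the edge `e`, when the basis tensors on its halves at the black
end and at the white end are `E_B` and `E_A`: the identity for an untagged edge; for a pair tag the
wedge of the two tensors (the left one first) in `⋀^r(U) ≅ ℂ`; for a source tag the shuffle of
the volume form into the two tensors. -/
noncomputable def edgeEntry (E : Module.Basis (Fin r) ℂ U) (O : W.Tagging) (e : G.Edge)
    (B A : Finset (Fin r)) : ℂ :=
  if O.WhiteToBlackAtWhite e ↔ O.WhiteToBlackAtBlack e then
    (if B = A then 1 else 0)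
  else if O.WhiteToBlackAtWhite e then
    wedgeEntry E (if O.blackFirst e then [B, A] else [A, B]) Finset.univ
  else
    shuffleEntry Finset.univ (if O.blackFirst e then [B, A] else [A, B])

open Classical in
/-- The value of the tagged web on `E_𝒮`: place `E_{S_i}` at boundary vertex `i` and compose the
wedge, shuffle, pair and source morphisms along the web. The composite is written out in the bases
`E_S`, as the sum over all basis tensors on the interior half-edges of the products of the matrix
entries of the morphisms.

At a white vertex the factors are wedged in counterclockwise order after the outgoing edge. At a
black vertex the factors of the shuffle are in counterclockwise order after the incoming edge.
Edges outside `W` have multiplicity `0` and carry `E_∅ = 1`. -/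
noncomputable def value (E : Module.Basis (Fin r) ℂ U) (O : W.Tagging)
    (S : ∀ i, Set.powersetCard (Fin r) (lam i)) : ℂ :=
  ∑ T : (G.Edge → Finset (Fin r)) × (G.Edge → Finset (Fin r)) with
      (∀ e, (T.1 e).card = O.blackHalfMult e) ∧ (∀ e, (T.2 e).card = O.whiteHalfMult e) ∧
      ∀ e i, G.black e = Sum.inr i → T.1 e = (S i : Finset (Fin r)),
    (∏ e, O.edgeEntry E e (T.1 e) (T.2 e)) *
    (∏ w, wedgeEntry E ((cycleAfter G.rotWhite (O.out w)).map T.2) (T.2 (O.out w))) *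
    ∏ b, shuffleEntry (T.1 (O.inc b)) ((cycleAfter G.rotBlack (O.inc b)).map T.1)

/-- The linear functional `Ŵ(W, 𝒪)` of a tagged web. -/
noncomputable def functional (E : Module.Basis (Fin r) ℂ U) (O : W.Tagging) :
    FundamentalTensor U lam →ₗ[ℂ] ℂ :=
  (Basis.piTensorProduct fun i => E.exteriorPower (lam i)).constr ℂ (O.value E)

/-- The property characterizing `sign(W, 𝒪)`:
`Ŵ(E_𝒮) = sign(𝒮) sign(W, 𝒪) a(𝒮; W)` for all `𝒮`. (If not all colors occur equally often in
`𝒮`, both sides are zero.) -/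
def IsSign (E : Module.Basis (Fin r) ℂ U) (O : W.Tagging) (ε : ℤˣ) : Prop :=
  ∀ S : ∀ i, Set.powersetCard (Fin r) (lam i),
    O.functional E (basisTensor E S) =
      ((subsetSign (List.ofFn fun i => (S i : Finset (Fin r))) * (ε : ℤ) * W.labelingCount S : ℤ)
        : ℂ)

/-- The sign `sign(W, 𝒪)`. -/
noncomputable def sign (E : Module.Basis (Fin r) ℂ U) (O : W.Tagging) : ℤˣ :=
  Classical.epsilon (O.IsSign E)

/-- The tensor invariant `𝐖 = sign(W, 𝒪) Ŵ(W, 𝒪)`, computed with the tagging `𝒪`. -/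
noncomputable def invariant (E : Module.Basis (Fin r) ℂ U) (O : W.Tagging) :
    FundamentalTensor U lam →ₗ[ℂ] ℂ :=
  (((O.sign E : ℤˣ) : ℤ) : ℂ) • O.functional E

end Tagging

end DiskGraph.Weblike

/-! ### The `r`-fold boundary measurement -/

namespace DiskNetwork

variable {n r : ℕ} {lam : Fin n → ℕ}

/-- The weight of a weblike subgraph. -/
noncomputable def webWeight (N : DiskNetwork n) (W : N.Weblike r lam) : ℂ :=
  ∏ e, N.weight e ^ W.mult e

/-- The `r`-fold boundary measurement `Web_r(N; λ)`: the sum of `wt(W) 𝐖` over the `r`-weblike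
subgraphs of degree `λ`, where each `𝐖` is computed with the tagging `O W` of `W`. -/
noncomputable def web {U : Type*} [AddCommGroup U] [Module ℂ U] (E : Module.Basis (Fin r) ℂ U)
    (lam : Fin n → ℕ) (N : DiskNetwork n) (O : ∀ W : N.Weblike r lam, W.Tagging) :
    FundamentalTensor U lam →ₗ[ℂ] ℂ :=
  ∑ W : N.Weblike r lam, N.webWeight W • (O W).invariant E

/-- The invariants `𝐖` in the definition of `Web_r(N; λ)` are meaningful: every weblike subgraph
has a tagging, and `sign(W, 𝒪)` has its characterizing property for every tagging. -/
def WebsWellDefined {U : Type*} [AddCommGroup U] [Module ℂ U] (E : Module.Basis (Fin r) ℂ U)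
    (lam : Fin n → ℕ) (N : DiskNetwork n) : Prop :=
  ∀ W : N.Weblike r lam, Nonempty W.Tagging ∧ ∀ O : W.Tagging, O.IsSign E (O.sign E)

end DiskNetwork

/-! ### Inversion sums modulo two -/

/-! Everything is computed on the basis tensors `basisTensor E S`. When the composite of wedges,
shuffles and tags is expanded over labels of half-edges, exactly the consistent labelings of the web
survive, and each contributes a sign. Once that sign is known to be sign(S) times a constant of the
tagged web, `sign` exists and normalizing by it leaves sign(S) a(S; W). A consistent labeling of
some W is the same as a choice, for each color c, of a dimer configuration with boundary I_c = {i :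
c ∈ S_i}, and its weight is the product of the dimer weights. Hence `web_basisTensor`: the value of
the web sum at S is sign(S) ∏_c Δ_{I_c}(N). No tagging appears in it, and Δ_I vanishes unless I has
k elements, so it is determined by the cone point.

The sign has a local and a global part. Locally (`term_eq`), the complements carried by edges
directed white to black cancel in pairs, and what remains, up to a constant of the tagged web, is
the number of inversions of the words of labels around all vertices. Globally (`exists_total_sign`),
these words compare several orders on the pairs (edge, color) of a labeling. Inversion numbers
modulo two are additive along a chain of orders, and each link of the chain depends only on the
multiplicities or on S, except the comparison within one color of the orders of white and black
ends. That link is the sign of a dimer configuration, controlled by Kasteleyn signs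
(`exists_kasteleyn`).

Kasteleyn signs are obtained from the rotation system alone. The symmetric difference of two dimer
configurations is a cycle modulo two; by Euler's formula it is the boundary of a chain x of faces
(`exists_face_chain`). An identity for two permutations (`invSum_add_invSum_eq`) expresses the
product of the two dimer signs by a function of x which is linear on face chains and vanishes on
chains without boundary. It therefore factors through the boundary map, which is to say that it is a
sum of contributions of edges.

Invariance comes from a second description of the web sum (`web_mem_tensorInvariants`). With m white
vertices, send x_1 ⊗ ⋯ ⊗ x_n to the top form on ℂ^m ⊗ U of the wedge of the x_i, tensored with the
columns of a Kasteleyn matrix, followed by the volume forms of the interior black vertices tensored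
with theirs. This is visibly SL(U)-invariant, and its expansion is the same sum over colorings up to
one global sign. -/

section InversionSums

/-- The indicator of `a < b`, modulo two. -/
def ltInd {α : Type*} [LinearOrder α] (a b : α) : ZMod 2 := if a < b then 1 else 0

@[simp] lemma ltInd_self {α : Type*} [LinearOrder α] (a : α) : ltInd a a = 0 := by
  simp [ltInd]

lemma ltInd_add_swap {α : Type*} [LinearOrder α] {a b : α} (h : a ≠ b) :
    ltInd a b + ltInd b a = 1 := by
  rcases lt_or_gt_of_ne h with h | h <;> simp [ltInd, h, h.not_gt]

lemma zmod_two_mul_self (a : ZMod 2) : a * a = a := by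
  revert a; decide

lemma zmod_two_add_self (a : ZMod 2) : a + a = 0 := CharTwo.add_self_eq_zero a

variable {E α β γ : Type*}

/-- The function `f` is injective on the support of the weight `x`. -/
def InjWeight (x : E → ZMod 2) (f : E → α) : Prop :=
  ∀ p q, x p ≠ 0 → x q ≠ 0 → f p = f q → p = q

lemma Function.Injective.injWeight {f : E → α} (hf : Function.Injective f) (x : E → ZMod 2) :
    InjWeight x f := fun _ _ _ _ h => hf h

/-- Modulo two the sum records whether the two orders disagree on the pair, a property of the
unordered pair. This supplies the symmetry needed by `pairSum_eq_pairSum`. -/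
lemma ltInd_add_symm [LinearOrder α] [LinearOrder β] {x : E → ZMod 2} {f : E → α}
    {g : E → β} (hf : InjWeight x f)
    (hg : InjWeight x g) (p q : E) (hp : x p ≠ 0) (hq : x q ≠ 0) (hpq : p ≠ q) :
    ltInd (f p) (f q) + ltInd (g p) (g q) = ltInd (f q) (f p) + ltInd (g q) (g p) := by
  have h1 := ltInd_add_swap (fun h => hpq (hf p q hp hq h))
  have h2 := ltInd_add_swap (fun h => hpq (hg p q hp hq h))
  generalize ltInd (f p) (f q) = a at *
  generalize ltInd (f q) (f p) = b at *
  generalize ltInd (g p) (g q) = c at *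
  generalize ltInd (g q) (g p) = d at *
  revert a b c d; decide

lemma mul_ltInd_add_swap [LinearOrder α] [LinearOrder β] {f : E → α} {g : E → β}
    (hf : f.Injective) (hg : g.Injective) (p q : E) :
    ltInd (f p) (f q) * ltInd (g q) (g p) + ltInd (f q) (f p) * ltInd (g p) (g q)
      = ltInd (f q) (f p) + ltInd (g q) (g p) := by
  by_cases hpq : p = q
  · subst hpq; simp
  have h1 := ltInd_add_swap (hf.ne hpq)
  have h2 := ltInd_add_swap (hg.ne hpq)
  generalize ltInd (f p) (f q) = a at *
  generalize ltInd (f q) (f p) = b at *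
  generalize ltInd (g p) (g q) = c at *
  generalize ltInd (g q) (g p) = d at *
  revert a b c d; decide

variable [Fintype E] [LinearOrder α] [LinearOrder β] [LinearOrder γ]

/-- The number of pairs, weighted by `x`, whose orders under `f` and `g` disagree. -/
def invSum (x : E → ZMod 2) (f : E → α) (g : E → β) : ZMod 2 :=
  ∑ p, ∑ q, x p * x q * (ltInd (f p) (f q) * ltInd (g q) (g p))

/-- The sum of `F` over pairs, each listed once in the order given by `f`. -/
def pairSum (x : E → ZMod 2) (f : E → α) (F : E → E → ZMod 2) : ZMod 2 :=
  ∑ p, ∑ q, x p * x q * (ltInd (f p) (f q) * F p q)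

/-- For symmetric `F` this is a sum over unordered pairs, so the order used to list each pair once
is immaterial. -/
lemma pairSum_eq_pairSum {x : E → ZMod 2} {f : E → α} {g : E → β} (hf : InjWeight x f)
    (hg : InjWeight x g) {F : E → E → ZMod 2}
    (hF : ∀ p q, x p ≠ 0 → x q ≠ 0 → p ≠ q → F p q = F q p) :
    pairSum x f F = pairSum x g F := by
  have h1 : pairSum x f F = ∑ p, ∑ q, x p * x q *
      (ltInd (f p) (f q) * (ltInd (g p) (g q) + ltInd (g q) (g p)) * F p q) := by
    refine Finset.sum_congr rfl fun p _ => Finset.sum_congr rfl fun q _ => ?_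
    by_cases hp : x p = 0
    · simp [hp]
    by_cases hq : x q = 0
    · simp [hq]
    by_cases hpq : p = q
    · subst hpq; simp
    · rw [ltInd_add_swap (fun h => hpq (hg p q hp hq h)), mul_one]
  have h2 : pairSum x g F = ∑ p, ∑ q, x p * x q *
      ((ltInd (f p) (f q) + ltInd (f q) (f p)) * ltInd (g p) (g q) * F p q) := by
    refine Finset.sum_congr rfl fun p _ => Finset.sum_congr rfl fun q _ => ?_
    by_cases hp : x p = 0
    · simp [hp]
    by_cases hq : x q = 0
    · simp [hq]
    by_cases hpq : p = q
    · subst hpq; simp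
    · rw [ltInd_add_swap (fun h => hpq (hf p q hp hq h)), one_mul]
  rw [h1, h2]
  simp only [mul_add, add_mul, Finset.sum_add_distrib]
  congr 1
  rw [Finset.sum_comm]
  refine Finset.sum_congr rfl fun p _ => Finset.sum_congr rfl fun q _ => ?_
  by_cases hp : x p = 0
  · simp [hp]
  by_cases hq : x q = 0
  · simp [hq]
  by_cases hpq : p = q
  · subst hpq; simp
  · rw [hF q p hq hp (Ne.symm hpq)]; ring

lemma invSum_eq_pairSum {x : E → ZMod 2} {f : E → α} {g : E → β} (hg : InjWeight x g) :
    invSum x f g = pairSum x f fun p q => ltInd (f p) (f q) + ltInd (g p) (g q) := by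
  refine Finset.sum_congr rfl fun p _ => Finset.sum_congr rfl fun q _ => ?_
  by_cases hp : x p = 0
  · simp [hp]
  by_cases hq : x q = 0
  · simp [hq]
  by_cases hpq : p = q
  · subst hpq; simp
  · have h := ltInd_add_swap (fun h => hpq (hg p q hp hq h))
    have h' : ltInd (g q) (g p) = 1 + ltInd (g p) (g q) := by
      rw [← h, add_right_comm, zmod_two_add_self, zero_add]
    rw [mul_add, zmod_two_mul_self, h', mul_add, mul_one]

/-- Inversion sums are additive along chains of orders. -/
lemma invSum_add_invSum {x : E → ZMod 2} {f : E → α} {g : E → β} {h : E → γ}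
    (hf : InjWeight x f) (hg : InjWeight x g) (hh : InjWeight x h) :
    invSum x f g + invSum x g h = invSum x f h := by
  -- With all pairs listed in the order `f`, the indicators of `g` occur twice and cancel.
  rw [invSum_eq_pairSum hg, invSum_eq_pairSum hh, invSum_eq_pairSum hh,
    pairSum_eq_pairSum hg hf (ltInd_add_symm hg hh)]
  simp only [pairSum, ← Finset.sum_add_distrib]
  refine Finset.sum_congr rfl fun p _ => Finset.sum_congr rfl fun q _ => ?_
  linear_combination x p * x q * ltInd (f p) (f q) * zmod_two_add_self (ltInd (g p) (g q))

lemma invSum_comm (x : E → ZMod 2) (f : E → α) (g : E → β) : invSum x f g = invSum x g f := by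
  unfold invSum
  rw [Finset.sum_comm]
  refine Finset.sum_congr rfl fun p _ => Finset.sum_congr rfl fun q _ => ?_
  ring

lemma invSum_comp_perm (x : E → ZMod 2) (f : E → α) (g : E → β) (σ : Equiv.Perm E) :
    invSum (x ∘ σ) (f ∘ σ) (g ∘ σ) = invSum x f g := by
  unfold invSum
  rw [← Equiv.sum_comp σ fun p => ∑ q, x p * x q * (ltInd (f p) (f q) * ltInd (g q) (g p))]
  refine Finset.sum_congr rfl fun p _ => ?_
  exact Equiv.sum_comp σ fun q => x (σ p) * x q *
    (ltInd (f (σ p)) (f q) * ltInd (g q) (g (σ p)))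

/-- Polarization of the inversion sum, as a quadratic form in the weight. -/
lemma invSum_add_weight {f : E → α} {g : E → β} (hf : f.Injective) (hg : g.Injective)
    (x y : E → ZMod 2) :
    invSum (x + y) f g = invSum x f g + invSum y f g +
      ∑ p, x p * (∑ q, y q * ltInd (f q) (f p) + ∑ q, y q * ltInd (g q) (g p)) := by
  have h : ∑ p, x p * (∑ q, y q * ltInd (f q) (f p) + ∑ q, y q * ltInd (g q) (g p))
      = ∑ p, ∑ q, x p * y q * (ltInd (f p) (f q) * ltInd (g q) (g p))
        + ∑ p, ∑ q, y p * x q * (ltInd (f p) (f q) * ltInd (g q) (g p)) := by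
    rw [Finset.sum_comm (f := fun p q => y p * x q * (ltInd (f p) (f q) * ltInd (g q) (g p)))]
    rw [← Finset.sum_add_distrib]
    refine Finset.sum_congr rfl fun p _ => ?_
    rw [← Finset.sum_add_distrib, ← Finset.sum_add_distrib, Finset.mul_sum]
    refine Finset.sum_congr rfl fun q _ => ?_
    linear_combination (-(x p * y q)) * mul_ltInd_add_swap hf hg p q
  rw [h]
  simp only [invSum, ← Finset.sum_add_distrib, Pi.add_apply]
  refine Finset.sum_congr rfl fun p _ => Finset.sum_congr rfl fun q _ => ?_
  ring

end InversionSums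

/-! ### Ranks compatible with a permutation, and the Kasteleyn identity -/

/-- A numbering of the cycles of a permutation together with a base point in each cycle. -/
structure CycleRank {E : Type*} (σ : Equiv.Perm E) where
  index : E → ℕ
  sameCycle_iff : ∀ e e', σ.SameCycle e e' ↔ index e = index e'
  base : E → E
  index_base : ∀ e, index (base e) = index e
  base_eq : ∀ e e', index e = index e' → base e = base e'

namespace CycleRank

variable {E : Type*} {σ : Equiv.Perm E} (R : CycleRank σ)

lemma base_base (e : E) : R.base (R.base e) = R.base e := R.base_eq _ _ (R.index_base e)

lemma index_apply (e : E) : R.index (σ e) = R.index e :=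
  ((R.sameCycle_iff _ _).1 (Equiv.Perm.sameCycle_apply_left.2 (Equiv.Perm.SameCycle.refl σ e)))

lemma base_apply (e : E) : R.base (σ e) = R.base e := R.base_eq _ _ (R.index_apply e)

section Finite

variable [Finite E]

lemma exists_pow_base (e : E) : ∃ t : ℕ, (σ ^ t) (R.base e) = e :=
  ((R.sameCycle_iff _ _).2 (R.index_base e)).exists_nat_pow_eq

open Classical in
/-- The number of steps from the base point. -/
noncomputable def pos (e : E) : ℕ := Nat.find (R.exists_pow_base e)

lemma pow_pos (e : E) : (σ ^ R.pos e) (R.base e) = e := by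
  classical exact Nat.find_spec (R.exists_pow_base e)

lemma pos_le {e : E} {t : ℕ} (h : (σ ^ t) (R.base e) = e) : R.pos e ≤ t := by
  classical exact Nat.find_min' (R.exists_pow_base e) h

lemma pos_inj {e e' : E} (h : R.index e = R.index e') (h' : R.pos e = R.pos e') : e = e' := by
  rw [← R.pow_pos e, ← R.pow_pos e', h', R.base_eq _ _ h]

lemma pos_base (e : E) : R.pos (R.base e) = 0 :=
  Nat.le_zero.1 (R.pos_le (by rw [R.base_base]; rfl))

lemma pos_eq_zero_iff (e : E) : R.pos e = 0 ↔ R.base e = e := by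
  constructor
  · intro h
    have := R.pow_pos e
    rwa [h] at this
  · intro h
    rw [← h, R.pos_base]

lemma pos_apply {e : E} (h : σ e ≠ R.base e) : R.pos (σ e) = R.pos e + 1 := by
  apply le_antisymm
  · apply R.pos_le
    rw [R.base_apply, pow_succ', Equiv.Perm.mul_apply, R.pow_pos]
  · have h1 := R.pow_pos (σ e)
    rcases hp : R.pos (σ e) with _ | s
    · rw [hp, R.base_apply] at h1
      exact absurd h1.symm h
    · rw [hp, R.base_apply, pow_succ', Equiv.Perm.mul_apply, σ.injective.eq_iff] at h1
      have := R.pos_le h1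
      omega

lemma pos_apply_le (e : E) : R.pos (σ e) ≤ R.pos e + 1 := by
  by_cases h : σ e = R.base e
  · rw [h, R.pos_base]; omega
  · rw [R.pos_apply h]

/-- The predecessor of the base point is the last element of its cycle: from there the powers of `σ`
only repeat earlier elements. -/
lemma pos_le_of_apply_eq_base {e e' : E} (h : σ e = R.base e) (hi : R.index e' = R.index e) :
    R.pos e' ≤ R.pos e := by
  by_contra! hlt
  have h1 : (σ ^ (R.pos e + 1)) (R.base e) = R.base e := by
    rw [pow_succ', Equiv.Perm.mul_apply, R.pow_pos, h]
  have h2 := R.pow_pos e'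
  rw [R.base_eq _ _ hi] at h2
  obtain ⟨s, hs⟩ := Nat.exists_eq_add_of_le (Nat.succ_le_of_lt hlt)
  rw [hs, add_comm, pow_add, Equiv.Perm.mul_apply, Nat.succ_eq_add_one, h1,
    ← R.base_eq _ _ hi] at h2
  have := R.pos_le h2
  omega

/-- The rank of an element: cycles in the order of their indices, and elements of a cycle in
cyclic order from the base point. -/
noncomputable def rank (e : E) : ℕ ×ₗ ℕ := toLex (R.index e, R.pos e)

lemma rank_lt_rank {e e' : E} : R.rank e < R.rank e' ↔
    R.index e < R.index e' ∨ R.index e = R.index e' ∧ R.pos e < R.pos e' :=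
  Prod.Lex.toLex_lt_toLex

lemma rank_injective : Function.Injective R.rank := by
  intro e e' h
  have h' : (R.index e, R.pos e) = (R.index e', R.pos e') := h
  rw [Prod.mk.injEq] at h'
  exact R.pos_inj h'.1 h'.2

end Finite

variable [Fintype E] [DecidableEq E]

/-- Partial sums of a coboundary. -/
lemma sum_mul_ltInd_rank {x d : E → ZMod 2} (hx : ∀ e, x (σ e) = x e + d e) (e : E) :
    ∑ q, d q * ltInd (R.rank q) (R.rank e) = x e + x (R.base e) := by
  have hd : ∀ q, d q = x (σ q) + x q := fun q => by
    rw [hx q, add_right_comm, zmod_two_add_self, zero_add]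
  have hsplit : ∀ e q, ltInd (R.rank q) (R.rank e) = ltInd (R.index q) (R.index e) +
      if R.index q = R.index e ∧ R.pos q < R.pos e then 1 else 0 := by
    intro e q
    unfold ltInd
    simp only [R.rank_lt_rank]
    by_cases h : R.index q < R.index e
    · simp [h, h.ne]
    · simp [h]
  -- Complete earlier cycles contribute nothing, since a coboundary sums to zero over a cycle. What
  -- is left telescopes along the cycle of `e`, by induction on the position.
  have h1 : ∑ q, d q * ltInd (R.index q) (R.index e) = 0 := by
    simp only [hd, add_mul, Finset.sum_add_distrib]
    have := Equiv.sum_comp σ fun q => x q * ltInd (R.index q) (R.index e)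
    simp only [R.index_apply] at this
    rw [this, zmod_two_add_self]
  simp only [hsplit, mul_add, Finset.sum_add_distrib, h1, zero_add]
  clear hsplit h1
  induction ht : R.pos e generalizing e with
  | zero =>
    simp [(R.pos_eq_zero_iff e).1 ht, zmod_two_add_self]
  | succ t ih =>
    obtain ⟨e', rfl⟩ := σ.surjective e
    have hb : σ e' ≠ R.base e' := fun h => by
      rw [h, R.pos_base] at ht; omega
    rw [R.pos_apply hb, Nat.add_right_cancel_iff] at ht
    rw [R.base_apply, R.index_apply, hx]
    have hsplit : ∀ q, (if R.index q = R.index e' ∧ R.pos q < t + 1 then 1 else 0 : ZMod 2) =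
        (if R.index q = R.index e' ∧ R.pos q < t then 1 else 0) + if q = e' then 1 else 0 := by
      intro q
      by_cases hq : q = e'
      · subst hq; simp [ht]
      · by_cases hi : R.index q = R.index e'
        · have : R.pos q ≠ t := fun h => hq (R.pos_inj hi (h.trans ht.symm))
          have h2 : R.pos q < t + 1 ↔ R.pos q < t := by omega
          simp [hi, hq, h2]
        · simp [hi, hq]
    simp only [hsplit, mul_add, Finset.sum_add_distrib, ih e' ht]
    simp
    ring

/-- Moving every element one step along its cycle keeps the order of ranks, except that the last
element of a cycle jumps to the base point, in front of all the others. -/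
lemma ltInd_rank_mul_ltInd_rank (p q : E) :
    ltInd (R.rank p) (R.rank q) * ltInd (R.rank (σ q)) (R.rank (σ p)) =
      if R.base (σ p) = σ q ∧ σ p ≠ σ q then 1 else 0 := by
  have key : (R.rank p < R.rank q ∧ R.rank (σ q) < R.rank (σ p)) ↔
      (R.base (σ p) = σ q ∧ σ p ≠ σ q) := by
    rw [R.rank_lt_rank, R.rank_lt_rank, R.index_apply, R.index_apply, R.base_apply]
    constructor
    · rintro ⟨h1, h2⟩
      have hi : R.index p = R.index q := by omega
      have h1' : R.pos p < R.pos q := by omega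
      have h2' : R.pos (σ q) < R.pos (σ p) := by omega
      refine ⟨?_, fun h => by rw [h] at h2'; omega⟩
      rw [R.base_eq _ _ hi]
      by_contra hb
      rw [R.pos_apply (Ne.symm hb)] at h2'
      have := R.pos_apply_le p
      omega
    · rintro ⟨h1, h2⟩
      have hi : R.index p = R.index q := by
        rw [← R.index_base, h1, R.index_apply]
      have h1' : σ q = R.base q := by rw [← h1, R.base_eq _ _ hi]
      have h3 := R.pos_le_of_apply_eq_base h1' hi
      have h4 : R.pos p ≠ R.pos q := fun h => h2 (by rw [R.pos_inj hi h])
      have h5 : R.pos (σ q) = 0 := by rw [h1', R.pos_base]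
      have h6 : R.pos (σ p) ≠ 0 := fun h => h2
        (R.pos_inj (by rw [R.index_apply, R.index_apply, hi]) (by rw [h, h5]))
      omega
  unfold ltInd
  rw [ite_zero_mul_ite_zero, mul_one]
  exact if_congr key rfl rfl

/-- The number of inversions of a permutation that rotates the cycles. -/
lemma invSum_rank_comp (x : E → ZMod 2) :
    invSum (x ∘ σ) R.rank (R.rank ∘ σ) =
      ∑ e, x e * x (R.base e) + ∑ e, if R.base e = e then x e else 0 := by
  have h1 : invSum (x ∘ σ) R.rank (R.rank ∘ σ) =
      ∑ p, ∑ q, x p * x q * if R.base p = q ∧ p ≠ q then 1 else 0 := by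
    rw [← Equiv.sum_comp σ fun p => ∑ q, x p * x q * if R.base p = q ∧ p ≠ q then 1 else 0]
    refine Finset.sum_congr rfl fun p _ => ?_
    rw [← Equiv.sum_comp σ fun q => x (σ p) * x q * if R.base (σ p) = q ∧ σ p ≠ q then 1 else 0]
    refine Finset.sum_congr rfl fun q _ => ?_
    simp only [Function.comp_apply, R.ltInd_rank_mul_ltInd_rank]
  rw [h1, ← Finset.sum_add_distrib]
  refine Finset.sum_congr rfl fun p _ => ?_
  have h2 : ∀ q, x p * x q * (if R.base p = q ∧ p ≠ q then 1 else 0 : ZMod 2) =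
      if R.base p = q then (x p * x q * if p ≠ q then 1 else 0) else 0 := by
    intro q
    by_cases h : R.base p = q <;> simp [h]
  simp only [h2, Finset.sum_ite_eq, Finset.mem_univ, if_true]
  by_cases h : R.base p = p
  · simp [h, zmod_two_mul_self, zmod_two_add_self]
  · simp [h, Ne.symm h]

end CycleRank

section Kasteleyn

variable {E : Type*} [Fintype E] [DecidableEq E] {σ τ : Equiv.Perm E}

/-- Kasteleyn's identity for a pair of permutations. Here `x` is a `ZMod 2`-chain of faces with
boundary `d = u + u'`. -/
theorem invSum_add_invSum_eq (R : CycleRank σ) (R' : CycleRank τ⁻¹) {x u u' : E → ZMod 2}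
    (hσ : ∀ e, x (σ e) = x e + (u e + u' e)) (hτ : ∀ e, x (τ⁻¹ e) = x e + (u e + u' e)) :
    invSum u R.rank R'.rank + invSum u' R.rank R'.rank
        + invSum x R.rank (R.rank ∘ (σ * τ : Equiv.Perm E)) =
      ∑ e, u e * (x (R.base e) + x (R'.base e)) + (∑ e, if R.base e = e then x e else 0)
        + ∑ e, if R'.base e = e then x e else 0 := by
  obtain ⟨d, hd⟩ : ∃ d : E → ZMod 2, d = u + u' := ⟨_, rfl⟩
  have hσ' : ∀ e, x (σ e) = x e + d e := fun e => by rw [hσ, hd]; rfl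
  have hτ' : ∀ e, x (τ⁻¹ e) = x e + d e := fun e => by rw [hτ, hd]; rfl
  have hu' : u' = u + d := by
    ext e; rw [hd]
    simp only [Pi.add_apply]
    rw [← add_assoc, zmod_two_add_self, zero_add]
  have hA := R.rank_injective
  have hB := R'.rank_injective
  have q1 := invSum_add_weight hA hB u d
  have q2 := invSum_add_weight hA hB x d
  -- The polarization terms become explicit because `d` is a coboundary of `x` along both `σ` and
  -- `τ⁻¹`.
  simp only [R.sum_mul_ltInd_rank hσ', R'.sum_mul_ltInd_rank hτ'] at q1 q2
  have yσ : x + d = x ∘ σ := by ext e; exact (hσ' e).symm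
  have yτ : x + d = x ∘ (τ⁻¹ : Equiv.Perm E) := by ext e; exact (hτ' e).symm
  have xy : x = (x + d) ∘ τ := by
    rw [yτ]; ext e; simp
  -- The order is carried from `R.rank` to its translate by `σ * τ` through `R'.rank` and its
  -- translate by `τ`. The two changes between white and black orders involve `x` and `x + d`, and
  -- the two others are rotations of cycles.
  have c1 : invSum x R.rank (R.rank ∘ (σ * τ : Equiv.Perm E)) =
      invSum x R.rank R'.rank + invSum x R'.rank (R'.rank ∘ τ) +
        invSum x (R'.rank ∘ τ) (R.rank ∘ τ) +
        invSum x (R.rank ∘ τ) (R.rank ∘ (σ * τ : Equiv.Perm E)) := by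
    have iτ := (hB.comp τ.injective).injWeight x
    have iτ' := (hA.comp τ.injective).injWeight x
    have iφ := (hA.comp (σ * τ : Equiv.Perm E).injective).injWeight x
    rw [invSum_add_invSum (hA.injWeight x) (hB.injWeight x) iτ,
      invSum_add_invSum (hA.injWeight x) iτ iτ', invSum_add_invSum (hA.injWeight x) iτ' iφ]
  have c2 : invSum x (R'.rank ∘ τ) (R.rank ∘ τ) = invSum (x + d) R.rank R'.rank := by
    conv_lhs => rw [xy]
    rw [invSum_comp_perm, invSum_comm]
  have c3 : invSum x (R.rank ∘ τ) (R.rank ∘ (σ * τ : Equiv.Perm E)) =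
      invSum (x ∘ σ) R.rank (R.rank ∘ σ) := by
    conv_lhs => rw [xy]
    rw [← yσ]
    exact invSum_comp_perm _ _ (R.rank ∘ σ) τ
  -- `R'` is a rank for `τ⁻¹`, so both orders are translated by `τ⁻¹` to reach the form of
  -- `invSum_rank_comp`.
  have c4 : invSum x R'.rank (R'.rank ∘ τ) =
      invSum (x ∘ (τ⁻¹ : Equiv.Perm E)) R'.rank (R'.rank ∘ (τ⁻¹ : Equiv.Perm E)) := by
    have h := invSum_comp_perm (x ∘ (τ⁻¹ : Equiv.Perm E)) R'.rank
      (R'.rank ∘ (τ⁻¹ : Equiv.Perm E)) τ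
    have hτ : (τ⁻¹ : Equiv.Perm E) ∘ τ = id := by ext e; simp
    rw [← h, Function.comp_assoc, Function.comp_assoc, hτ, Function.comp_id, Function.comp_id,
      invSum_comm]
  rw [c1, c2, c3, c4, R.invSum_rank_comp, R'.invSum_rank_comp, hu', q1, q2]
  simp only [mul_add, Finset.sum_add_distrib]
  have e1 := zmod_two_add_self (invSum u R.rank R'.rank)
  have e2 := zmod_two_add_self (invSum x R.rank R'.rank)
  have e3 := zmod_two_add_self (invSum d R.rank R'.rank)
  have e4 := zmod_two_add_self (∑ e, u e * x e)
  have e5 := zmod_two_add_self (∑ e, x e * x e)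
  have e6 := zmod_two_add_self (∑ e, x e * x (R.base e))
  have e7 := zmod_two_add_self (∑ e, x e * x (R'.base e))
  linear_combination e1 + e2 + e3 + e4 + e5 + e6 + e7

lemma invSum_comp_add {E : Type*} [Fintype E] {f : E → ℕ ×ₗ ℕ} (hf : f.Injective)
    {φ : Equiv.Perm E} {x y : E → ZMod 2}
    (hy : ∀ e, y (φ e) = y e) :
    invSum (x + y) f (f ∘ φ) = invSum x f (f ∘ φ) + invSum y f (f ∘ φ) +
      ∑ p, x p * (∑ q, y q * ltInd (f q) (f p) + ∑ q, y q * ltInd (f q) (f (φ p))) := by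
  rw [invSum_add_weight hf (hf.comp φ.injective)]
  congr 1
  refine Finset.sum_congr rfl fun p _ => ?_
  congr 2
  rw [← Equiv.sum_comp φ fun q => y q * ltInd (f q) (f (φ p))]
  simp [hy]

/-- On chains invariant under `φ`, the inversion sum of `φ` is additive. -/
lemma invSum_comp_add_of_invariant {E : Type*} [Fintype E] {f : E → ℕ ×ₗ ℕ} (hf : f.Injective)
    {φ : Equiv.Perm E}
    {x y : E → ZMod 2} (hx : ∀ e, x (φ e) = x e) (hy : ∀ e, y (φ e) = y e) :
    invSum (x + y) f (f ∘ φ) = invSum x f (f ∘ φ) + invSum y f (f ∘ φ) := by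
  rw [invSum_comp_add hf hy]
  -- The two halves of the polarization term differ by the reindexing `φ`, under which `x` is
  -- invariant, so they cancel.
  have h := Equiv.sum_comp φ fun p => x p * ∑ q, y q * ltInd (f q) (f p)
  simp only [hx] at h
  simp only [mul_add, Finset.sum_add_distrib, h, zmod_two_add_self, add_zero]

end Kasteleyn

/-! ### Planarity: cycles are boundaries of sets of faces -/

section Planarity

/-- The functions with values in `ZMod 2` that are constant on the classes of a setoid. -/
def classFunctions {E : Type} (s : Setoid E) : Submodule (ZMod 2) (E → ZMod 2) where
  carrier := {x | ∀ e e', s e e' → x e = x e'}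
  add_mem' := fun hx hy e e' h => by simp only [Pi.add_apply, hx e e' h, hy e e' h]
  zero_mem' := fun _ _ _ => rfl
  smul_mem' := fun c x hx e e' h => by simp only [Pi.smul_apply, hx e e' h]

/-- Turns the numbers of vertices, faces and components in Euler's formula into dimensions of spaces
of chains. -/
lemma finrank_classFunctions {E : Type} [Finite E] (s : Setoid E) :
    Module.finrank (ZMod 2) (classFunctions s) = Nat.card (Quotient s) := by
  have := Fintype.ofFinite (Quotient s)
  let f : (Quotient s → ZMod 2) ≃ₗ[ZMod 2] classFunctions s :=
    { toFun := fun x => ⟨fun e => x (Quotient.mk s e), fun e e' h =>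
        congrArg x (Quotient.sound (s := s) h)⟩
      map_add' := fun _ _ => rfl
      map_smul' := fun _ _ => rfl
      invFun := fun x q => Quotient.lift x.1 x.2 q
      left_inv := fun x => by
        ext q
        induction q using Quotient.inductionOn
        rfl
      right_inv := fun x => rfl }
  rw [← f.finrank_eq, Module.finrank_fintype_fun_eq_card, Nat.card_eq_fintype_card]

lemma mem_classFunctions_sameCycle {E : Type} [Finite E] {σ : Equiv.Perm E} {x : E → ZMod 2} :
    x ∈ classFunctions (Equiv.Perm.SameCycle.setoid σ) ↔ ∀ e, x (σ e) = x e := by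
  constructor
  · intro h e
    exact h _ _ (Equiv.Perm.sameCycle_apply_left.2 (Equiv.Perm.SameCycle.refl σ e))
  · intro h e e' hee
    obtain ⟨t, rfl⟩ := Equiv.Perm.SameCycle.exists_nat_pow_eq hee
    induction t with
    | zero => rfl
    | succ t ih =>
      rw [pow_succ', Equiv.Perm.mul_apply, h]
      exact ih ⟨t, by simp⟩

lemma mem_classFunctions_orbitRel {E : Type} {σ τ : Equiv.Perm E} {x : E → ZMod 2} :
    x ∈ classFunctions (MulAction.orbitRel (Subgroup.closure {σ, τ}) E) ↔
      (∀ e, x (σ e) = x e) ∧ ∀ e, x (τ e) = x e := by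
  constructor
  · intro h
    exact ⟨fun e => h _ _ ⟨⟨σ, Subgroup.subset_closure (by simp)⟩, rfl⟩,
      fun e => h _ _ ⟨⟨τ, Subgroup.subset_closure (by simp)⟩, rfl⟩⟩
  · rintro ⟨hσ, hτ⟩ e e' ⟨⟨g, hg⟩, rfl⟩
    change x (g e') = x e'
    induction hg using Subgroup.closure_induction generalizing e' with
    | mem g hg =>
      rcases hg with rfl | rfl
      · exact hσ e'
      · exact hτ e'
    | one => rfl
    | mul g h _ _ ihg ihh => rw [Equiv.Perm.mul_apply, ihg, ihh]
    | inv g _ ih => rw [← ih, Equiv.Perm.coe_inv, Equiv.apply_symm_apply]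

variable {E : Type} [Fintype E] {σ τ : Equiv.Perm E}

open Classical in
/-- In genus zero, a `ZMod 2`-chain of edges whose boundary vanishes is the boundary of a chain of
faces. -/
theorem exists_face_chain
    (planar : cycleCount σ + cycleCount τ + cycleCount (σ * τ)
      = Fintype.card E + 2 * jointOrbitCount σ τ) {d : E → ZMod 2}
    (hσ : ∀ x : E → ZMod 2, (∀ e, x (σ e) = x e) → ∑ e, x e * d e = 0)
    (hτ : ∀ x : E → ZMod 2, (∀ e, x (τ e) = x e) → ∑ e, x e * d e = 0) :
    ∃ x : E → ZMod 2, (∀ e, x (σ e) = x e + d e) ∧ ∀ e, x (τ⁻¹ e) = x e + d e := by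
  set Vσ := classFunctions (Equiv.Perm.SameCycle.setoid σ) with hVσ
  set Vτ := classFunctions (Equiv.Perm.SameCycle.setoid τ) with hVτ
  set Vφ := classFunctions (Equiv.Perm.SameCycle.setoid (σ * τ)) with hVφ
  set V := classFunctions (MulAction.orbitRel (Subgroup.closure {σ, τ}) E) with hV
  have fσ : Module.finrank (ZMod 2) Vσ = cycleCount σ := finrank_classFunctions _
  have fτ : Module.finrank (ZMod 2) Vτ = cycleCount τ := finrank_classFunctions _
  have fφ : Module.finrank (ZMod 2) Vφ = cycleCount (σ * τ) := finrank_classFunctions _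
  have fV : Module.finrank (ZMod 2) V = jointOrbitCount σ τ := finrank_classFunctions _
  have hinf : Vσ ⊓ Vτ = V := by
    ext x
    rw [Submodule.mem_inf, hVσ, hVτ, hV, mem_classFunctions_sameCycle,
      mem_classFunctions_sameCycle, mem_classFunctions_orbitRel]
  have hsup := Submodule.finrank_sup_add_finrank_inf_eq Vσ Vτ
  rw [hinf, fσ, fτ, fV] at hsup
  -- The boundary map from faces to edges: an edge separates the face of `e` from the face of `τ⁻¹
  -- e`. On `Vφ` the latter is also the face of `σ e`.
  let D : (E → ZMod 2) →ₗ[ZMod 2] (E → ZMod 2) :=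
    LinearMap.id + LinearMap.funLeft (ZMod 2) (ZMod 2) (τ⁻¹ : Equiv.Perm E)
  have hD : ∀ x e, D x e = x e + x (τ⁻¹ e) := fun x e => rfl
  have hφ : ∀ x ∈ Vφ, ∀ e, x (σ e) = x (τ⁻¹ e) := by
    intro x hx e
    have := mem_classFunctions_sameCycle.1 hx (τ⁻¹ e)
    simpa using this
  have hker : Module.finrank (ZMod 2) (LinearMap.ker (D.domRestrict Vφ)) =
      jointOrbitCount σ τ := by
    rw [← fV, ← Submodule.finrank_map_subtype_eq Vφ]
    suffices h : (LinearMap.ker (D.domRestrict Vφ)).map Vφ.subtype = V by rw [h]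
    ext x
    simp only [Submodule.mem_map, LinearMap.mem_ker, Submodule.subtype_apply, Subtype.exists,
      exists_and_right, exists_eq_right, LinearMap.domRestrict_apply]
    rw [hV, mem_classFunctions_orbitRel]
    constructor
    · rintro ⟨hx, h0⟩
      have h1 : ∀ e, x (τ⁻¹ e) = x e := fun e => by
        have := congrFun h0 e
        rw [hD, Pi.zero_apply] at this
        exact (CharTwo.add_eq_zero.1 this).symm
      refine ⟨fun e => by rw [hφ x hx, h1], fun e => ?_⟩
      have := h1 (τ e)
      simpa using this.symm
    · rintro ⟨h1, h2⟩
      refine ⟨mem_classFunctions_sameCycle.2 fun e => by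
        rw [Equiv.Perm.mul_apply, h1, h2], ?_⟩
      ext e
      have : x e = x (τ⁻¹ e) := by simpa using h2 (τ⁻¹ e)
      rw [hD, ← this, zmod_two_add_self, Pi.zero_apply]
  have hrange := LinearMap.finrank_range_add_finrank_ker (D.domRestrict Vφ)
  rw [hker, fφ] at hrange
  let B : LinearMap.BilinForm (ZMod 2) (E → ZMod 2) := Matrix.toBilin' 1
  have hB : ∀ x y, B x y = ∑ e, x e * y e := fun x y => by
    simp [B, Matrix.toBilin'_apply', dotProduct]
  have hBn : B.Nondegenerate := by
    rw [LinearMap.BilinForm.nondegenerate_toBilin'_iff_det_ne_zero, Matrix.det_one]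
    exact one_ne_zero
  have horth := LinearMap.BilinForm.finrank_orthogonal hBn (Vσ ⊔ Vτ)
  rw [Module.finrank_fintype_fun_eq_card] at horth
  -- A boundary is orthogonal to the functions of the white vertex and to those of the black vertex,
  -- in other words it is a cycle. Euler's formula then makes the space of cycles no larger than the
  -- space of boundaries.
  have hle : LinearMap.range (D.domRestrict Vφ) ≤ B.orthogonal (Vσ ⊔ Vτ) := by
    rintro _ ⟨⟨x, hx⟩, rfl⟩
    rw [LinearMap.BilinForm.mem_orthogonal_iff]
    intro y hy
    obtain ⟨z, hz, z', hz', rfl⟩ := Submodule.mem_sup.1 hy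
    rw [map_add, LinearMap.add_apply, hB, hB]
    simp only [LinearMap.domRestrict_apply, hD, mul_add, Finset.sum_add_distrib]
    have e1 : ∑ e, z e * x (τ⁻¹ e) = ∑ e, z e * x e := by
      rw [← Equiv.sum_comp σ fun e => z e * x e]
      refine Finset.sum_congr rfl fun e _ => ?_
      rw [mem_classFunctions_sameCycle.1 hz, hφ x hx]
    have e2 : ∑ e, z' e * x (τ⁻¹ e) = ∑ e, z' e * x e := by
      rw [← Equiv.sum_comp τ fun e => z' e * x (τ⁻¹ e)]
      refine Finset.sum_congr rfl fun e _ => ?_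
      rw [mem_classFunctions_sameCycle.1 hz', Equiv.Perm.coe_inv, Equiv.symm_apply_apply]
    rw [e1, e2, zmod_two_add_self, zmod_two_add_self, add_zero]
  have heq : LinearMap.range (D.domRestrict Vφ) = B.orthogonal (Vσ ⊔ Vτ) := by
    apply Submodule.eq_of_le_of_finrank_le hle
    rw [horth]
    omega
  have hd : d ∈ B.orthogonal (Vσ ⊔ Vτ) := by
    rw [LinearMap.BilinForm.mem_orthogonal_iff]
    intro y hy
    obtain ⟨z, hz, z', hz', rfl⟩ := Submodule.mem_sup.1 hy
    rw [map_add, LinearMap.add_apply, hB, hB,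
      hσ z (mem_classFunctions_sameCycle.1 hz), hτ z' (mem_classFunctions_sameCycle.1 hz'),
      add_zero]
  rw [← heq] at hd
  obtain ⟨⟨x, hx⟩, rfl⟩ := hd
  have key : ∀ e, x (τ⁻¹ e) = x e + D x e := fun e => by
    rw [hD, ← add_assoc, zmod_two_add_self, zero_add]
  exact ⟨x, fun e => by rw [hφ x hx]; exact key e, key⟩

end Planarity

/-! ### Kasteleyn signs of a planar graph in the disk -/

/-- Any numbering of the cycles of a permutation can be completed by base points. -/
noncomputable def CycleRank.ofIndex {E : Type*} {σ : Equiv.Perm E} (index : E → ℕ)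
    (h : ∀ e e', σ.SameCycle e e' ↔ index e = index e') : CycleRank σ where
  index := index
  sameCycle_iff := h
  base e := Classical.choose (⟨e, rfl⟩ : ∃ e', index e' = index e)
  index_base e := Classical.choose_spec (⟨e, rfl⟩ : ∃ e', index e' = index e)
  base_eq e e' hee := by simp only [hee]

/-- Replace the base point of one cycle. -/
noncomputable def CycleRank.rebase {E : Type*} {σ : Equiv.Perm E} (R : CycleRank σ) (e₀ : E) :
    CycleRank σ where
  index := R.index
  sameCycle_iff := R.sameCycle_iff
  base e := if R.index e = R.index e₀ then e₀ else R.base e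
  index_base e := by
    split_ifs with h
    · exact h.symm
    · exact R.index_base e
  base_eq e e' hee := by
    simp only [hee, R.base_eq e e' hee]

lemma Equiv.Perm.apply_eq_of_sameCycle {E α : Type*} [Finite E] {σ : Equiv.Perm E} {f : E → α}
    (hf : ∀ e, f (σ e) = f e) {e e' : E} (h : σ.SameCycle e e') : f e' = f e := by
  obtain ⟨t, rfl⟩ := h.exists_nat_pow_eq
  induction t with
  | zero => rfl
  | succ t ih => rw [pow_succ', Equiv.Perm.mul_apply, hf]; exact ih ⟨t, by simp⟩

namespace DiskGraph

variable {n : ℕ} (G : DiskGraph n)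

/-- A numbering of the white vertices. -/
noncomputable def whiteIndex (w : G.White) : ℕ := Fintype.equivFin G.White w

/-- A numbering of the black vertices, the boundary vertices first. -/
noncomputable def blackIndex : G.Black ⊕ Fin n → ℕ
  | Sum.inl b => n + Fintype.equivFin G.Black b
  | Sum.inr i => i

lemma whiteIndex_injective : Function.Injective G.whiteIndex := fun _ _ h =>
  (Fintype.equivFin G.White).injective (Fin.ext h)

lemma blackIndex_injective : Function.Injective G.blackIndex := by
  rintro (b | i) (b' | i') h
  · simp only [blackIndex] at h
    exact congrArg _ ((Fintype.equivFin G.Black).injective (Fin.ext (by omega)))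
  · simp only [blackIndex] at h; omega
  · simp only [blackIndex] at h; omega
  · rw [Fin.ext h]

lemma rotBlack_of_boundary {e : G.Edge} {i : Fin n} (h : G.black e = Sum.inr i) :
    G.rotBlack e = e := by
  have := (G.sameCycle_rotBlack (G.rotBlack e) e).1
    (Equiv.Perm.sameCycle_apply_left.2 (Equiv.Perm.SameCycle.refl _ e))
  exact G.boundary_unique _ _ i (this.trans h) h

lemma black_rotBlack (e : G.Edge) : G.black (G.rotBlack e) = G.black e :=
  (G.sameCycle_rotBlack _ _).1 (Equiv.Perm.sameCycle_apply_left.2 (Equiv.Perm.SameCycle.refl _ e))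

lemma mem_boundaryEdgeList {e : G.Edge} :
    e ∈ boundaryEdgeList G.black ↔ ∃ i, G.black e = Sum.inr i := by
  simp [boundaryEdgeList]

lemma pairwise_boundaryEdgeList : (boundaryEdgeList G.black).Pairwise
    fun e e' => G.blackIndex (G.black e) < G.blackIndex (G.black e') := by
  classical
  rw [boundaryEdgeList, List.pairwise_flatMap]
  constructor
  · intro i _
    have hc : (Finset.univ.filter fun e => G.black e = Sum.inr i).card ≤ 1 := by
      rw [Finset.card_le_one]
      intro e he e' he'
      exact G.boundary_unique e e' i (by simpa using he) (by simpa using he')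
    rw [← Finset.length_toList] at hc
    match hl : (Finset.univ.filter fun e => G.black e = Sum.inr i).toList, hc with
    | [], _ => convert! List.Pairwise.nil
    | [a], _ => convert! List.pairwise_singleton _ a
  · refine (List.pairwise_lt_finRange n).imp fun {i j} hij e he e' he' => ?_
    simp only [Finset.mem_toList, Finset.mem_filter, Finset.mem_univ, true_and] at he he'
    rw [he, he']
    exact hij

lemma nodup_boundaryEdgeList : (boundaryEdgeList G.black).Nodup :=
  G.pairwise_boundaryEdgeList.imp fun {a b} h hab => by rw [hab] at h; exact lt_irrefl _ h

/-- The rotation around black vertices, the boundary being contracted to one vertex. -/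
noncomputable def closedRotation : Equiv.Perm G.Edge := G.rotBlack * outerRotation G.black

lemma outerRotation_inv :
    ∃ _ : DecidableEq G.Edge, (outerRotation G.black)⁻¹ = (boundaryEdgeList G.black).formPerm := by
  classical
  refine ⟨Classical.decEq _, ?_⟩
  rw [outerRotation, List.formPerm_reverse, inv_inv]

lemma outerRotation_of_interior {e : G.Edge} {b : G.Black} (h : G.black e = Sum.inl b) :
    outerRotation G.black e = e := by
  classical
  rw [outerRotation]
  apply List.formPerm_apply_of_notMem
  rw [List.mem_reverse, G.mem_boundaryEdgeList, h]
  simp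

lemma closedRotation_of_interior {e : G.Edge} {b : G.Black} (h : G.black e = Sum.inl b) :
    G.closedRotation e = G.rotBlack e := by
  rw [closedRotation, Equiv.Perm.mul_apply, G.outerRotation_of_interior h]

/-- Around the contracted boundary the counterclockwise order decreases the labels, so it is the
inverse rotation that lists the boundary edges by increasing label. For this reason the black ranks
belong to `closedRotation⁻¹`. -/
lemma closedRotation_inv_getElem {j : ℕ} (hj : j + 1 < (boundaryEdgeList G.black).length) :
    (G.closedRotation⁻¹ : Equiv.Perm G.Edge) (boundaryEdgeList G.black)[j] =
      (boundaryEdgeList G.black)[j + 1] := by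
  obtain ⟨_, h⟩ := G.outerRotation_inv
  obtain ⟨i, hi⟩ := G.mem_boundaryEdgeList.1 (List.getElem_mem (Nat.lt_of_succ_lt hj))
  rw [closedRotation, mul_inv_rev, Equiv.Perm.mul_apply, h]
  have h1 : (G.rotBlack⁻¹ : Equiv.Perm G.Edge) (boundaryEdgeList G.black)[j] =
      (boundaryEdgeList G.black)[j] := by
    rw [Equiv.Perm.inv_eq_iff_eq, G.rotBlack_of_boundary hi]
  rw [h1]
  exact List.formPerm_apply_lt_getElem _ G.nodup_boundaryEdgeList _ hj

/-- A numbering of the black vertices, the boundary being contracted to one vertex. -/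
noncomputable def closedIndex (e : G.Edge) : ℕ :=
  match G.black e with
  | Sum.inl b => 1 + Fintype.equivFin G.Black b
  | Sum.inr _ => 0

lemma closedIndex_of_boundary {e : G.Edge} {i : Fin n} (h : G.black e = Sum.inr i) :
    G.closedIndex e = 0 := by
  simp [closedIndex, h]

lemma closedIndex_eq_zero_iff {e : G.Edge} : G.closedIndex e = 0 ↔ ∃ i, G.black e = Sum.inr i := by
  rcases h : G.black e with b | i <;> simp [closedIndex, h]

lemma closedIndex_eq_iff_of_interior {e e' : G.Edge} {b : G.Black} (h : G.black e = Sum.inl b) :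
    G.closedIndex e' = G.closedIndex e ↔ G.black e' = Sum.inl b := by
  rcases h' : G.black e' with b' | i
  · simp only [closedIndex, h, h', Sum.inl.injEq]
    constructor
    · intro hh
      exact (Fintype.equivFin G.Black).injective (Fin.ext (by omega))
    · rintro rfl; rfl
  · simp only [closedIndex, h, h', reduceCtorEq, iff_false]
    omega

lemma closedIndex_closedRotation (e : G.Edge) :
    G.closedIndex (G.closedRotation e) = G.closedIndex e := by
  classical
  rcases h : G.black e with b | i
  · rw [G.closedIndex_eq_iff_of_interior h, G.closedRotation_of_interior h, G.black_rotBlack, h]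
  · rw [G.closedIndex_of_boundary h, closedIndex_eq_zero_iff, closedRotation,
      Equiv.Perm.mul_apply, G.black_rotBlack, ← G.mem_boundaryEdgeList, outerRotation,
      ← List.mem_reverse, List.formPerm_mem_iff_mem, List.mem_reverse, G.mem_boundaryEdgeList]
    exact ⟨i, h⟩

lemma sameCycle_getElem {j : ℕ} (hj : j < (boundaryEdgeList G.black).length) :
    (G.closedRotation⁻¹).SameCycle ((boundaryEdgeList G.black)[0]'(by omega))
      (boundaryEdgeList G.black)[j] := by
  induction j with
  | zero => exact Equiv.Perm.SameCycle.refl _ _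
  | succ j ih =>
    rw [← G.closedRotation_inv_getElem hj]
    exact Equiv.Perm.sameCycle_apply_right.2 (ih (by omega))

lemma sameCycle_closedRotation_inv (e e' : G.Edge) :
    (G.closedRotation⁻¹).SameCycle e e' ↔ G.closedIndex e = G.closedIndex e' := by
  constructor
  · intro h
    rw [Equiv.Perm.sameCycle_inv] at h
    exact (Equiv.Perm.apply_eq_of_sameCycle G.closedIndex_closedRotation h).symm
  · intro h
    rcases hb : G.black e with b | i
    · rw [eq_comm, G.closedIndex_eq_iff_of_interior hb] at h
      rw [Equiv.Perm.sameCycle_inv]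
      obtain ⟨t, rfl⟩ :=
        ((G.sameCycle_rotBlack e e').2 (hb.trans h.symm)).exists_nat_pow_eq
      have key : ∀ t : ℕ, (G.closedRotation ^ t) e = (G.rotBlack ^ t) e ∧
          G.black ((G.rotBlack ^ t) e) = Sum.inl b := by
        intro t
        induction t with
        | zero => exact ⟨rfl, hb⟩
        | succ t ih =>
          rw [pow_succ', pow_succ', Equiv.Perm.mul_apply, Equiv.Perm.mul_apply, ih.1,
            G.closedRotation_of_interior ih.2, G.black_rotBlack]
          exact ⟨rfl, ih.2⟩
      exact ⟨t, by rw [zpow_natCast, (key t).1]⟩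
    · have h1 : e ∈ boundaryEdgeList G.black := G.mem_boundaryEdgeList.2 ⟨i, hb⟩
      have h2 : e' ∈ boundaryEdgeList G.black := by
        rw [G.mem_boundaryEdgeList, ← closedIndex_eq_zero_iff, ← h, G.closedIndex_of_boundary hb]
      obtain ⟨j, hj, rfl⟩ := List.getElem_of_mem h1
      obtain ⟨j', hj', rfl⟩ := List.getElem_of_mem h2
      exact (G.sameCycle_getElem hj).symm.trans (G.sameCycle_getElem hj')

/-- The ranks of the edges around the white vertices. -/
noncomputable def whiteRank : CycleRank G.rotWhite :=
  CycleRank.ofIndex (fun e => G.whiteIndex (G.white e)) fun e e' => by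
    rw [G.sameCycle_rotWhite, G.whiteIndex_injective.eq_iff]

open Classical in
/-- The ranks of the edges around the black vertices. Boundary edges are ranked by their
labels. -/
noncomputable def blackRank : CycleRank G.closedRotation⁻¹ :=
  if h : 0 < (boundaryEdgeList G.black).length then
    (CycleRank.ofIndex G.closedIndex G.sameCycle_closedRotation_inv).rebase
      (boundaryEdgeList G.black)[0]
  else CycleRank.ofIndex G.closedIndex G.sameCycle_closedRotation_inv

lemma blackRank_index : G.blackRank.index = G.closedIndex := by
  unfold blackRank
  split_ifs <;> rfl

lemma blackRank_base_of_boundary {e : G.Edge} {i : Fin n} (hb : G.black e = Sum.inr i) :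
    ∃ h : 0 < (boundaryEdgeList G.black).length,
      G.blackRank.base e = (boundaryEdgeList G.black)[0] := by
  have h : 0 < (boundaryEdgeList G.black).length :=
    List.length_pos_of_mem (G.mem_boundaryEdgeList.2 ⟨i, hb⟩)
  refine ⟨h, ?_⟩
  rw [blackRank, dif_pos h]
  apply if_pos
  change G.closedIndex _ = G.closedIndex _
  rw [G.closedIndex_of_boundary hb, eq_comm, closedIndex_eq_zero_iff, ← G.mem_boundaryEdgeList]
  exact List.getElem_mem h

lemma blackRank_pos_getElem {j : ℕ} (hj : j < (boundaryEdgeList G.black).length) :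
    G.blackRank.pos (boundaryEdgeList G.black)[j] = j := by
  induction j with
  | zero =>
    obtain ⟨i, hi⟩ := G.mem_boundaryEdgeList.1 (List.getElem_mem hj)
    obtain ⟨h, h'⟩ := G.blackRank_base_of_boundary hi
    exact (G.blackRank.pos_eq_zero_iff _).2 h'
  | succ j ih =>
    obtain ⟨i, hi⟩ := G.mem_boundaryEdgeList.1 (List.getElem_mem (Nat.lt_of_succ_lt hj))
    obtain ⟨h, h'⟩ := G.blackRank_base_of_boundary hi
    rw [← G.closedRotation_inv_getElem hj, G.blackRank.pos_apply, ih]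
    rw [h', G.closedRotation_inv_getElem hj]
    intro h0
    have := (G.nodup_boundaryEdgeList.getElem_inj_iff).1 h0
    omega

/-- The contracted vertex has index 0, and the first boundary edge is its base point. Thus one cycle
of `closedRotation⁻¹` ranks the boundary edges exactly as the separate boundary vertices are ranked
by `blackIndex`. -/
lemma blackRank_lt_iff {e e' : G.Edge} (hne : G.black e ≠ G.black e') :
    G.blackRank.rank e < G.blackRank.rank e' ↔
      G.blackIndex (G.black e) < G.blackIndex (G.black e') := by
  rw [CycleRank.rank_lt_rank, G.blackRank_index]
  rcases h : G.black e with b | i <;> rcases h' : G.black e' with b' | i'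
  · have : G.closedIndex e ≠ G.closedIndex e' := fun hh =>
      hne (by rw [h, (G.closedIndex_eq_iff_of_interior h).1 hh.symm])
    simp only [closedIndex, h, h', blackIndex] at this ⊢
    omega
  · simp only [closedIndex, h, h', blackIndex]
    omega
  · simp only [closedIndex, h, h', blackIndex]
    omega
  · rw [G.closedIndex_of_boundary h, G.closedIndex_of_boundary h']
    obtain ⟨j, hj, rfl⟩ := List.getElem_of_mem (G.mem_boundaryEdgeList.2 ⟨i, h⟩)
    obtain ⟨j', hj', rfl⟩ := List.getElem_of_mem (G.mem_boundaryEdgeList.2 ⟨i', h'⟩)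
    rw [G.blackRank_pos_getElem, G.blackRank_pos_getElem, ← h, ← h']
    have hp := List.pairwise_iff_getElem.1 G.pairwise_boundaryEdgeList
    constructor
    · rintro (h0 | ⟨-, h0⟩)
      · omega
      · exact hp j j' hj hj' h0
    · intro hlt
      refine Or.inr ⟨rfl, ?_⟩
      rcases lt_trichotomy j j' with h0 | h0 | h0
      · exact h0
      · subst h0; exact absurd hlt (lt_irrefl _)
      · exact absurd (hp j' j hj' hj h0) hlt.not_gt

end DiskGraph

/-! ### Signs of dimer configurations -/

namespace DiskGraph

variable {n : ℕ} (G : DiskGraph n)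

open Classical in
/-- The indicator of a set of edges, modulo two. -/
noncomputable def edgeIndicator (π : Finset G.Edge) (e : G.Edge) : ZMod 2 := if e ∈ π then 1 else 0

lemma sum_edgeIndicator_mul (π : Finset G.Edge) (f : G.Edge → ZMod 2) :
    ∑ e, G.edgeIndicator π e * f e = ∑ e ∈ π, f e := by
  classical
  simp [edgeIndicator, Finset.sum_ite_mem]

/-- The number of inversions, modulo two, of the matching of vertices given by a set of edges. -/
noncomputable def matchingInversions (π : Finset G.Edge) : ZMod 2 :=
  invSum (G.edgeIndicator π) (fun e => G.whiteIndex (G.white e))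
    (fun e => G.blackIndex (G.black e))

variable {G}

lemma IsDimer.eq_of_white_eq {π : Finset G.Edge} (h : G.IsDimer π) {e e' : G.Edge} (he : e ∈ π)
    (he' : e' ∈ π) (hw : G.white e = G.white e') : e = e' :=
  (h.1 (G.white e')).unique ⟨he, hw⟩ ⟨he', rfl⟩

lemma IsDimer.eq_of_black_eq {π : Finset G.Edge} (h : G.IsDimer π) {e e' : G.Edge} (he : e ∈ π)
    (he' : e' ∈ π) (hw : G.black e = G.black e') : e = e' := by
  rcases hb : G.black e' with b | i
  · exact (h.2 b).unique ⟨he, hw.trans hb⟩ ⟨he', hb⟩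
  · exact G.boundary_unique _ _ i (hw.trans hb) hb

lemma IsDimer.card_eq {π : Finset G.Edge} (h : G.IsDimer π) :
    π.card = Fintype.card G.White := by
  rw [← Finset.card_univ]
  refine Finset.card_bij (fun e _ => G.white e) (fun _ _ => Finset.mem_univ _)
    (fun e he e' he' hw => h.eq_of_white_eq he he' hw) fun w _ => ?_
  obtain ⟨e, ⟨he, hw⟩, -⟩ := h.1 w
  exact ⟨e, he, hw⟩

open Classical in
lemma IsDimer.card_boundary {k : ℕ} (hk : Fintype.card G.White = Fintype.card G.Black + k)
    {π : Finset G.Edge} (h : G.IsDimer π) :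
    (π.filter fun e => ∃ i, G.black e = Sum.inr i).card = k := by
  have h1 : (π.filter fun e => ¬ ∃ i, G.black e = Sum.inr i).card = Fintype.card G.Black := by
    rw [← Finset.card_univ, eq_comm]
    choose f hf _ using h.2
    refine Finset.card_bij (fun b _ => f b) (fun b _ => ?_) (fun b _ b' _ hb => ?_) fun e he => ?_
    · rw [Finset.mem_filter]
      exact ⟨(hf b).1, by rw [(hf b).2]; simp⟩
    · have := (hf b).2.symm.trans ((congrArg _ hb).trans (hf b').2)
      exact Sum.inl_injective this
    · rw [Finset.mem_filter] at he
      rcases hb : G.black e with b | i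
      · exact ⟨b, Finset.mem_univ _, h.eq_of_black_eq (hf b).1 he.1 ((hf b).2.trans hb.symm)⟩
      · exact absurd ⟨i, hb⟩ he.2
  have := Finset.card_filter_add_card_filter_not (s := π) (fun e => ∃ i, G.black e = Sum.inr i)
  rw [h1, h.card_eq] at this
  omega

/-- Distinct edges of a dimer configuration have distinct white ends and distinct black ends, so
positions around a vertex play no role. -/
lemma IsDimer.matchingInversions_eq {π : Finset G.Edge} (h : G.IsDimer π) :
    invSum (G.edgeIndicator π) G.whiteRank.rank G.blackRank.rank = G.matchingInversions π := by
  refine Finset.sum_congr rfl fun p _ => Finset.sum_congr rfl fun q _ => ?_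
  by_cases hp : p ∈ π
  swap
  · simp [edgeIndicator, hp]
  by_cases hq : q ∈ π
  swap
  · simp [edgeIndicator, hq]
  by_cases hpq : p = q
  · subst hpq; simp
  have hw : G.white p ≠ G.white q := fun hh => hpq (h.eq_of_white_eq hp hq hh)
  have hb : G.black q ≠ G.black p := fun hh => hpq (h.eq_of_black_eq hq hp hh).symm
  have h1 : G.whiteRank.rank p < G.whiteRank.rank q ↔
      G.whiteIndex (G.white p) < G.whiteIndex (G.white q) := by
    rw [CycleRank.rank_lt_rank]
    have := G.whiteIndex_injective.ne hw
    change G.whiteIndex (G.white p) < G.whiteIndex (G.white q) ∨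
      G.whiteIndex (G.white p) = G.whiteIndex (G.white q) ∧ _ ↔ _
    simp [this]
  simp only [ltInd, h1, G.blackRank_lt_iff hb]

-- Each white vertex lies on exactly one edge of `π` and has exactly one base point, so both sums
-- run over the white vertices.
open Classical in
lemma IsDimer.sum_whiteRank_base {π : Finset G.Edge} (h : G.IsDimer π) (x : G.Edge → ZMod 2) :
    ∑ e ∈ π, x (G.whiteRank.base e) = ∑ e, if G.whiteRank.base e = e then x e else 0 := by
  have hw : ∀ e e', G.whiteRank.index e = G.whiteRank.index e' → G.white e = G.white e' :=
    fun e e' hh => G.whiteIndex_injective hh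
  rw [← Finset.sum_filter]
  refine Finset.sum_bij (fun e _ => G.whiteRank.base e) (fun e _ => ?_) (fun e he e' he' hh => ?_)
    (fun b hb => ?_) fun _ _ => rfl
  · simp [G.whiteRank.base_base]
  · refine h.eq_of_white_eq he he' (hw _ _ ?_)
    rw [← G.whiteRank.index_base, hh, G.whiteRank.index_base]
  · obtain ⟨e, ⟨he, hwe⟩, -⟩ := h.1 (G.white b)
    refine ⟨e, he, ?_⟩
    rw [Finset.mem_filter] at hb
    exact (G.whiteRank.base_eq _ _ (congrArg G.whiteIndex hwe)).trans hb.2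

variable (G) in
/-- The value of a chain at the first boundary edge. -/
noncomputable def outerValue : (G.Edge → ZMod 2) →ₗ[ZMod 2] ZMod 2 :=
  if h : 0 < (boundaryEdgeList G.black).length then
    LinearMap.proj ((boundaryEdgeList G.black)[0])
  else 0

-- The contributions of interior black vertices cancel as they do at white vertices. The contracted
-- vertex lies on `k` edges of `π` and, if there are boundary edges, has one base point; this
-- accounts for the factor `k + 1`.
open Classical in
lemma IsDimer.sum_blackRank_base {k : ℕ} (hk : Fintype.card G.White = Fintype.card G.Black + k)
    {π : Finset G.Edge} (h : G.IsDimer π) (x : G.Edge → ZMod 2) :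
    ∑ e ∈ π, x (G.blackRank.base e) + ∑ e, (if G.blackRank.base e = e then x e else 0) =
      (k + 1) * G.outerValue x := by
  have hcb : ∀ e e' b, G.black e = Sum.inl b → G.closedIndex e' = G.closedIndex e →
      G.black e' = Sum.inl b := fun e e' b hb hh => (G.closedIndex_eq_iff_of_interior hb).1 hh
  have hib : ∀ e, G.closedIndex (G.blackRank.base e) = G.closedIndex e := fun e => by
    rw [← G.blackRank_index]; exact G.blackRank.index_base e
  have hbase : ∀ e e', G.closedIndex e = G.closedIndex e' →
      G.blackRank.base e = G.blackRank.base e' := fun e e' hh =>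
    G.blackRank.base_eq _ _ (by rw [G.blackRank_index]; exact hh)
  have hx : ∀ e, (∃ i, G.black e = Sum.inr i) → x (G.blackRank.base e) = G.outerValue x := by
    rintro e ⟨i, hi⟩
    obtain ⟨h0, h1⟩ := G.blackRank_base_of_boundary hi
    rw [h1, outerValue, dif_pos h0]
    rfl
  have hsumx : ∑ e ∈ π with ∃ i, G.black e = Sum.inr i, x (G.blackRank.base e) =
      k * G.outerValue x := by
    rw [Finset.sum_congr rfl fun e he => hx e (Finset.mem_filter.1 he).2, Finset.sum_const,
      h.card_boundary hk, nsmul_eq_mul]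
  have hone : ∑ e with (∃ i, G.black e = Sum.inr i),
      (if G.blackRank.base e = e then x e else 0) = G.outerValue x := by
    by_cases h0 : 0 < (boundaryEdgeList G.black).length
    · have hmem := G.mem_boundaryEdgeList.1 (List.getElem_mem h0)
      rw [Finset.sum_eq_single (boundaryEdgeList G.black)[0]]
      · obtain ⟨i, hi⟩ := hmem
        obtain ⟨_, h1⟩ := G.blackRank_base_of_boundary hi
        rw [if_pos h1, outerValue, dif_pos h0]
        rfl
      · intro e he hne
        obtain ⟨i, hi⟩ := (Finset.mem_filter.1 he).2
        obtain ⟨_, h1⟩ := G.blackRank_base_of_boundary hi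
        rw [if_neg]
        rw [h1]
        exact Ne.symm hne
      · intro hh
        exact absurd (Finset.mem_filter.2 ⟨Finset.mem_univ (boundaryEdgeList G.black)[0], hmem⟩) hh
    · rw [outerValue, dif_neg h0, Finset.sum_eq_zero]
      · rfl
      · intro e he
        exact absurd (List.length_pos_of_mem (G.mem_boundaryEdgeList.2 (Finset.mem_filter.1 he).2))
          h0
  have hint : ∑ e ∈ π with ¬ ∃ i, G.black e = Sum.inr i, x (G.blackRank.base e) =
      ∑ e with ¬ ∃ i, G.black e = Sum.inr i, if G.blackRank.base e = e then x e else 0 := by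
    rw [← Finset.sum_filter, Finset.filter_filter]
    refine Finset.sum_bij (fun e _ => G.blackRank.base e) (fun e he => ?_)
      (fun e he e' he' hh => ?_) (fun b hb => ?_) fun _ _ => rfl
    · rw [Finset.mem_filter] at he ⊢
      refine ⟨Finset.mem_univ _, ?_, G.blackRank.base_base e⟩
      rw [← closedIndex_eq_zero_iff, hib, closedIndex_eq_zero_iff]
      exact he.2
    · rw [Finset.mem_filter] at he he'
      rcases hb : G.black e' with b | i
      · refine h.eq_of_black_eq he.1 he'.1 (Eq.trans (hcb e' e b hb ?_) hb.symm)
        rw [← hib, hh, hib]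
      · exact absurd ⟨i, hb⟩ he'.2
    · rw [Finset.mem_filter] at hb
      rcases hbb : G.black b with b' | i
      · obtain ⟨e, ⟨he, hbe⟩, -⟩ := h.2 b'
        refine ⟨e, Finset.mem_filter.2 ⟨he, by rw [hbe]; simp⟩, ?_⟩
        exact (hbase _ _ ((G.closedIndex_eq_iff_of_interior hbb).2 hbe)).trans hb.2.2
      · exact absurd ⟨i, hbb⟩ hb.2.1
  rw [← Finset.sum_filter_add_sum_filter_not π (fun e => ∃ i, G.black e = Sum.inr i),
    ← Finset.sum_filter_add_sum_filter_not Finset.univ (fun e => ∃ i, G.black e = Sum.inr i),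
    hsumx, hone, hint]
  linear_combination zmod_two_add_self
    (∑ e with ¬ ∃ i, G.black e = Sum.inr i, if G.blackRank.base e = e then x e else 0)

/-- Kasteleyn signs exist: up to a sign depending multiplicatively on the edges, all dimer
configurations have the same sign. -/
theorem exists_kasteleyn {k : ℕ} (hk : Fintype.card G.White = Fintype.card G.Black + k) :
    ∃ (κ : G.Edge → ZMod 2) (c : ZMod 2), ∀ π : Finset G.Edge, G.IsDimer π →
      G.matchingInversions π + ∑ e ∈ π, κ e = c := by
  classical
  by_cases hex : ∃ π₀ : Finset G.Edge, G.IsDimer π₀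
  swap
  · exact ⟨0, 0, fun π hπ => absurd ⟨π, hπ⟩ hex⟩
  obtain ⟨π₀, h₀⟩ := hex
  set τ := G.closedRotation with hτ
  set φ := G.rotWhite * τ with hφ
  let V := classFunctions (Equiv.Perm.SameCycle.setoid φ)
  -- The right side of Kasteleyn's identity for two dimer configurations. The inversion sum is
  -- quadratic in the chain, but additive on chains invariant under `φ`, and so `q` is linear.
  let q : V →ₗ[ZMod 2] ZMod 2 :=
    AddMonoidHom.toZModLinearMap 2
      { toFun := fun x => invSum x.1 G.whiteRank.rank (G.whiteRank.rank ∘ φ) +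
          (k + 1) * G.outerValue x.1
        map_zero' := by simp [invSum]
        map_add' := fun x y => by
          rw [Submodule.coe_add, map_add, invSum_comp_add_of_invariant G.whiteRank.rank_injective
            (mem_classFunctions_sameCycle.1 x.2) (mem_classFunctions_sameCycle.1 y.2)]
          ring }
  have hq : ∀ x : V, q x = invSum x.1 G.whiteRank.rank (G.whiteRank.rank ∘ φ) +
          (k + 1) * G.outerValue x.1 := fun x => rfl
  let D : V →ₗ[ZMod 2] (G.Edge → ZMod 2) :=
    (LinearMap.id + LinearMap.funLeft (ZMod 2) (ZMod 2) (τ⁻¹ : Equiv.Perm G.Edge)).domRestrict V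
  have hD : ∀ (x : V) e, D x e = x.1 e + x.1 (τ⁻¹ e) := fun x e => rfl
  have hcore : ∀ π, G.IsDimer π → ∀ x : V,
      (∀ e, D x e = G.edgeIndicator π e + G.edgeIndicator π₀ e) →
      G.matchingInversions π + G.matchingInversions π₀ = q x := by
    intro π hπ x hx
    have hxτ : ∀ e, x.1 (τ⁻¹ e) = x.1 e + (G.edgeIndicator π e + G.edgeIndicator π₀ e) := by
      intro e
      rw [← hx, hD, ← add_assoc, zmod_two_add_self, zero_add]
    have hxσ : ∀ e, x.1 (G.rotWhite e) =
        x.1 e + (G.edgeIndicator π e + G.edgeIndicator π₀ e) := by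
      intro e
      rw [← hxτ]
      simpa [hφ] using mem_classFunctions_sameCycle.1 x.2 (τ⁻¹ e)
    have key := invSum_add_invSum_eq G.whiteRank G.blackRank hxσ hxτ
    simp only [mul_add, Finset.sum_add_distrib] at key
    rw [hπ.matchingInversions_eq, h₀.matchingInversions_eq, sum_edgeIndicator_mul,
      sum_edgeIndicator_mul, hπ.sum_whiteRank_base] at key
    have hb := hπ.sum_blackRank_base hk x.1
    rw [hq]
    linear_combination key + hb + zmod_two_add_self
      (∑ e, if G.whiteRank.base e = e then x.1 e else 0) -
      zmod_two_add_self (invSum x.1 G.whiteRank.rank (G.whiteRank.rank ∘ φ))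
  -- Taking `π = π₀` in `hcore` shows that `q` vanishes on chains without boundary. Hence it extends
  -- from the boundaries to a functional on all edge chains, whose values on single edges are the
  -- Kasteleyn signs.
  have hker : q ∈ (LinearMap.ker D).dualAnnihilator := by
    rw [Submodule.mem_dualAnnihilator]
    intro x hx
    rw [← hcore π₀ h₀ x fun e => by
      rw [LinearMap.mem_ker.1 hx, zmod_two_add_self, Pi.zero_apply], zmod_two_add_self]
  rw [← LinearMap.range_dualMap_eq_dualAnnihilator_ker] at hker
  obtain ⟨κ', hκ'⟩ := hker
  have hκ : ∀ d : G.Edge → ZMod 2, κ' d = ∑ e, d e * κ' (Pi.single e 1) := by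
    intro d
    conv_lhs => rw [pi_eq_sum_univ' d, map_sum]
    refine Finset.sum_congr rfl fun e _ => ?_
    rw [map_smul, smul_eq_mul]
  refine ⟨fun e => κ' (Pi.single e 1),
    G.matchingInversions π₀ + ∑ e ∈ π₀, κ' (Pi.single e 1), fun π hπ => ?_⟩
  -- The two dimer configurations have the same degree modulo two at every vertex, including degree
  -- `k` at the contracted one, so their sum is a cycle.
  obtain ⟨x, hx1, hx2⟩ := exists_face_chain (σ := G.rotWhite) (τ := τ)
    (d := fun e => G.edgeIndicator π e + G.edgeIndicator π₀ e) G.planar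
    (by
      intro x hx
      have hxb : ∀ e, x e = x (G.whiteRank.base e) := fun e =>
        Equiv.Perm.apply_eq_of_sameCycle hx
          ((G.whiteRank.sameCycle_iff _ _).2 (G.whiteRank.index_base e))
      have h1 : ∀ π, G.IsDimer π → ∑ e, G.edgeIndicator π e * x e =
          ∑ e, if G.whiteRank.base e = e then x e else 0 := fun π hπ => by
        rw [sum_edgeIndicator_mul, ← hπ.sum_whiteRank_base]
        exact Finset.sum_congr rfl fun e _ => hxb e
      simp only [mul_comm (x _), add_mul, Finset.sum_add_distrib, h1 π hπ, h1 π₀ h₀,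
        zmod_two_add_self])
    (by
      intro x hx
      have hx' : ∀ e, x (τ⁻¹ e) = x e := fun e => by
        conv_rhs => rw [← Equiv.apply_symm_apply τ e, hx]
        rfl
      have hxb : ∀ e, x e = x (G.blackRank.base e) := fun e =>
        Equiv.Perm.apply_eq_of_sameCycle hx'
          ((G.blackRank.sameCycle_iff _ _).2 (G.blackRank.index_base e))
      have h1 : ∀ π, G.IsDimer π → ∑ e, G.edgeIndicator π e * x e =
          (k + 1) * G.outerValue x + ∑ e, if G.blackRank.base e = e then x e else 0 :=
        fun π hπ => by
          rw [sum_edgeIndicator_mul, ← hπ.sum_blackRank_base hk, add_assoc, zmod_two_add_self,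
            add_zero]
          exact Finset.sum_congr rfl fun e _ => hxb e
      simp only [mul_comm (x _), add_mul, Finset.sum_add_distrib, h1 π hπ, h1 π₀ h₀,
        zmod_two_add_self])
  have hxV : x ∈ V := by
    rw [mem_classFunctions_sameCycle]
    intro e
    have h2 := hx2 (τ e)
    rw [hφ, Equiv.Perm.mul_apply, hx1, ← h2]
    simp
  have hDx : ∀ e, D ⟨x, hxV⟩ e = G.edgeIndicator π e + G.edgeIndicator π₀ e := fun e => by
    rw [hD]
    change x e + x (τ⁻¹ e) = _
    rw [hx2, ← add_assoc, zmod_two_add_self, zero_add]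
  have h1 := hcore π hπ ⟨x, hxV⟩ hDx
  have h2 : q ⟨x, hxV⟩ = κ' (D ⟨x, hxV⟩) := by rw [← hκ']; rfl
  rw [h2, hκ] at h1
  simp only [hDx, add_mul, Finset.sum_add_distrib, sum_edgeIndicator_mul] at h1
  linear_combination h1 + zmod_two_add_self (∑ e ∈ π, κ' (Pi.single e 1)) -
    zmod_two_add_self (G.matchingInversions π₀)

end DiskGraph

/-! ### Words and signs -/

section Words

/-- The number of inversions of a word in a linearly ordered alphabet. -/
def wordInversions {α : Type*} [LinearOrder α] : List α → ℕ
  | [] => 0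
  | a :: l => l.countP (fun b => decide (b < a)) + wordInversions l

lemma wordInversions_eq_inversions {r : ℕ} (l : List (Fin r)) :
    wordInversions l = inversions l := by
  induction l with
  | nil => rfl
  | cons a l ih => simp only [wordInversions, inversions, ih]

variable {α A : Type*} [LinearOrder α] [Ring A]

lemma prod_map_orderedInsert {f : α → A} (hf : ∀ a b, f a * f b = -(f b * f a)) (a : α)
    {l : List α} (hl : l.Pairwise (· ≤ ·)) :
    ((l.orderedInsert (· ≤ ·) a).map f).prod =
      (-1) ^ l.countP (fun b => decide (b < a)) * (f a * (l.map f).prod) := by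
  induction l with
  | nil => simp
  | cons b l ih =>
    rw [List.pairwise_cons] at hl
    rw [List.orderedInsert_cons]
    split_ifs with h
    · have h0 : (b :: l).countP (fun c => decide (c < a)) = 0 := by
        rw [List.countP_eq_zero]
        intro c hc
        have : b ≤ c := by
          rcases List.mem_cons.1 hc with rfl | hc
          · exact le_rfl
          · exact hl.1 c hc
        simpa using h.trans this
      rw [h0, pow_zero, one_mul, List.map_cons, List.prod_cons]
    · rw [not_le] at h
      rw [List.map_cons, List.prod_cons, ih hl.2, List.countP_cons_of_pos (by simpa using h),
        List.map_cons, List.prod_cons, pow_succ, ← mul_assoc (f a), hf a b, ← mul_assoc,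
        ((Commute.neg_one_right (f b)).pow_right _).eq]
      noncomm_ring

/-- Sorting a word in anticommuting letters. -/
lemma prod_map_eq_insertionSort {f : α → A} (hf : ∀ a b, f a * f b = -(f b * f a))
    (l : List α) :
    (l.map f).prod = (-1) ^ wordInversions l * ((l.insertionSort (· ≤ ·)).map f).prod := by
  induction l with
  | nil => simp [wordInversions]
  | cons a l ih =>
    have hs : ((-1 : A) ^ l.countP (fun b => decide (b < a))) *
        (-1) ^ l.countP (fun b => decide (b < a)) = 1 := by
      rw [← pow_add]; exact Even.neg_one_pow ⟨_, rfl⟩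
    have ht := ((Commute.neg_one_right (f a)).pow_right (wordInversions l)).eq
    rw [List.insertionSort_cons, prod_map_orderedInsert hf a (List.pairwise_insertionSort _ l),
      (List.perm_insertionSort (· ≤ ·) l).countP_eq, List.map_cons, List.prod_cons, ih,
      wordInversions, add_comm, pow_add]
    generalize ((-1 : A) ^ l.countP (fun b => decide (b < a))) = s at *
    rw [mul_assoc, ← mul_assoc s, hs, one_mul, ← mul_assoc, ht, mul_assoc]

lemma wordInversions_append (l l' : List α) : wordInversions (l ++ l') =
    wordInversions l + wordInversions l' +
      (l.map fun a => l'.countP fun b => decide (b < a)).sum := by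
  induction l with
  | nil => simp [wordInversions]
  | cons a l ih =>
    simp only [List.cons_append, wordInversions, List.countP_append, ih, List.map_cons,
      List.sum_cons]
    omega

lemma wordInversions_eq_zero {l : List α} (hl : l.Pairwise (· ≤ ·)) : wordInversions l = 0 := by
  induction l with
  | nil => rfl
  | cons a l ih =>
    rw [List.pairwise_cons] at hl
    rw [wordInversions, ih hl.2, add_zero, List.countP_eq_zero]
    intro b hb
    simpa using hl.1 b hb

end Words

/-! ### Matrix entries of wedges and shuffles -/

section Wedge

open ExteriorAlgebra

variable {U : Type*} [AddCommGroup U] [Module ℂ U] {r : ℕ} (E : Module.Basis (Fin r) ℂ U)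

lemma ι_mul_ι_eq_neg {M : Type*} [AddCommGroup M] [Module ℂ M] (x y : M) :
    ι ℂ x * ι ℂ y = -(ι ℂ y * ι ℂ x) :=
  eq_neg_of_add_eq_zero_left (ι_add_mul_swap x y)

lemma prod_map_ι_eq_zero {M β : Type*} [AddCommGroup M] [Module ℂ M] (v : β → M) {l : List β}
    (hl : ¬ l.Nodup) : (l.map fun b => ι ℂ (v b)).prod = 0 := by
  have h : (l.map fun b => ι ℂ (v b)).prod = ιMulti ℂ l.length fun i => v l[i] := by
    rw [ιMulti_apply]
    congr 1
    refine List.ext_getElem (by simp) fun i h1 h2 => by simp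
  rw [h]
  apply ιMulti_eq_zero_of_not_inj
  intro hinj
  apply hl
  rw [List.nodup_iff_injective_get]
  exact fun i j hij => hinj (congrArg v hij)

lemma basis_exteriorAlgebra_eq_prod (S : Finset (Fin r)) :
    E.ExteriorAlgebra S = ((S.sort (· ≤ ·)).map fun c => ι ℂ (E c)).prod := by
  rw [ExteriorAlgebra.basis_apply_ofCard E (rfl : S.card = S.card)]
  unfold ExteriorAlgebra.ιMulti_family
  rw [ιMulti_apply]
  congr 1
  refine List.ext_getElem (by simp) fun i h1 h2 => ?_
  simp [Set.powersetCard.ofFinEmbEquiv_symm_apply, Finset.orderEmbOfFin_apply]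

lemma prod_map_ι_of_nodup {l : List (Fin r)} (hl : l.Nodup) :
    (l.map fun c => ι ℂ (E c)).prod = ((-1) ^ inversions l : ℂ) • E.ExteriorAlgebra l.toFinset := by
  rw [prod_map_eq_insertionSort (fun a b => ι_mul_ι_eq_neg (E a) (E b)),
    basis_exteriorAlgebra_eq_prod, wordInversions_eq_inversions]
  have h : l.toFinset.sort (· ≤ ·) = l.insertionSort (· ≤ ·) := by
    apply List.Perm.eq_of_pairwise (le := (· ≤ ·))
    · intro a b _ _ h1 h2; exact le_antisymm h1 h2
    · exact Finset.pairwise_sort _ _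
    · exact List.pairwise_insertionSort _ _
    · refine List.Perm.trans ?_ (List.perm_insertionSort _ l).symm
      rw [List.perm_ext_iff_of_nodup (Finset.sort_nodup _ _) hl]
      simp
  rw [h, Algebra.smul_def, map_pow, map_neg, map_one]

lemma mem_subsetWord {L : List (Finset (Fin r))} {x : Fin r} :
    x ∈ subsetWord L ↔ ∃ S ∈ L, x ∈ S := by
  simp [subsetWord]

lemma nodup_subsetWord {L : List (Finset (Fin r))} :
    (subsetWord L).Nodup ↔ L.Pairwise Disjoint := by
  rw [subsetWord, List.nodup_flatMap]
  constructor
  · rintro ⟨-, h⟩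
    refine h.imp fun {a b} hab => ?_
    rw [Finset.disjoint_left]
    intro x hx hx'
    exact hab ((Finset.mem_sort _).2 hx) ((Finset.mem_sort _).2 hx')
  · intro h
    refine ⟨fun S _ => Finset.sort_nodup _ _, h.imp fun {a b} hab => ?_⟩
    intro x hx hx'
    exact Finset.disjoint_left.1 hab ((Finset.mem_sort _).1 hx) ((Finset.mem_sort _).1 hx')

/-- The condition that the disjoint union of the subsets in a list is a given set. -/
def IsPartition (T : Finset (Fin r)) (L : List (Finset (Fin r))) : Prop :=
  L.Pairwise Disjoint ∧ ∀ x, x ∈ T ↔ ∃ S ∈ L, x ∈ S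

-- A word with a repeated color has product zero, and sorting a word without repetition costs one
-- sign for each inversion.
open Classical in
lemma wedgeEntry_eq (L : List (Finset (Fin r))) (T : Finset (Fin r)) :
    wedgeEntry E L T = if IsPartition T L then ((subsetSign L : ℤ) : ℂ) else 0 := by
  have h : (L.map E.ExteriorAlgebra).prod = ((subsetWord L).map fun c => ι ℂ (E c)).prod := by
    induction L with
    | nil => rfl
    | cons S L ih =>
      rw [List.map_cons, List.prod_cons, ih, basis_exteriorAlgebra_eq_prod]
      simp [subsetWord]
  rw [wedgeEntry, h]
  by_cases hn : (subsetWord L).Nodup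
  · rw [prod_map_ι_of_nodup E hn, map_smul, Finsupp.smul_apply, Module.Basis.repr_self,
      Finsupp.single_apply]
    have : (subsetWord L).toFinset = T ↔ IsPartition T L := by
      rw [IsPartition, Finset.ext_iff]
      simp only [List.mem_toFinset, mem_subsetWord, nodup_subsetWord.1 hn, true_and]
      exact forall_congr' fun x => Iff.comm
    rw [if_congr this rfl rfl]
    split_ifs <;> simp [subsetSign]
  · rw [prod_map_ι_eq_zero _ hn, map_zero, Finsupp.zero_apply, if_neg]
    exact fun hh => hn (nodup_subsetWord.2 hh.1)

open Classical in
lemma shuffleEntry_eq (T : Finset (Fin r)) (L : List (Finset (Fin r))) :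
    shuffleEntry T L = if IsPartition T L then
      ((subsetSign L * (-1) ^ blockInversions (L.map Finset.card) : ℤ) : ℂ) else 0 := by
  unfold shuffleEntry IsPartition
  congr

/-- The number of pairs in `S × S'` in decreasing order. -/
def crossInversions (S S' : Finset (Fin r)) : ℕ := ∑ x ∈ S, ∑ y ∈ S', if y < x then 1 else 0

lemma crossInversions_add_swap {S S' : Finset (Fin r)} (h : Disjoint S S') :
    crossInversions S S' + crossInversions S' S = S.card * S'.card := by
  unfold crossInversions
  rw [Finset.sum_comm (s := S'), ← Finset.sum_add_distrib, Finset.card_eq_sum_ones, Finset.sum_mul]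
  refine Finset.sum_congr rfl fun x hx => ?_
  rw [← Finset.sum_add_distrib, one_mul, Finset.card_eq_sum_ones]
  refine Finset.sum_congr rfl fun y hy => ?_
  have : x ≠ y := fun hxy => Finset.disjoint_left.1 h hx (hxy ▸ hy)
  rcases lt_or_gt_of_ne this with hlt | hlt <;> simp [hlt, hlt.not_gt]

lemma countP_sort_lt (S : Finset (Fin r)) (x : Fin r) :
    (S.sort (· ≤ ·)).countP (fun b => decide (b < x)) = ∑ y ∈ S, if y < x then 1 else 0 := by
  rw [← Finset.card_filter, List.countP_eq_length_filter,
    ← List.toFinset_card_of_nodup ((Finset.sort_nodup _ _).filter _)]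
  congr 1
  ext y
  simp

/-- Every block is sorted, so inversions occur only between different blocks. -/
lemma inversions_subsetWord_cons (S : Finset (Fin r)) (L : List (Finset (Fin r))) :
    inversions (subsetWord (S :: L)) =
      inversions (subsetWord L) + (L.map (crossInversions S)).sum := by
  rw [← wordInversions_eq_inversions, ← wordInversions_eq_inversions]
  have h1 : subsetWord (S :: L) = S.sort (· ≤ ·) ++ subsetWord L := by simp [subsetWord]
  rw [h1, wordInversions_append, wordInversions_eq_zero (Finset.pairwise_sort _ _), zero_add]
  congr 1
  have h2 : ((S.sort (· ≤ ·)).map fun a => (subsetWord L).countP fun b => decide (b < a)).sum =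
      ∑ a ∈ S, (subsetWord L).countP fun b => decide (b < a) := by
    rw [Finset.sum, ← Finset.sort_eq S (· ≤ ·), Multiset.map_coe, Multiset.sum_coe]
  rw [h2]
  induction L with
  | nil => simp [subsetWord]
  | cons T L ih =>
    have h3 : subsetWord (T :: L) = T.sort (· ≤ ·) ++ subsetWord L := by simp [subsetWord]
    simp only [h3, List.countP_append, Finset.sum_add_distrib, countP_sort_lt, List.map_cons,
      List.sum_cons] at ih ⊢
    rw [ih (by simp [subsetWord]) (by
      rw [Finset.sum, ← Finset.sort_eq S (· ≤ ·), Multiset.map_coe, Multiset.sum_coe])]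
    rfl

end Wedge

/-! ### Colorings and the total sign -/

section PairSums

variable {E : Type*}

/-- The sum of a function over pairs of entries of a list, in the order of the list. -/
def listPairSum (X : E → E → ZMod 2) : List E → ZMod 2
  | [] => 0
  | a :: l => (l.map (X a)).sum + listPairSum X l

/-- The position function `p` replaces the list, so that words at different vertices can be added as
one sum over pairs of edges. -/
lemma listPairSum_eq [DecidableEq E] (X : E → E → ZMod 2) {p : E → ℕ} {l : List E}
    (hl : l.Pairwise fun a b => p a < p b) :
    listPairSum X l = ∑ e ∈ l.toFinset, ∑ e' ∈ l.toFinset, ltInd (p e) (p e') * X e e' := by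
  induction l with
  | nil => rfl
  | cons a l ih =>
    rw [List.pairwise_cons] at hl
    have ha : a ∉ l.toFinset := fun h => lt_irrefl _ (hl.1 a (List.mem_toFinset.1 h))
    have hnd : l.Nodup := hl.2.imp fun {a b} h hab => by rw [hab] at h; exact lt_irrefl _ h
    rw [listPairSum, ih hl.2, List.toFinset_cons, Finset.sum_insert ha, Finset.sum_insert ha]
    simp only [Finset.sum_insert ha, ltInd_self, zero_mul, zero_add]
    rw [← List.sum_toFinset _ hnd]
    congr 1
    · refine Finset.sum_congr rfl fun e he => ?_
      rw [ltInd, if_pos (hl.1 e (List.mem_toFinset.1 he)), one_mul]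
    · refine Finset.sum_congr rfl fun e he => ?_
      have : ltInd (p e) (p a) = 0 := if_neg (hl.1 e (List.mem_toFinset.1 he)).not_gt
      rw [this, zero_mul, zero_add]

/-- The indicator of membership in a label, modulo two. -/
def labelIndicator {r : ℕ} (l : E → Finset (Fin r)) (p : E × Fin r) : ZMod 2 :=
  if p.2 ∈ l p.1 then 1 else 0

lemma sum_labelIndicator_mul {r : ℕ} (l : E → Finset (Fin r)) (e : E) (f : Fin r → ZMod 2) :
    ∑ c, labelIndicator l (e, c) * f c = ∑ c ∈ l e, f c := by
  simp [labelIndicator, Finset.sum_ite_mem]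

lemma cast_crossInversions {r : ℕ} (l : E → Finset (Fin r)) (e e' : E) :
    (crossInversions (l e) (l e') : ZMod 2) =
      ∑ c, ∑ c', labelIndicator l (e, c) * labelIndicator l (e', c') * ltInd c' c := by
  have : ∀ c, ∑ c', labelIndicator l (e, c) * labelIndicator l (e', c') * ltInd c' c =
      labelIndicator l (e, c) * ∑ c' ∈ l e', ltInd c' c := by
    intro c
    rw [← sum_labelIndicator_mul l e' fun c' => ltInd c' c, Finset.mul_sum]
    exact Finset.sum_congr rfl fun _ _ => mul_assoc _ _ _
  simp only [this, sum_labelIndicator_mul]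
  simp [crossInversions, ltInd]

lemma cast_inversions_subsetWord {r : ℕ} (l : E → Finset (Fin r)) (L : List E) :
    (inversions (subsetWord (L.map l)) : ZMod 2) =
      listPairSum (fun e e' => (crossInversions (l e) (l e') : ZMod 2)) L := by
  induction L with
  | nil => rfl
  | cons a L ih =>
    rw [List.map_cons, inversions_subsetWord_cons, Nat.cast_add, ih, listPairSum, add_comm]
    congr 1
    rw [← Nat.coe_castAddMonoidHom, map_list_sum, List.map_map, List.map_map]
    rfl

end PairSums

/-! ### Inversions between lexicographic orders -/

section Lex

variable {α β γ δ ε : Type*} [LinearOrder α] [LinearOrder β] [LinearOrder γ] [LinearOrder δ]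
  [LinearOrder ε]

lemma ltInd_toLex (a a' : α) (b b' : β) :
    ltInd (toLex (a, b)) (toLex (a', b')) = ltInd a a' + if a = a' then ltInd b b' else 0 := by
  simp only [ltInd, Prod.Lex.toLex_lt_toLex]
  rcases lt_trichotomy a a' with h | h | h
  · simp [h, h.ne]
  · subst h; simp
  · simp [h.not_gt, h.ne']

lemma ltInd_mul_swap (a a' : α) : ltInd a a' * ltInd a' a = 0 := by
  unfold ltInd
  split_ifs with h1 h2
  · exact absurd h1 h2.not_gt
  all_goals simp

/-- Inserting a middle key disturbs only pairs with equal first key. For labels, these are the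
inversions of the word read around one vertex. -/
lemma ltInd_refine (a a' : α) (p p' : β) (c c' : γ) :
    ltInd (toLex (a, toLex (p, c))) (toLex (a', toLex (p', c'))) *
        ltInd (toLex (a', c')) (toLex (a, c)) =
      if a = a' then ltInd p p' * ltInd c' c else 0 := by
  simp only [ltInd_toLex]
  rcases eq_or_ne a a' with rfl | h
  · rcases eq_or_ne p p' with rfl | h'
    · simp [ltInd_mul_swap]
    · simp [h']
  · simp [h, h.symm, ltInd_mul_swap]

/-- Ties in either key give no inversion: the two orders are then decided by the same remaining key.
-/
lemma ltInd_lex_swap (a a' : α) (b b' : β) :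
    ltInd (toLex (a, b)) (toLex (a', b')) * ltInd (toLex (b', a')) (toLex (b, a)) =
      ltInd a a' * ltInd b' b := by
  simp only [ltInd_toLex]
  rcases eq_or_ne a a' with rfl | h
  · rcases eq_or_ne b b' with rfl | h'
    · simp
    · simp [h'.symm, ltInd_mul_swap]
  · rcases eq_or_ne b b' with rfl | h'
    · simp [h, ltInd_mul_swap]
    · simp [h, h'.symm]

lemma ltInd_lex_same (c c' : γ) (a a' : α) (b b' : β) :
    ltInd (toLex (c, a)) (toLex (c', a')) * ltInd (toLex (c', b')) (toLex (c, b)) =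
      if c = c' then ltInd a a' * ltInd b' b else 0 := by
  simp only [ltInd_toLex]
  rcases eq_or_ne c c' with rfl | h
  · simp
  · simp [h, h.symm, ltInd_mul_swap]

/-- If the two keys in front separate the same pairs in both orders, the last key cannot create an
inversion. Applied to edges, this removes the dependence on the colors. -/
lemma ltInd_lex_coarsen {a a' : α} {p p' : β} {b b' : δ} {q q' : ε} (c c' : γ)
    (h : (a = a' ∧ p = p') ↔ (b' = b ∧ q' = q)) :
    ltInd (toLex (a, toLex (p, c))) (toLex (a', toLex (p', c'))) *
        ltInd (toLex (b', toLex (q', c'))) (toLex (b, toLex (q, c))) =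
      ltInd (toLex (a, p)) (toLex (a', p')) * ltInd (toLex (b', q')) (toLex (b, q)) := by
  simp only [ltInd_toLex]
  by_cases h1 : a = a' ∧ p = p'
  · obtain ⟨rfl, rfl⟩ := h.1 h1
    obtain ⟨rfl, rfl⟩ := h1
    simp [ltInd_mul_swap]
  · have h2 := fun hh => h1 (h.2 hh)
    have e1 : (if a = a' then ltInd p p' + (if p = p' then ltInd c c' else 0) else 0 : ZMod 2) =
        if a = a' then ltInd p p' else 0 := by
      by_cases ha : a = a'
      · have hp : p ≠ p' := fun hp => h1 ⟨ha, hp⟩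
        simp [ha, hp]
      · simp [ha]
    have e2 : (if b' = b then ltInd q' q + (if q' = q then ltInd c' c else 0) else 0 : ZMod 2) =
        if b' = b then ltInd q' q else 0 := by
      by_cases ha : b' = b
      · have hp : q' ≠ q := fun hp => h2 ⟨ha, hp⟩
        simp [ha, hp]
      · simp [ha]
    rw [e1, e2]

end Lex

namespace DiskGraph

variable {n r : ℕ} {G : DiskGraph n}

open Classical in
/-- The edges whose labels contain a given color. -/
noncomputable def colorClass (l : G.Edge → Finset (Fin r)) (c : Fin r) : Finset G.Edge :=
  Finset.univ.filter fun e => c ∈ l e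

@[simp] lemma mem_colorClass {l : G.Edge → Finset (Fin r)} {c : Fin r} {e : G.Edge} :
    e ∈ colorClass l c ↔ c ∈ l e := by
  simp [colorClass]

/-- A coloring is a labeling of the edges by sets of colors, such that the edges of each color
form a dimer configuration. -/
def IsColoring (l : G.Edge → Finset (Fin r)) : Prop := ∀ c, G.IsDimer (colorClass l c)

/-- The subsets at the boundary vertices. -/
def HasBoundaryLabels (l : G.Edge → Finset (Fin r)) (S : Fin n → Finset (Fin r)) : Prop :=
  ∀ i c, c ∈ S i ↔ ∃ e, G.black e = Sum.inr i ∧ c ∈ l e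

variable {l : G.Edge → Finset (Fin r)} {S : Fin n → Finset (Fin r)}

lemma IsColoring.eq_of_white (h : IsColoring l) {e e' : G.Edge} {c : Fin r} (he : c ∈ l e)
    (he' : c ∈ l e') (hw : G.white e = G.white e') : e = e' :=
  (h c).eq_of_white_eq (by simpa) (by simpa) hw

lemma IsColoring.eq_of_black (h : IsColoring l) {e e' : G.Edge} {c : Fin r} (he : c ∈ l e)
    (he' : c ∈ l e') (hw : G.black e = G.black e') : e = e' :=
  (h c).eq_of_black_eq (by simpa) (by simpa) hw

lemma HasBoundaryLabels.eq (h : HasBoundaryLabels l S) {e : G.Edge} {i : Fin n}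
    (he : G.black e = Sum.inr i) : S i = l e := by
  ext c
  rw [h]
  constructor
  · rintro ⟨e', he', hc⟩
    rwa [G.boundary_unique e e' i he he']
  · exact fun hc => ⟨e, he, hc⟩

/-- A coloring realizes every pair of a white vertex and a color exactly once, so the sum does not
depend on the coloring. -/
lemma IsColoring.sum_white (h : IsColoring l) (F : G.White → Fin r → ZMod 2) :
    ∑ p : G.Edge × Fin r, labelIndicator l p * F (G.white p.1) p.2 = ∑ w, ∑ c, F w c := by
  rw [Fintype.sum_prod_type_right]
  refine Eq.trans ?_ Finset.sum_comm
  refine Finset.sum_congr rfl fun c _ => ?_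
  have h1 : ∑ e, labelIndicator l (e, c) * F (G.white e) c =
      ∑ e ∈ colorClass l c, F (G.white e) c := by
    classical
    rw [colorClass, Finset.sum_filter]
    exact Finset.sum_congr rfl fun e _ => by simp [labelIndicator]
  rw [h1]
  refine Finset.sum_bij (fun e _ => G.white e) (fun _ _ => Finset.mem_univ _)
    (fun e he e' he' hw => (h c).eq_of_white_eq he he' hw) (fun w _ => ?_) fun _ _ => rfl
  obtain ⟨e, ⟨he, hw⟩, -⟩ := (h c).1 w
  exact ⟨e, he, hw⟩

/-- At black ends, a coloring realizes all pairs at interior vertices once and, at the boundary,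
exactly the pairs prescribed by `S`. -/
lemma IsColoring.sum_black (h : IsColoring l) (hS : HasBoundaryLabels l S)
    (F : G.Black ⊕ Fin n → Fin r → ZMod 2) :
    ∑ p : G.Edge × Fin r, labelIndicator l p * F (G.black p.1) p.2 =
      ∑ b, ∑ c, F (Sum.inl b) c +
        ∑ p : Fin n × Fin r, labelIndicator S p * F (Sum.inr p.1) p.2 := by
  classical
  have hcomm : ∑ b, ∑ c, F (Sum.inl b) c = ∑ c, ∑ b, F (Sum.inl b) c := Finset.sum_comm
  rw [Fintype.sum_prod_type_right, Fintype.sum_prod_type_right, hcomm, ← Finset.sum_add_distrib]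
  refine Finset.sum_congr rfl fun c _ => ?_
  have h1 : ∑ e, labelIndicator l (e, c) * F (G.black e) c =
      ∑ e ∈ colorClass l c, F (G.black e) c := by
    rw [colorClass, Finset.sum_filter]
    exact Finset.sum_congr rfl fun e _ => by simp [labelIndicator]
  have h2 : ∑ b, F (Sum.inl b) c + ∑ i, labelIndicator S (i, c) * F (Sum.inr i) c =
      ∑ x : G.Black ⊕ Fin n with (∀ i, x = Sum.inr i → c ∈ S i), F x c := by
    rw [Finset.sum_filter, Fintype.sum_sum_type]
    congr 1
    · simp
    · refine Finset.sum_congr rfl fun i _ => ?_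
      simp [labelIndicator]
  rw [h1, h2]
  refine Finset.sum_bij (fun e _ => G.black e) (fun e he => ?_)
    (fun e he e' he' hw => (h c).eq_of_black_eq he he' hw) (fun x hx => ?_) fun _ _ => rfl
  · rw [Finset.mem_filter]
    exact ⟨Finset.mem_univ _, fun i hi => (hS i c).2 ⟨e, hi, by simpa using he⟩⟩
  · rcases x with b | i
    · obtain ⟨e, ⟨he, hb⟩, -⟩ := (h c).2 b
      exact ⟨e, he, hb⟩
    · obtain ⟨e, he, hc⟩ := (hS i c).1 ((Finset.mem_filter.1 hx).2 i rfl)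
      exact ⟨e, by simpa using hc, he⟩

/-- Every color class is a dimer configuration, and the excedance makes it use `k` boundary edges.
-/
lemma IsColoring.sum_boundary {k : ℕ} (hk : Fintype.card G.White = Fintype.card G.Black + k)
    (h : IsColoring l) (hS : HasBoundaryLabels l S) (f : Fin r → ZMod 2) :
    ∑ p : Fin n × Fin r, labelIndicator S p * f p.2 = k * ∑ c, f c := by
  classical
  have h1 := h.sum_black hS fun x c => match x with
    | Sum.inl _ => 0
    | Sum.inr _ => f c
  simp only [Finset.sum_const_zero, zero_add] at h1
  rw [← h1, Fintype.sum_prod_type_right, Finset.mul_sum]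
  refine Finset.sum_congr rfl fun c _ => ?_
  have h2 := (h c).card_boundary hk
  rw [← h2, ← nsmul_eq_mul, ← Finset.sum_const, colorClass, Finset.filter_filter,
    Finset.sum_filter]
  refine Finset.sum_congr rfl fun e _ => ?_
  rcases hb : G.black e with b | i
  · simp
  · by_cases hc : c ∈ l e <;> simp [labelIndicator, hc]

end DiskGraph

/-! ### The sign of a coloring -/

namespace DiskGraph

variable {n r : ℕ} {G : DiskGraph n} {l : G.Edge → Finset (Fin r)} {S : Fin n → Finset (Fin r)}

lemma pairwise_idxOf {E : Type*} [DecidableEq E] {L : List E} (hL : L.Nodup) :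
    L.Pairwise fun a b => L.idxOf a < L.idxOf b := by
  rw [List.pairwise_iff_getElem]
  intro i j hi hj hij
  rwa [hL.idxOf_getElem, hL.idxOf_getElem]

/-- Inversions around all vertices of a partition of the edges. -/
lemma sum_inversions_eq {E V : Type*} [Fintype E] [Fintype V] [DecidableEq V]
    (v : E → V) (L : V → List E) {p : E → ℕ} (hp : ∀ w, (L w).Pairwise fun a b => p a < p b)
    (hL : ∀ w e, e ∈ L w ↔ v e = w) (l : E → Finset (Fin r)) :
    ∑ w, (inversions (subsetWord ((L w).map l)) : ZMod 2) =
      ∑ x : E × Fin r, ∑ y : E × Fin r, labelIndicator l x * labelIndicator l y *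
        if v x.1 = v y.1 then ltInd (p x.1) (p y.1) * ltInd y.2 x.2 else 0 := by
  classical
  have h1 : ∀ w, (inversions (subsetWord ((L w).map l)) : ZMod 2) =
      ∑ e, ∑ e', if v e = w then if v e' = w then
        ltInd (p e) (p e') * (crossInversions (l e) (l e') : ZMod 2) else 0 else 0 := by
    intro w
    have hset : (L w).toFinset = Finset.univ.filter fun e => v e = w := by
      ext e; simp [hL]
    rw [cast_inversions_subsetWord, listPairSum_eq _ (hp w), hset, Finset.sum_filter]
    refine Finset.sum_congr rfl fun e _ => ?_
    split_ifs
    · rw [Finset.sum_filter]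
    · simp
  simp only [h1]
  rw [Finset.sum_comm, Fintype.sum_prod_type]
  refine Finset.sum_congr rfl fun e _ => ?_
  rw [Finset.sum_comm]
  simp only [Finset.sum_ite_eq, Finset.mem_univ, if_true, Fintype.sum_prod_type]
  rw [Finset.sum_comm]
  refine Finset.sum_congr rfl fun e' _ => ?_
  simp only [eq_comm (a := v e')]
  split_ifs
  · rw [cast_crossInversions, Finset.mul_sum]
    refine Finset.sum_congr rfl fun c _ => ?_
    rw [Finset.mul_sum]
    exact Finset.sum_congr rfl fun c' _ => by ring
  · simp

lemma inversions_ofFn_eq (S : Fin n → Finset (Fin r)) :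
    (inversions (subsetWord (List.ofFn fun i => S i)) : ZMod 2) =
      ∑ x : Fin n × Fin r, ∑ y : Fin n × Fin r, labelIndicator S x * labelIndicator S y *
        (ltInd (x.1 : ℕ) y.1 * ltInd y.2 x.2) := by
  have h := sum_inversions_eq (V := Unit) (fun _ : Fin n => ()) (fun _ => List.finRange n)
    (p := fun i => (i : ℕ)) (fun _ => List.pairwise_lt_finRange n) (by simp) S
  rw [List.ofFn_eq_map]
  simpa using h

/-- For a function of the edges alone, only the cardinalities of the labels matter. -/
lemma sum_sum_pair {E : Type*} [Fintype E] (l : E → Finset (Fin r)) (F : E → E → ZMod 2) :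
    ∑ x : E × Fin r, ∑ y : E × Fin r, labelIndicator l x * labelIndicator l y * F x.1 y.1 =
      ∑ e, ∑ e', ((l e).card : ZMod 2) * ((l e').card : ZMod 2) * F e e' := by
  have hc : ∀ e, ((l e).card : ZMod 2) = ∑ c, labelIndicator l (e, c) := fun e => by
    simp [labelIndicator]
  rw [Fintype.sum_prod_type]
  refine Finset.sum_congr rfl fun e _ => ?_
  simp only [Fintype.sum_prod_type]
  rw [Finset.sum_comm]
  refine Finset.sum_congr rfl fun e' _ => ?_
  rw [hc, hc, Finset.sum_mul_sum, Finset.sum_mul]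
  exact Finset.sum_congr rfl fun c _ => (Finset.sum_mul _ _ _).symm

/-- The sign of the permutation from the order of the black ends to the order of the white ends
of the edges of a coloring depends only on the boundary, up to signs of the edges. -/
theorem exists_coloring_sign {k : ℕ} (hk : Fintype.card G.White = Fintype.card G.Black + k) :
    ∃ (κ : G.Edge → ZMod 2) (c : ZMod 2),
      ∀ (l : G.Edge → Finset (Fin r)) (S : Fin n → Finset (Fin r)),
      IsColoring l → HasBoundaryLabels l S →
      invSum (labelIndicator l)
          (fun p => (toLex (G.whiteIndex (G.white p.1), p.2) : ℕ ×ₗ Fin r))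
          (fun p => (toLex (G.blackIndex (G.black p.1), p.2) : ℕ ×ₗ Fin r)) +
        ∑ e, ((l e).card : ZMod 2) * κ e +
        (inversions (subsetWord (List.ofFn fun i => S i)) : ZMod 2) = c := by
  classical
  obtain ⟨κ, c₀, hκ⟩ := G.exists_kasteleyn hk
  let wi : G.Edge → ℕ := fun e => G.whiteIndex (G.white e)
  let bi : G.Edge → ℕ := fun e => G.blackIndex (G.black e)
  have hwi : ∀ e e', wi e = wi e' ↔ G.white e = G.white e' := fun e e' =>
    G.whiteIndex_injective.eq_iff
  have hbi : ∀ e e', bi e = bi e' ↔ G.black e = G.black e' := fun e e' =>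
    G.blackIndex_injective.eq_iff
  refine ⟨κ, (∑ w, ∑ c : Fin r, ∑ w', ∑ c' : Fin r, ltInd (G.whiteIndex w) (G.whiteIndex w') *
        ltInd c' c) + r * c₀ +
      (∑ b, ∑ c : Fin r, ∑ b', ∑ c' : Fin r, ltInd c c' *
        ltInd (G.blackIndex (Sum.inl b')) (G.blackIndex (Sum.inl b))) +
      ∑ _b : G.Black, ∑ c : Fin r, k * ∑ c' : Fin r, ltInd c c', fun l S hl hS => ?_⟩
  let y := labelIndicator l
  let f2 : G.Edge × Fin r → ℕ ×ₗ Fin r := fun p => toLex (wi p.1, p.2)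
  let f3 : G.Edge × Fin r → Fin r ×ₗ ℕ := fun p => toLex (p.2, wi p.1)
  let f4 : G.Edge × Fin r → Fin r ×ₗ ℕ := fun p => toLex (p.2, bi p.1)
  let f5 : G.Edge × Fin r → ℕ ×ₗ Fin r := fun p => toLex (bi p.1, p.2)
  have hy : ∀ p, y p ≠ 0 → p.2 ∈ l p.1 := fun p hp => by
    by_contra hn
    exact hp (by simp [y, labelIndicator, hn])
  have i2 : InjWeight y f2 := by
    rintro ⟨e, c⟩ ⟨e', c'⟩ hp hq h
    have h' : (wi e, c) = (wi e', c') := h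
    simp only [Prod.mk.injEq] at h'
    obtain ⟨h1, rfl⟩ := h'
    have h2 : e = e' := hl.eq_of_white (c := c) (hy (e, c) hp) (hy (e', c) hq) ((hwi e e').1 h1)
    rw [h2]
  have i3 : InjWeight y f3 := by
    rintro ⟨e, c⟩ ⟨e', c'⟩ hp hq h
    have h' : (c, wi e) = (c', wi e') := h
    simp only [Prod.mk.injEq] at h'
    obtain ⟨rfl, h1⟩ := h'
    have h2 : e = e' := hl.eq_of_white (c := c) (hy (e, c) hp) (hy (e', c) hq) ((hwi e e').1 h1)
    rw [h2]
  have i4 : InjWeight y f4 := by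
    rintro ⟨e, c⟩ ⟨e', c'⟩ hp hq h
    have h' : (c, bi e) = (c', bi e') := h
    simp only [Prod.mk.injEq] at h'
    obtain ⟨rfl, h1⟩ := h'
    have h2 : e = e' := hl.eq_of_black (c := c) (hy (e, c) hp) (hy (e', c) hq) ((hbi e e').1 h1)
    rw [h2]
  have i5 : InjWeight y f5 := by
    rintro ⟨e, c⟩ ⟨e', c'⟩ hp hq h
    have h' : (bi e, c) = (bi e', c') := h
    simp only [Prod.mk.injEq] at h'
    obtain ⟨h1, rfl⟩ := h'
    have h2 : e = e' := hl.eq_of_black (c := c) (hy (e, c) hp) (hy (e', c) hq) ((hbi e e').1 h1)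
    rw [h2]
  -- The order (white end, color) is changed to (color, white end), then within each color to
  -- (color, black end), then to (black end, color). Each key is injective on a coloring, as a color
  -- occurs once at each vertex it meets.
  have chain : invSum y f2 f5 = invSum y f2 f3 + invSum y f3 f4 + invSum y f4 f5 := by
    rw [invSum_add_invSum i2 i3 i4, invSum_add_invSum i2 i4 i5]
  have e23 : invSum y f2 f3 = ∑ w, ∑ c : Fin r, ∑ w', ∑ c' : Fin r,
      ltInd (G.whiteIndex w) (G.whiteIndex w') * ltInd c' c := by
    rw [← hl.sum_white fun w c => ∑ w', ∑ c' : Fin r,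
      ltInd (G.whiteIndex w) (G.whiteIndex w') * ltInd c' c]
    refine Finset.sum_congr rfl fun p _ => ?_
    rw [← hl.sum_white fun w' c' => ltInd (G.whiteIndex (G.white p.1)) (G.whiteIndex w') *
      ltInd c' p.2, Finset.mul_sum]
    refine Finset.sum_congr rfl fun q _ => ?_
    refine Eq.trans ?_ (mul_assoc _ _ _)
    congr 1
    exact ltInd_lex_swap _ _ _ _
  -- Different colors never interchange here, so this is the sum of the dimer signs of the color
  -- classes.
  have e34 : invSum y f3 f4 = r * c₀ + ∑ e, ((l e).card : ZMod 2) * κ e := by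
    have h1 : invSum y f3 f4 = ∑ c, G.matchingInversions (colorClass l c) := by
      unfold invSum
      rw [Fintype.sum_prod_type_right]
      refine Finset.sum_congr rfl fun c _ => Finset.sum_congr rfl fun e _ => ?_
      rw [Fintype.sum_prod_type]
      refine Finset.sum_congr rfl fun e' _ => ?_
      have h2 : ∀ c', ltInd (f3 (e, c)) (f3 (e', c')) * ltInd (f4 (e', c')) (f4 (e, c)) =
          if c = c' then ltInd (wi e) (wi e') * ltInd (bi e') (bi e) else 0 := fun c' =>
        ltInd_lex_same _ _ _ _ _ _
      simp only [h2, mul_ite, mul_zero, Finset.sum_ite_eq, Finset.mem_univ, if_true]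
      simp [y, labelIndicator, edgeIndicator, wi, bi]
    have h2 : ∀ c, G.matchingInversions (colorClass l c) = c₀ + ∑ e ∈ colorClass l c, κ e :=
      fun c => by
        rw [← hκ _ (hl c), add_assoc, zmod_two_add_self, add_zero]
    rw [h1, Finset.sum_congr rfl fun c _ => h2 c, Finset.sum_add_distrib, Finset.sum_const,
      Finset.card_univ, Fintype.card_fin, nsmul_eq_mul]
    congr 1
    simp only [colorClass, Finset.sum_filter]
    rw [Finset.sum_comm]
    refine Finset.sum_congr rfl fun e _ => ?_
    simp
  -- Pairs of interior ends give a constant, and pairs of boundary ends give the inversions of the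
  -- word of `S`. Mixed pairs depend only on `k`, because boundary vertices precede interior ones
  -- and each color occurs `k` times at the boundary.
  have e45 : invSum y f4 f5 = (∑ b, ∑ c : Fin r, ∑ b', ∑ c' : Fin r, ltInd c c' *
        ltInd (G.blackIndex (Sum.inl b')) (G.blackIndex (Sum.inl b))) +
      ∑ _b : G.Black, ∑ c : Fin r, k * ∑ c' : Fin r, ltInd c c' +
      (inversions (subsetWord (List.ofFn fun i => S i)) : ZMod 2) := by
    let F : G.Black ⊕ Fin n → Fin r → G.Black ⊕ Fin n → Fin r → ZMod 2 := fun x c x' c' =>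
      ltInd c c' * ltInd (G.blackIndex x') (G.blackIndex x)
    have h1 : invSum y f4 f5 = ∑ p, y p * ∑ q, y q * F (G.black p.1) p.2 (G.black q.1) q.2 := by
      refine Finset.sum_congr rfl fun p _ => ?_
      rw [Finset.mul_sum]
      refine Finset.sum_congr rfl fun q _ => ?_
      refine Eq.trans ?_ (mul_assoc _ _ _)
      congr 1
      exact ltInd_lex_swap _ _ _ _
    have h2 : ∀ x c, ∑ q, y q * F x c (G.black q.1) q.2 = ∑ b, ∑ c', F x c (Sum.inl b) c' +
        ∑ q : Fin n × Fin r, labelIndicator S q * F x c (Sum.inr q.1) q.2 := fun x c =>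
      hl.sum_black hS fun x' c' => F x c x' c'
    rw [h1]
    simp only [h2]
    rw [hl.sum_black hS fun x c => ∑ b, ∑ c', F x c (Sum.inl b) c' +
        ∑ q : Fin n × Fin r, labelIndicator S q * F x c (Sum.inr q.1) q.2]
    simp only [Finset.sum_add_distrib]
    congr 1
    · congr 1
      refine Finset.sum_congr rfl fun b _ => Finset.sum_congr rfl fun c _ => ?_
      rw [← hl.sum_boundary hk hS]
      refine Finset.sum_congr rfl fun q _ => ?_
      have : ltInd (G.blackIndex (Sum.inr q.1)) (G.blackIndex (Sum.inl b)) = 1 := by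
        rw [ltInd, if_pos]
        simp only [blackIndex]
        omega
      simp only [F, this, mul_one]
    · rw [inversions_ofFn_eq, Finset.sum_comm]
      refine Finset.sum_congr rfl fun p _ => ?_
      have h3 : ∀ b c', F (Sum.inr p.1) p.2 (Sum.inl b) c' = 0 := by
        intro b c'
        have : ltInd (G.blackIndex (Sum.inl b)) (G.blackIndex (Sum.inr p.1)) = 0 := by
          rw [ltInd, if_neg]
          simp only [blackIndex]
          omega
        simp only [F, this, mul_zero]
      simp only [h3, Finset.sum_const_zero, zero_add]
      rw [Finset.mul_sum]
      refine Finset.sum_congr rfl fun q _ => ?_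
      simp only [F, blackIndex]
      ring
  rw [e23, e34, e45] at chain
  change invSum y f2 f5 + _ + _ = _
  have z1 := zmod_two_add_self (∑ e, ((l e).card : ZMod 2) * κ e)
  have z2 := zmod_two_add_self (inversions (subsetWord (List.ofFn fun i => S i)) : ZMod 2)
  linear_combination chain + z1 + z2

/-- The total sign of a coloring depends only on the multiplicities of the edges. -/
theorem exists_total_sign {k : ℕ} (hk : Fintype.card G.White = Fintype.card G.Black + k)
    (LW : G.White → List G.Edge) (LB : G.Black → List G.Edge)
    (hLW : ∀ w, (LW w).Nodup) (hLB : ∀ b, (LB b).Nodup)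
    (hW : ∀ w e, e ∈ LW w ↔ G.white e = w) (hB : ∀ b e, e ∈ LB b ↔ G.black e = Sum.inl b) :
    ∃ C : (G.Edge → ZMod 2) → ZMod 2, ∀ (l : G.Edge → Finset (Fin r)) (S : Fin n → Finset (Fin r)),
      IsColoring l → HasBoundaryLabels l S →
      ∑ w, (inversions (subsetWord ((LW w).map l)) : ZMod 2) +
        ∑ b, (inversions (subsetWord ((LB b).map l)) : ZMod 2) +
        (inversions (subsetWord (List.ofFn fun i => S i)) : ZMod 2) =
      C fun e => ((l e).card : ZMod 2) := by
  classical
  obtain ⟨κ, c₀, hκ⟩ := exists_coloring_sign (r := r) hk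
  let pW : G.Edge → ℕ := fun e => (LW (G.white e)).idxOf e
  -- Boundary vertices receive lists as well, so that every edge has a position at its black end.
  -- These have at most one entry and contribute no inversions.
  let LB' : G.Black ⊕ Fin n → List G.Edge := fun x => match x with
    | Sum.inl b => LB b
    | Sum.inr i => (Finset.univ.filter fun e => G.black e = Sum.inr i).toList
  have hLB' : ∀ x, (LB' x).Nodup := by
    rintro (b | i)
    · exact hLB b
    · exact Finset.nodup_toList _
  have hB' : ∀ x e, e ∈ LB' x ↔ G.black e = x := by
    rintro (b | i) e
    · exact hB b e
    · simp [LB']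
  let pB : G.Edge → ℕ := fun e => (LB' (G.black e)).idxOf e
  have hpW : ∀ w, (LW w).Pairwise fun a b => pW a < pW b := fun w => by
    refine (pairwise_idxOf (hLW w)).imp_of_mem fun {a b} ha hb hab => ?_
    simpa only [pW, (hW w a).1 ha, (hW w b).1 hb] using hab
  have hpB : ∀ x, (LB' x).Pairwise fun a b => pB a < pB b := fun x => by
    refine (pairwise_idxOf (hLB' x)).imp_of_mem fun {a b} ha hb hab => ?_
    simpa only [pB, (hB' x a).1 ha, (hB' x b).1 hb] using hab
  have injW : ∀ e e', G.white e = G.white e' → pW e = pW e' → e = e' := fun e e' h1 h2 => by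
    have m1 := (hW _ e).2 rfl
    have m2 := (hW _ e').2 h1.symm
    simp only [pW, ← h1] at h2
    exact (List.idxOf_inj m1).1 h2
  have injB : ∀ e e', G.black e = G.black e' → pB e = pB e' → e = e' := fun e e' h1 h2 => by
    have m1 := (hB' _ e).2 rfl
    have m2 := (hB' _ e').2 h1.symm
    simp only [pB, ← h1] at h2
    exact (List.idxOf_inj m1).1 h2
  let wi : G.Edge → ℕ := fun e => G.whiteIndex (G.white e)
  let bi : G.Edge → ℕ := fun e => G.blackIndex (G.black e)
  have hwi : ∀ e e', wi e = wi e' ↔ G.white e = G.white e' := fun e e' =>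
    G.whiteIndex_injective.eq_iff
  have hbi : ∀ e e', bi e = bi e' ↔ G.black e = G.black e' := fun e e' =>
    G.blackIndex_injective.eq_iff
  refine ⟨fun m => ∑ e, ∑ e', m e * m e' *
        (ltInd (toLex (wi e, pW e)) (toLex (wi e', pW e')) *
          ltInd (toLex (bi e', pB e')) (toLex (bi e, pB e))) +
      c₀ + ∑ e, m e * κ e, fun l S hl hS => ?_⟩
  let y := labelIndicator l
  let f1 : G.Edge × Fin r → ℕ ×ₗ (ℕ ×ₗ Fin r) := fun p => toLex (wi p.1, toLex (pW p.1, p.2))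
  let f2 : G.Edge × Fin r → ℕ ×ₗ Fin r := fun p => toLex (wi p.1, p.2)
  let f5 : G.Edge × Fin r → ℕ ×ₗ Fin r := fun p => toLex (bi p.1, p.2)
  let f6 : G.Edge × Fin r → ℕ ×ₗ (ℕ ×ₗ Fin r) := fun p => toLex (bi p.1, toLex (pB p.1, p.2))
  have hy : ∀ p, y p ≠ 0 → p.2 ∈ l p.1 := fun p hp => by
    by_contra hn
    exact hp (by simp [y, labelIndicator, hn])
  have i1 : InjWeight y f1 := by
    rintro ⟨e, c⟩ ⟨e', c'⟩ - - h
    have h' : (wi e, (pW e, c)) = (wi e', (pW e', c')) := h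
    simp only [Prod.mk.injEq] at h'
    obtain ⟨h1, h2, rfl⟩ := h'
    rw [injW e e' ((hwi _ _).1 h1) h2]
  have i2 : InjWeight y f2 := by
    rintro ⟨e, c⟩ ⟨e', c'⟩ hp hq h
    have h' : (wi e, c) = (wi e', c') := h
    simp only [Prod.mk.injEq] at h'
    obtain ⟨h1, rfl⟩ := h'
    have h2 : e = e' := hl.eq_of_white (c := c) (hy (e, c) hp) (hy (e', c) hq) ((hwi e e').1 h1)
    rw [h2]
  have i5 : InjWeight y f5 := by
    rintro ⟨e, c⟩ ⟨e', c'⟩ hp hq h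
    have h' : (bi e, c) = (bi e', c') := h
    simp only [Prod.mk.injEq] at h'
    obtain ⟨h1, rfl⟩ := h'
    have h2 : e = e' := hl.eq_of_black (c := c) (hy (e, c) hp) (hy (e', c) hq) ((hbi e e').1 h1)
    rw [h2]
  have i6 : InjWeight y f6 := by
    rintro ⟨e, c⟩ ⟨e', c'⟩ - - h
    have h' : (bi e, (pB e, c)) = (bi e', (pB e', c')) := h
    simp only [Prod.mk.injEq] at h'
    obtain ⟨h1, h2, rfl⟩ := h'
    rw [injB e e' ((hbi _ _).1 h1) h2]
  -- At the two extremes each label is one sorted block, so only whole edges are interchanged and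
  -- the count depends on the multiplicities. Sorting the blocks around each vertex by color
  -- produces the vertex words, and the middle link is `exists_coloring_sign`.
  have chain : invSum y f1 f6 = invSum y f1 f2 + invSum y f2 f5 + invSum y f5 f6 := by
    rw [invSum_add_invSum i1 i2 i5, invSum_add_invSum i1 i5 i6]
  have e16 : invSum y f1 f6 = ∑ e, ∑ e', ((l e).card : ZMod 2) * ((l e').card : ZMod 2) *
        (ltInd (toLex (wi e, pW e)) (toLex (wi e', pW e')) *
          ltInd (toLex (bi e', pB e')) (toLex (bi e, pB e))) := by
    rw [← sum_sum_pair l fun e e' => ltInd (toLex (wi e, pW e)) (toLex (wi e', pW e')) *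
          ltInd (toLex (bi e', pB e')) (toLex (bi e, pB e))]
    refine Finset.sum_congr rfl fun p _ => Finset.sum_congr rfl fun q _ => ?_
    congr 1
    apply ltInd_lex_coarsen
    constructor
    · rintro ⟨h1, h2⟩
      rw [injW _ _ ((hwi _ _).1 h1) h2]
      exact ⟨rfl, rfl⟩
    · rintro ⟨h1, h2⟩
      rw [injB _ _ ((hbi _ _).1 h1) h2]
      exact ⟨rfl, rfl⟩
  have e12 : invSum y f1 f2 = ∑ w, (inversions (subsetWord ((LW w).map l)) : ZMod 2) := by
    rw [sum_inversions_eq G.white LW hpW hW l]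
    refine Finset.sum_congr rfl fun p _ => Finset.sum_congr rfl fun q _ => ?_
    congr 1
    exact (ltInd_refine _ _ _ _ _ _).trans (if_congr (hwi _ _) rfl rfl)
  have e56 : invSum y f5 f6 = ∑ b, (inversions (subsetWord ((LB b).map l)) : ZMod 2) := by
    have h1 := sum_inversions_eq G.black LB' hpB hB' l
    rw [Fintype.sum_sum_type] at h1
    have h2 : ∀ i : Fin n,
        (inversions (subsetWord ((LB' (Sum.inr i)).map l)) : ZMod 2) = 0 := by
      intro i
      have hlen : (LB' (Sum.inr i)).length ≤ 1 := by
        rw [Finset.length_toList, Finset.card_le_one]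
        intro e he e' he'
        exact G.boundary_unique e e' i (by simpa using he) (by simpa using he')
      match h : LB' (Sum.inr i), hlen with
      | [], _ => rfl
      | [a], _ => rw [cast_inversions_subsetWord]; simp [listPairSum]
    simp only [h2, Finset.sum_const_zero, add_zero] at h1
    rw [h1, invSum_comm]
    refine Finset.sum_congr rfl fun p _ => Finset.sum_congr rfl fun q _ => ?_
    congr 1
    exact (ltInd_refine _ _ _ _ _ _).trans (if_congr (hbi _ _) rfl rfl)
  have e25 : invSum y f2 f5 + ∑ e, ((l e).card : ZMod 2) * κ e +
      (inversions (subsetWord (List.ofFn fun i => S i)) : ZMod 2) = c₀ := hκ l S hl hS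
  rw [e16, e12, e56] at chain
  beta_reduce
  have z1 := zmod_two_add_self (invSum y f2 f5)
  have z2 := zmod_two_add_self (∑ e, ((l e).card : ZMod 2) * κ e)
  linear_combination e25 - chain - z1 - z2

end DiskGraph

/-! ### The value of a tagged web -/

/-- The sign attached to a parity. -/
def paritySign (x : ZMod 2) : ℂ := if x = 0 then 1 else -1

lemma paritySign_add (x y : ZMod 2) : paritySign (x + y) = paritySign x * paritySign y := by
  have h : ∀ z : ZMod 2, z = 0 ∨ z = 1 := by decide
  have h2 : (1 : ZMod 2) + 1 = 0 := by decide
  have h3 : (1 : ZMod 2) ≠ 0 := by decide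
  rcases h x with rfl | rfl <;> rcases h y with rfl | rfl <;> simp [paritySign, h2, h3]

@[simp] lemma paritySign_zero : paritySign 0 = 1 := if_pos rfl

lemma paritySign_natCast (m : ℕ) : paritySign m = (-1) ^ m := by
  induction m with
  | zero => simp
  | succ m ih =>
    rw [Nat.cast_add, paritySign_add, ih, pow_succ]
    congr 1

lemma paritySign_sum {ι : Type*} (s : Finset ι) (f : ι → ZMod 2) :
    paritySign (∑ i ∈ s, f i) = ∏ i ∈ s, paritySign (f i) := by
  classical
  induction s using Finset.induction_on with
  | empty => simp
  | insert a s ha ih => rw [Finset.sum_insert ha, Finset.prod_insert ha, paritySign_add, ih]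

lemma paritySign_inversions {r : ℕ} (L : List (Finset (Fin r))) :
    ((subsetSign L : ℤ) : ℂ) = paritySign (inversions (subsetWord L)) := by
  rw [paritySign_natCast, subsetSign]; push_cast; rfl

section CycleAfter

-- The list of a cycle is empty at a fixed point, so its tail gives the remaining elements correctly
-- in both cases once `e` is put back in front.
open Classical in
lemma cons_cycleAfter_perm {α : Type} [Fintype α] (σ : Equiv.Perm α) (e : α) :
    (e :: cycleAfter σ e).Nodup ∧ ∀ x, x ∈ e :: cycleAfter σ e ↔ σ.SameCycle e x := by
  by_cases he : e ∈ σ.support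
  · have hne : σ.toList e ≠ [] := by
      rw [Ne, Equiv.Perm.toList_eq_nil_iff]; exact fun h => h he
    have hh : (σ.toList e).head hne = e := by
      have h2 : 2 ≤ (σ.toList e).length := Equiv.Perm.two_le_length_toList_iff_mem_support.2 he
      rw [List.head_eq_getElem]
      exact Equiv.Perm.getElem_toList σ e 0 (by omega)
    have h1 : e :: cycleAfter σ e = σ.toList e := by
      conv_rhs => rw [← List.cons_head_tail hne, hh]
      unfold cycleAfter
      congr
    rw [h1]
    refine ⟨Equiv.Perm.nodup_toList σ e, fun x => ?_⟩
    rw [Equiv.Perm.mem_toList_iff]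
    exact and_iff_left he
  · have h1 : cycleAfter σ e = [] := by
      unfold cycleAfter
      rw [Equiv.Perm.toList_eq_nil_iff.2 he]; rfl
    have hfix : σ e = e := by simpa using he
    rw [h1]
    refine ⟨List.nodup_singleton e, fun x => ?_⟩
    rw [List.mem_singleton]
    constructor
    · rintro rfl; exact Equiv.Perm.SameCycle.refl _ _
    · exact fun h => (h.eq_of_left hfix).symm

end CycleAfter

section Complement

variable {r : ℕ}

/-- The parity of the word formed by a set and its complement. -/
def complementInversions (X : Finset (Fin r)) : ZMod 2 := crossInversions X Xᶜ

lemma inversions_pair (X Y : Finset (Fin r)) :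
    inversions (subsetWord [X, Y]) = crossInversions X Y := by
  rw [inversions_subsetWord_cons, inversions_subsetWord_cons]
  simp [subsetWord, inversions]

lemma cast_crossInversions_compl_left (X : Finset (Fin r)) :
    (crossInversions Xᶜ X : ZMod 2) = complementInversions X + (X.card * (r - X.card) : ℕ) := by
  have h := crossInversions_add_swap (disjoint_compl_right (a := X))
  rw [Finset.card_compl, Fintype.card_fin] at h
  rw [← h, Nat.cast_add, complementInversions, ← add_assoc, zmod_two_add_self, zero_add]

lemma isPartition_univ_pair {A B : Finset (Fin r)} :
    IsPartition Finset.univ [A, B] ↔ B = Aᶜ := by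
  constructor
  · rintro ⟨h1, h2⟩
    simp only [List.pairwise_cons, List.mem_singleton, forall_eq] at h1
    ext x
    have := h2 x
    simp only [Finset.mem_univ, true_iff, List.mem_cons, List.not_mem_nil, or_false,
      exists_eq_or_imp, exists_eq_left] at this
    have hd : x ∈ A → x ∉ B := fun h => Finset.disjoint_left.1 h1.1 h
    simp only [Finset.mem_compl]
    tauto
  · rintro rfl
    refine ⟨by simp [disjoint_compl_right], fun x => ?_⟩
    simp [Classical.em]

lemma sum_crossInversions {X T : Finset (Fin r)} {L : List (Finset (Fin r))}
    (h : IsPartition T L) : (L.map (crossInversions X)).sum = crossInversions X T := by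
  have key : ∀ (L : List (Finset (Fin r))), L.Pairwise Disjoint → ∀ T : Finset (Fin r),
      (∀ x, x ∈ T ↔ ∃ S ∈ L, x ∈ S) → (L.map (crossInversions X)).sum = crossInversions X T := by
    intro L hL
    induction L with
    | nil =>
      intro T hT
      have : T = ∅ := by ext x; simp [hT]
      simp [this, crossInversions]
    | cons S L ih =>
      intro T hT
      rw [List.pairwise_cons] at hL
      have hsub : S ⊆ T := fun x hx => (hT x).2 ⟨S, by simp, hx⟩
      have h2 := ih hL.2 (T \ S) fun x => by
        rw [Finset.mem_sdiff, hT]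
        simp only [List.mem_cons, exists_eq_or_imp]
        constructor
        · rintro ⟨h1 | h1, h2⟩
          · exact absurd h1 h2
          · exact h1
        · rintro ⟨S', h1, h2⟩
          exact ⟨Or.inr ⟨S', h1, h2⟩, fun h3 => Finset.disjoint_left.1 (hL.1 S' h1) h3 h2⟩
      rw [List.map_cons, List.sum_cons, h2]
      unfold crossInversions
      rw [← Finset.sum_add_distrib]
      refine Finset.sum_congr rfl fun x _ => ?_
      rw [add_comm]
      exact Finset.sum_sdiff hsub
  exact key L h.1 T h.2

/-- Removing the first block of a partition of the set of all colors. -/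
lemma inversions_tail {X : Finset (Fin r)} {L : List (Finset (Fin r))} (h : IsPartition Xᶜ L) :
    (inversions (subsetWord L) : ZMod 2) =
      inversions (subsetWord (X :: L)) + complementInversions X := by
  rw [inversions_subsetWord_cons, sum_crossInversions h, Nat.cast_add, complementInversions,
    add_assoc, zmod_two_add_self, add_zero]

end Complement

namespace DiskGraph.Weblike

variable {n r : ℕ} {G : DiskGraph n} {lam : Fin n → ℕ}

/-- The consistent labelings of a weblike subgraph. -/
structure IsLabeling (W : G.Weblike r lam) (S : ∀ i, Set.powersetCard (Fin r) (lam i))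
    (l : G.Edge → Finset (Fin r)) : Prop where
  card_eq : ∀ e, (l e).card = W.mult e
  white_disjoint : ∀ e e', e ≠ e' → G.white e = G.white e' → Disjoint (l e) (l e')
  black_disjoint : ∀ e e' b, e ≠ e' → G.black e = Sum.inl b → G.black e' = Sum.inl b →
    Disjoint (l e) (l e')
  boundary : ∀ e i, G.black e = Sum.inr i → l e = (S i : Finset (Fin r))

variable {W : G.Weblike r lam} {S : ∀ i, Set.powersetCard (Fin r) (lam i)}
  {l : G.Edge → Finset (Fin r)}

open Classical in
lemma labelingCount_eq (W : G.Weblike r lam) (S : ∀ i, Set.powersetCard (Fin r) (lam i)) :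
    W.labelingCount S = (Finset.univ.filter (W.IsLabeling S)).card := by
  unfold labelingCount
  congr 1
  ext l
  simp only [Finset.mem_filter, Finset.mem_univ, true_and]
  exact ⟨fun ⟨h1, h2, h3, h4⟩ => ⟨h1, h2, h3, h4⟩, fun ⟨h1, h2, h3, h4⟩ => ⟨h1, h2, h3, h4⟩⟩

/-- Disjoint sets of total size `r` cover all colors. -/
lemma exists_mem_of_sum_card {E : Type*} {s : Finset E} {l : E → Finset (Fin r)}
    (hd : (s : Set E).PairwiseDisjoint l) (hs : ∑ e ∈ s, (l e).card = r) (c : Fin r) :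
    ∃ e ∈ s, c ∈ l e := by
  classical
  have h : s.biUnion l = Finset.univ := by
    rw [← Finset.card_eq_iff_eq_univ, Finset.card_biUnion hd, hs, Fintype.card_fin]
  have hc : c ∈ s.biUnion l := h ▸ Finset.mem_univ c
  simpa using hc

lemma IsLabeling.exists_white (h : W.IsLabeling S l) (w : G.White) (c : Fin r) :
    ∃ e, G.white e = w ∧ c ∈ l e := by
  classical
  obtain ⟨e, he, hc⟩ := exists_mem_of_sum_card (s := Finset.univ.filter fun e => G.white e = w)
    (l := l) (fun e he e' he' hne => h.white_disjoint e e' hne (by simp_all)) (by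
      simp only [h.card_eq]; convert W.2.1 w; rfl) c
  exact ⟨e, by simpa using he, hc⟩

lemma IsLabeling.exists_black (h : W.IsLabeling S l) (b : G.Black) (c : Fin r) :
    ∃ e, G.black e = Sum.inl b ∧ c ∈ l e := by
  classical
  obtain ⟨e, he, hc⟩ := exists_mem_of_sum_card
    (s := Finset.univ.filter fun e => G.black e = Sum.inl b)
    (l := l) (fun e he e' he' hne => h.black_disjoint e e' b hne (by simp_all) (by simp_all)) (by
      simp only [h.card_eq]; convert W.2.2.1 b; rfl) c
  exact ⟨e, by simpa using he, hc⟩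

lemma IsLabeling.isColoring (h : W.IsLabeling S l) : IsColoring l := by
  intro c
  constructor
  · intro w
    obtain ⟨e, he, hc⟩ := h.exists_white w c
    refine ⟨e, ⟨by simpa using hc, he⟩, fun e' ⟨hc', he'⟩ => ?_⟩
    by_contra hne
    exact Finset.disjoint_left.1 (h.white_disjoint e' e hne (he'.trans he.symm))
      (by simpa using hc') hc
  · intro b
    obtain ⟨e, he, hc⟩ := h.exists_black b c
    refine ⟨e, ⟨by simpa using hc, he⟩, fun e' ⟨hc', he'⟩ => ?_⟩
    by_contra hne
    exact Finset.disjoint_left.1 (h.black_disjoint e' e b hne he' he) (by simpa using hc') hc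

lemma IsLabeling.hasBoundaryLabels (h : W.IsLabeling S l) :
    HasBoundaryLabels l fun i => (S i : Finset (Fin r)) := by
  classical
  intro i c
  constructor
  · intro hc
    have hpos : 0 < lam i := by
      have h2 : (S i : Finset (Fin r)).card = lam i := (S i).2
      rw [← h2]
      exact Finset.card_pos.2 ⟨c, hc⟩
    rw [← W.2.2.2 i] at hpos
    obtain ⟨e, he, -⟩ := Finset.exists_ne_zero_of_sum_ne_zero hpos.ne'
    have he' : G.black e = Sum.inr i := by simpa using he
    exact ⟨e, he', by rwa [h.boundary e i he']⟩
  · rintro ⟨e, he, hc⟩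
    change c ∈ (S i : Finset (Fin r))
    rwa [← h.boundary e i he]

lemma isLabeling_of_isColoring (hc : ∀ e, (l e).card = W.mult e) (h : IsColoring l)
    (hS : HasBoundaryLabels l fun i => (S i : Finset (Fin r))) : W.IsLabeling S l where
  card_eq := hc
  white_disjoint _ _ hne hw := Finset.disjoint_left.2 fun _ h1 h2 => hne (h.eq_of_white h1 h2 hw)
  black_disjoint _ _ _ hne h1 h2 := Finset.disjoint_left.2 fun _ h3 h4 =>
    hne (h.eq_of_black h3 h4 (h1.trans h2.symm))
  boundary _ _ he := (hS.eq he).symm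

namespace Directions

variable (D : W.Directions)

lemma out_injective : Function.Injective D.out := fun w w' h => by
  rw [← D.white_out w, ← D.white_out w', h]

lemma inc_injective : Function.Injective D.inc := fun b b' h => by
  have := (D.black_inc b).symm.trans ((congrArg G.black h).trans (D.black_inc b'))
  simpa using this

/-- The edges at a white vertex, starting with the outgoing one. -/
noncomputable def whiteStar (w : G.White) : List G.Edge :=
  D.out w :: cycleAfter G.rotWhite (D.out w)

/-- The edges at a black vertex, starting with the incoming one. -/
noncomputable def blackStar (b : G.Black) : List G.Edge :=
  D.inc b :: cycleAfter G.rotBlack (D.inc b)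

lemma nodup_whiteStar (w : G.White) : (D.whiteStar w).Nodup := (cons_cycleAfter_perm _ _).1

lemma nodup_blackStar (b : G.Black) : (D.blackStar b).Nodup := (cons_cycleAfter_perm _ _).1

lemma mem_whiteStar (w : G.White) (e : G.Edge) : e ∈ D.whiteStar w ↔ G.white e = w := by
  rw [whiteStar, (cons_cycleAfter_perm _ _).2, G.sameCycle_rotWhite, D.white_out, eq_comm]

lemma mem_blackStar (b : G.Black) (e : G.Edge) : e ∈ D.blackStar b ↔ G.black e = Sum.inl b := by
  rw [blackStar, (cons_cycleAfter_perm _ _).2, G.sameCycle_rotBlack, D.black_inc, eq_comm]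

lemma not_whiteToBlackAtWhite {w : G.White} {e : G.Edge}
    (he : e ∈ cycleAfter G.rotWhite (D.out w)) : ¬ D.WhiteToBlackAtWhite e := by
  rintro ⟨w', rfl⟩
  have h := (D.mem_whiteStar w _).1 (List.mem_cons_of_mem _ he)
  rw [D.white_out] at h
  subst h
  exact (List.nodup_cons.1 (D.nodup_whiteStar w')).1 he

lemma not_whiteToBlackAtBlack {b : G.Black} {e : G.Edge}
    (he : e ∈ cycleAfter G.rotBlack (D.inc b)) : ¬ D.WhiteToBlackAtBlack e := by
  rintro ⟨b', rfl⟩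
  have h := (D.mem_blackStar b _).1 (List.mem_cons_of_mem _ he)
  rw [D.black_inc] at h
  simp only [Sum.inl.injEq] at h
  subst h
  exact (List.nodup_cons.1 (D.nodup_blackStar b')).1 he

open Classical in
/-- The label of the half of an edge at its white end. -/
noncomputable def whiteLabel (l : G.Edge → Finset (Fin r)) (e : G.Edge) : Finset (Fin r) :=
  if D.WhiteToBlackAtWhite e then (l e)ᶜ else l e

open Classical in
/-- The label of the half of an edge at its black end. -/
noncomputable def blackLabel (l : G.Edge → Finset (Fin r)) (e : G.Edge) : Finset (Fin r) :=
  if D.WhiteToBlackAtBlack e then (l e)ᶜ else l e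

lemma map_whiteLabel (l : G.Edge → Finset (Fin r)) (w : G.White) :
    (cycleAfter G.rotWhite (D.out w)).map (D.whiteLabel l) =
      (cycleAfter G.rotWhite (D.out w)).map l :=
  List.map_congr_left fun _ he => if_neg (D.not_whiteToBlackAtWhite he)

lemma map_blackLabel (l : G.Edge → Finset (Fin r)) (b : G.Black) :
    (cycleAfter G.rotBlack (D.inc b)).map (D.blackLabel l) =
      (cycleAfter G.rotBlack (D.inc b)).map l :=
  List.map_congr_left fun _ he => if_neg (D.not_whiteToBlackAtBlack he)

lemma whiteLabel_out (l : G.Edge → Finset (Fin r)) (w : G.White) :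
    D.whiteLabel l (D.out w) = (l (D.out w))ᶜ := if_pos ⟨w, rfl⟩

lemma blackLabel_inc (l : G.Edge → Finset (Fin r)) (b : G.Black) :
    D.blackLabel l (D.inc b) = (l (D.inc b))ᶜ := if_pos ⟨b, rfl⟩

/-- A list that starts with `X` partitions all colors when its tail partitions the complement. -/
lemma isPartition_compl_iff {E : Type*} {a : E} {L : List E} {l : E → Finset (Fin r)}
    (hnd : (a :: L).Nodup) : IsPartition (l a)ᶜ (L.map l) ↔
      (∀ e ∈ a :: L, ∀ e' ∈ a :: L, e ≠ e' → Disjoint (l e) (l e')) ∧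
        ∀ c, ∃ e ∈ a :: L, c ∈ l e := by
  rw [List.nodup_cons] at hnd
  constructor
  · rintro ⟨h1, h2⟩
    rw [List.pairwise_map] at h1
    have hdis : ∀ e ∈ L, Disjoint (l a) (l e) := fun e he => Finset.disjoint_right.2 fun c hc =>
      Finset.mem_compl.1 ((h2 c).2 ⟨l e, List.mem_map_of_mem he, hc⟩)
    refine ⟨fun e he e' he' hne => ?_, fun c => ?_⟩
    · rw [List.mem_cons] at he he'
      rcases he with rfl | he <;> rcases he' with rfl | he'
      · exact absurd rfl hne
      · exact hdis _ he'
      · exact (hdis _ he).symm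
      · have : Std.Symm fun a b => Disjoint (l a) (l b) := ⟨fun _ _ h => h.symm⟩
        exact h1.forall he he' hne
    · by_cases hc : c ∈ l a
      · exact ⟨a, by simp, hc⟩
      · obtain ⟨T, hT, hc'⟩ := (h2 c).1 (Finset.mem_compl.2 hc)
        obtain ⟨e, he, rfl⟩ := List.mem_map.1 hT
        exact ⟨e, List.mem_cons_of_mem _ he, hc'⟩
  · rintro ⟨h1, h2⟩
    refine ⟨?_, fun c => ?_⟩
    · rw [List.pairwise_map]
      exact hnd.2.imp_of_mem fun {e e'} he he' hne =>
        h1 e (List.mem_cons_of_mem _ he) e' (List.mem_cons_of_mem _ he') hne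
    · rw [Finset.mem_compl]
      constructor
      · intro hc
        obtain ⟨e, he, hc'⟩ := h2 c
        rcases List.mem_cons.1 he with rfl | he
        · exact absurd hc' hc
        · exact ⟨l e, List.mem_map_of_mem he, hc'⟩
      · rintro ⟨T, hT, hc'⟩
        obtain ⟨e, he, rfl⟩ := List.mem_map.1 hT
        have hne : a ≠ e := fun h => hnd.1 (h ▸ he)
        exact Finset.disjoint_right.1 (h1 a (by simp) e (List.mem_cons_of_mem _ he) hne) hc'

/-- Since the sizes around an interior vertex add up to `r`, disjoint labels exhaust all colors.
Consistency thus becomes the condition under which the wedge and shuffle entries are nonzero. -/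
lemma isLabeling_iff : W.IsLabeling S l ↔ (∀ e, (l e).card = W.mult e) ∧
    (∀ w, IsPartition (l (D.out w))ᶜ ((cycleAfter G.rotWhite (D.out w)).map l)) ∧
    (∀ b, IsPartition (l (D.inc b))ᶜ ((cycleAfter G.rotBlack (D.inc b)).map l)) ∧
    ∀ e i, G.black e = Sum.inr i → l e = (S i : Finset (Fin r)) := by
  constructor
  · intro h
    refine ⟨h.card_eq, fun w => ?_, fun b => ?_, h.boundary⟩
    · rw [isPartition_compl_iff (D.nodup_whiteStar w)]
      refine ⟨fun e he e' he' hne => h.white_disjoint e e' hne ?_, fun c => ?_⟩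
      · rw [(D.mem_whiteStar w e).1 he, (D.mem_whiteStar w e').1 he']
      · obtain ⟨e, he, hc⟩ := h.exists_white w c
        exact ⟨e, (D.mem_whiteStar w e).2 he, hc⟩
    · rw [isPartition_compl_iff (D.nodup_blackStar b)]
      refine ⟨fun e he e' he' hne => h.black_disjoint e e' b hne ((D.mem_blackStar b e).1 he)
        ((D.mem_blackStar b e').1 he'), fun c => ?_⟩
      obtain ⟨e, he, hc⟩ := h.exists_black b c
      exact ⟨e, (D.mem_blackStar b e).2 he, hc⟩
  · rintro ⟨h1, h2, h3, h4⟩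
    refine ⟨h1, fun e e' hne hw => ?_, fun e e' b hne hb hb' => ?_, h4⟩
    · exact ((isPartition_compl_iff (D.nodup_whiteStar (G.white e))).1 (h2 _)).1 e
        ((D.mem_whiteStar _ e).2 rfl) e' ((D.mem_whiteStar _ e').2 hw.symm) hne
    · exact ((isPartition_compl_iff (D.nodup_blackStar b)).1 (h3 _)).1 e
        ((D.mem_blackStar _ e).2 hb) e' ((D.mem_blackStar _ e').2 hb') hne

end Directions

end DiskGraph.Weblike

/-! ### Consistent labelings and their signs -/

namespace DiskGraph.Weblike.Tagging

variable {n r : ℕ} {G : DiskGraph n} {lam : Fin n → ℕ} {W : G.Weblike r lam}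
  {S : ∀ i, Set.powersetCard (Fin r) (lam i)} {l : G.Edge → Finset (Fin r)}
  {U : Type*} [AddCommGroup U] [Module ℂ U] (E : Module.Basis (Fin r) ℂ U) (O : W.Tagging)

open Classical in
/-- The parity by which the entry of a tagged edge differs from the parity of the word formed by
its label and the complement. -/
noncomputable def tagParity (e : G.Edge) : ZMod 2 :=
  if O.WhiteToBlackAtWhite e ↔ O.WhiteToBlackAtBlack e then 0
  else if O.blackFirst e then 0 else (W.mult e * (r - W.mult e) : ℕ)

-- Reversing the two sides of a tag costs m(r - m). For a source tag the block sign of the shuffle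
-- costs the same, and the half carrying the label is at the other end, so pair and source tags lead
-- to the same `tagParity`.
open Classical in
lemma edgeEntry_label (hc : ∀ e, (l e).card = W.mult e) (e : G.Edge) :
    O.edgeEntry E e (O.blackLabel l e) (O.whiteLabel l e) = paritySign (O.tagParity e +
      if O.WhiteToBlackAtWhite e ↔ O.WhiteToBlackAtBlack e then 0
      else complementInversions (l e)) := by
  have hcc : (l e)ᶜ.card = r - W.mult e := by
    rw [Finset.card_compl, Fintype.card_fin, hc]
  unfold edgeEntry tagParity Directions.blackLabel Directions.whiteLabel
  by_cases h1 : O.WhiteToBlackAtWhite e <;> by_cases h2 : O.WhiteToBlackAtBlack e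
  · simp [h1, h2]
  · simp only [h1, h2, if_true, if_false, iff_false, not_true_eq_false]
    rcases O.blackFirst e
    · simp only [Bool.false_eq_true, if_false]
      rw [wedgeEntry_eq, if_pos (isPartition_univ_pair.2 (compl_compl _).symm),
        paritySign_inversions, inversions_pair, cast_crossInversions_compl_left, hc, add_comm]
    · simp only [if_true]
      rw [wedgeEntry_eq, if_pos (isPartition_univ_pair.2 rfl), paritySign_inversions,
        inversions_pair, zero_add, complementInversions]
  · simp only [h1, h2, if_true, if_false, false_iff, not_true_eq_false]
    rcases O.blackFirst e
    · simp only [Bool.false_eq_true, if_false]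
      rw [shuffleEntry_eq, if_pos (isPartition_univ_pair.2 rfl), Int.cast_mul,
        paritySign_inversions, inversions_pair]
      simp only [List.map_cons, List.map_nil, blockInversions, List.sum_cons, List.sum_nil,
        hcc, hc, add_zero, mul_zero, Int.cast_pow, Int.cast_neg, Int.cast_one]
      rw [← paritySign_natCast, ← paritySign_add, add_comm, complementInversions]
    · simp only [if_true]
      rw [shuffleEntry_eq, if_pos (isPartition_univ_pair.2 (compl_compl _).symm), Int.cast_mul,
        paritySign_inversions, inversions_pair, cast_crossInversions_compl_left]
      simp only [List.map_cons, List.map_nil, blockInversions, List.sum_cons, List.sum_nil,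
        hcc, hc, add_zero, mul_zero, Int.cast_pow, Int.cast_neg, Int.cast_one]
      rw [← paritySign_natCast, ← paritySign_add, mul_comm (r - W.mult e), add_assoc,
        zmod_two_add_self, zero_add, add_zero]
  · simp [h1, h2]

/-- The parity of the block permutations at the black vertices. -/
noncomputable def blockParity : ZMod 2 :=
  ∑ b, (blockInversions ((cycleAfter G.rotBlack (O.inc b)).map W.mult) : ZMod 2)

open Classical in
/-- The contribution of a consistent labeling to the value of a tagged web. -/
lemma term_eq (h : W.IsLabeling S l) :
    (∏ e, O.edgeEntry E e (O.blackLabel l e) (O.whiteLabel l e)) *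
      (∏ w, wedgeEntry E ((cycleAfter G.rotWhite (O.out w)).map (O.whiteLabel l))
        (O.whiteLabel l (O.out w))) *
      (∏ b, shuffleEntry (O.blackLabel l (O.inc b))
        ((cycleAfter G.rotBlack (O.inc b)).map (O.blackLabel l))) =
    paritySign (∑ e, O.tagParity e + O.blockParity +
      (∑ w, (inversions (subsetWord ((O.whiteStar w).map l)) : ZMod 2) +
        ∑ b, (inversions (subsetWord ((O.blackStar b).map l)) : ZMod 2))) := by
  obtain ⟨hc, hw, hb, -⟩ := O.isLabeling_iff.1 h
  have e1 : ∀ w, wedgeEntry E ((cycleAfter G.rotWhite (O.out w)).map (O.whiteLabel l))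
      (O.whiteLabel l (O.out w)) = paritySign
        (inversions (subsetWord ((O.whiteStar w).map l)) +
          complementInversions (l (O.out w))) := fun w => by
    rw [O.map_whiteLabel, O.whiteLabel_out, wedgeEntry_eq, if_pos (hw w), paritySign_inversions,
      inversions_tail (hw w)]
    rfl
  have e2 : ∀ b, shuffleEntry (O.blackLabel l (O.inc b))
      ((cycleAfter G.rotBlack (O.inc b)).map (O.blackLabel l)) = paritySign
        (inversions (subsetWord ((O.blackStar b).map l)) +
          complementInversions (l (O.inc b)) +
          (blockInversions ((cycleAfter G.rotBlack (O.inc b)).map W.mult) : ZMod 2)) := fun b => by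
    have hm : ((cycleAfter G.rotBlack (O.inc b)).map l).map Finset.card =
        (cycleAfter G.rotBlack (O.inc b)).map W.mult := by
      rw [List.map_map]
      exact List.map_congr_left fun e _ => hc e
    rw [O.map_blackLabel, O.blackLabel_inc, shuffleEntry_eq, if_pos (hb b), Int.cast_mul,
      paritySign_inversions, inversions_tail (hb b), hm]
    simp only [Int.cast_pow, Int.cast_neg, Int.cast_one]
    rw [← paritySign_natCast, ← paritySign_add]
    rfl
  simp only [e1, e2, O.edgeEntry_label E hc, ← paritySign_sum, ← paritySign_add,
    Finset.sum_add_distrib]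
  congr 1
  have e3 : ∑ w, complementInversions (l (O.out w)) =
      ∑ e, if O.WhiteToBlackAtWhite e then complementInversions (l e) else 0 := by
    rw [← Finset.sum_filter, ← Finset.sum_image (g := O.out) (f := fun e =>
      complementInversions (l e)) fun w _ w' _ h => O.out_injective h]
    congr 1
    ext e
    rw [Finset.mem_filter]
    simp [Directions.WhiteToBlackAtWhite]
  have e4 : ∑ b, complementInversions (l (O.inc b)) =
      ∑ e, if O.WhiteToBlackAtBlack e then complementInversions (l e) else 0 := by
    rw [← Finset.sum_filter, ← Finset.sum_image (g := O.inc) (f := fun e =>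
      complementInversions (l e)) fun w _ w' _ h => O.inc_injective h]
    congr 1
    ext e
    rw [Finset.mem_filter]
    simp [Directions.WhiteToBlackAtBlack]
  -- The star words start with the label itself, whereas the entries see its complement, which costs
  -- `complementInversions` once for each end where the edge is directed white to black. With equal
  -- halves these costs occur zero or two times; with unequal halves one such cost cancels that of
  -- the tag.
  have e5 : (∑ e, if O.WhiteToBlackAtWhite e ↔ O.WhiteToBlackAtBlack e then 0
      else complementInversions (l e)) + ∑ w, complementInversions (l (O.out w)) +
      ∑ b, complementInversions (l (O.inc b)) = 0 := by
    rw [e3, e4, ← Finset.sum_add_distrib, ← Finset.sum_add_distrib]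
    refine Finset.sum_eq_zero fun e _ => ?_
    by_cases h1 : O.WhiteToBlackAtWhite e <;> by_cases h2 : O.WhiteToBlackAtBlack e <;>
      simp [h1, h2, zmod_two_add_self]
  unfold blockParity
  linear_combination e5

-- A nonzero edge entry forces the two half-edge labels to be equal, or complementary at a tag, and
-- so to come from one edge label. Nonzero vertex entries then say that the edge labels are
-- consistent.
open Classical in
lemma value_eq_sum (S : ∀ i, Set.powersetCard (Fin r) (lam i)) :
    O.value E S = ∑ l with W.IsLabeling S l,
      paritySign (∑ e, O.tagParity e + O.blockParity +
      (∑ w, (inversions (subsetWord ((O.whiteStar w).map l)) : ZMod 2) +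
        ∑ b, (inversions (subsetWord ((O.blackStar b).map l)) : ZMod 2))) := by
  have hcard : ∀ (p : Prop) [Decidable p] (X : Finset (Fin r)) (m : ℕ), X.card = m →
      (if p then Xᶜ else X).card = if p then r - m else m := by
    rintro p _ X m rfl
    split_ifs
    · rw [Finset.card_compl, Fintype.card_fin]
    · rfl
  symm
  unfold value
  refine Finset.sum_of_injOn (fun l => (O.blackLabel l, O.whiteLabel l)) ?_ ?_ ?_ ?_
  · rintro l - l' - h
    have h2 := congrArg Prod.snd h
    funext e
    have h3 := congrFun h2 e
    simp only [Directions.whiteLabel] at h3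
    split_ifs at h3
    · exact compl_injective h3
    · exact h3
  · intro l hl
    rw [Finset.coe_filter, Set.mem_ofPred_eq] at hl ⊢
    obtain ⟨-, hl⟩ := hl
    refine ⟨Finset.mem_univ _, fun e => hcard _ _ _ (hl.card_eq e),
      fun e => hcard _ _ _ (hl.card_eq e), fun e i he => ?_⟩
    rw [← hl.boundary e i he]
    refine if_neg ?_
    rintro ⟨b, rfl⟩
    rw [O.black_inc] at he
    exact absurd he (by simp)
  · rintro ⟨B, A⟩ hT hnot
    rw [Finset.mem_filter] at hT
    obtain ⟨-, hB, hA, hS⟩ := hT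
    by_contra hne
    rw [mul_assoc] at hne
    obtain ⟨hne1, hne2⟩ := mul_ne_zero_iff.1 hne
    obtain ⟨hne2, hne3⟩ := mul_ne_zero_iff.1 hne2
    rw [Finset.prod_ne_zero_iff] at hne1 hne2 hne3
    apply hnot
    -- The edge label is recovered from the white half alone; the edge entry then determines the
    -- black half.
    let l : G.Edge → Finset (Fin r) := fun e => if O.WhiteToBlackAtWhite e then (A e)ᶜ else A e
    have hAl : O.whiteLabel l = A := by
      funext e
      simp only [Directions.whiteLabel, l]
      split_ifs
      · exact compl_compl _
      · rfl
    have hBl : O.blackLabel l = B := by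
      funext e
      have h := hne1 e (Finset.mem_univ e)
      simp only [Directions.blackLabel, l]
      unfold edgeEntry at h
      by_cases h1 : O.WhiteToBlackAtWhite e <;> by_cases h2 : O.WhiteToBlackAtBlack e
      · simp only [h1, h2, if_true, ne_eq, ite_eq_right_iff, one_ne_zero, imp_false,
          not_not] at h ⊢
        rw [compl_compl, h]
      · simp only [h1, h2, iff_false, not_true_eq_false, if_true, if_false] at h ⊢
        rw [wedgeEntry_eq] at h
        rcases hbf : O.blackFirst e
        · simp only [hbf, Bool.false_eq_true, if_false] at h
          exact (isPartition_univ_pair.1 (by_contra fun hh => h (if_neg hh))).symm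
        · simp only [hbf, if_true] at h
          rw [isPartition_univ_pair.1 (by_contra fun hh => h (if_neg hh)), compl_compl]
      · simp only [h1, h2, false_iff, not_true_eq_false, if_true, if_false] at h ⊢
        rw [shuffleEntry_eq] at h
        rcases hbf : O.blackFirst e
        · simp only [hbf, Bool.false_eq_true, if_false] at h
          exact (isPartition_univ_pair.1 (by_contra fun hh => h (if_neg hh))).symm
        · simp only [hbf, if_true] at h
          rw [isPartition_univ_pair.1 (by_contra fun hh => h (if_neg hh)), compl_compl]
      · simp only [h1, h2, if_true, ne_eq, ite_eq_right_iff, one_ne_zero, imp_false,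
          not_not, if_false] at h ⊢
        exact h.symm
    refine ⟨l, ?_, Prod.ext hBl hAl⟩
    rw [Finset.coe_filter, Set.mem_ofPred_eq, O.isLabeling_iff]
    refine ⟨Finset.mem_univ _, fun e => ?_, fun w => ?_, fun b => ?_, fun e i he => ?_⟩
    · have h := hA e
      have hlt : W.mult e ≤ r := Nat.lt_succ_iff.1 (W.1 e).2
      simp only [whiteHalfMult] at h
      simp only [l]
      split_ifs at h ⊢
      · rw [Finset.card_compl, Fintype.card_fin, h]; omega
      · exact h
    · have h := hne2 w (Finset.mem_univ w)
      simp only [← hAl] at h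
      rw [O.map_whiteLabel, O.whiteLabel_out, wedgeEntry_eq] at h
      exact by_contra fun hh => h (if_neg hh)
    · have h := hne3 b (Finset.mem_univ b)
      simp only [← hBl] at h
      rw [O.map_blackLabel, O.blackLabel_inc, shuffleEntry_eq] at h
      exact by_contra fun hh => h (if_neg hh)
    · rw [← hS e i he, ← hBl]
      symm
      refine if_neg ?_
      rintro ⟨b, rfl⟩
      rw [O.black_inc] at he
      exact absurd he (by simp)
  · intro l hl
    rw [Finset.mem_filter] at hl
    exact (O.term_eq E hl.2).symm

lemma functional_basisTensor (S : ∀ i, Set.powersetCard (Fin r) (lam i)) :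
    O.functional E (basisTensor E S) = O.value E S := by
  have h : basisTensor E S = Basis.piTensorProduct (fun i => E.exteriorPower (lam i)) S := by
    rw [Basis.piTensorProduct_apply]; rfl
  rw [h, functional, Module.Basis.constr_basis]

/-- Every tagging has a sign. -/
theorem exists_isSign {k : ℕ} (hk : Fintype.card G.White = Fintype.card G.Black + k) :
    ∃ ε, O.IsSign E ε := by
  classical
  obtain ⟨C, hC⟩ := exists_total_sign (r := r) hk O.whiteStar O.blackStar O.nodup_whiteStar
    O.nodup_blackStar O.mem_whiteStar O.mem_blackStar
  -- Consistent labelings of `W` all have the cardinalities prescribed by its multiplicities, so the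
  -- total sign contributes the same constant for every one of them.
  let x : ZMod 2 := ∑ e, O.tagParity e + O.blockParity + C fun e => (W.mult e : ZMod 2)
  refine ⟨if x = 0 then 1 else -1, fun S => ?_⟩
  have hx : ((((if x = 0 then 1 else -1 : ℤˣ) : ℤ)) : ℂ) = paritySign x := by
    unfold paritySign; split_ifs <;> simp
  have hterm : ∀ l, W.IsLabeling S l → ∑ e, O.tagParity e + O.blockParity +
      (∑ w, (inversions (subsetWord ((O.whiteStar w).map l)) : ZMod 2) +
        ∑ b, (inversions (subsetWord ((O.blackStar b).map l)) : ZMod 2)) =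
      (inversions (subsetWord (List.ofFn fun i => (S i : Finset (Fin r)))) : ZMod 2) + x := by
    intro l hl
    have h := hC l _ hl.isColoring hl.hasBoundaryLabels
    have hm : (fun e => ((l e).card : ZMod 2)) = fun e => (W.mult e : ZMod 2) :=
      funext fun e => by rw [hl.card_eq]
    rw [hm] at h
    have h2 := zmod_two_add_self
      (inversions (subsetWord (List.ofFn fun i => (S i : Finset (Fin r)))) : ZMod 2)
    simp only [x]
    linear_combination h - h2
  rw [functional_basisTensor, value_eq_sum, Finset.sum_congr rfl fun l hl => by
    rw [hterm l (Finset.mem_filter.1 hl).2], Finset.sum_const, labelingCount_eq, nsmul_eq_mul]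
  push_cast
  rw [hx, paritySign_add, ← paritySign_inversions]
  ring

theorem isSign_sign {k : ℕ} (hk : Fintype.card G.White = Fintype.card G.Black + k) :
    O.IsSign E (O.sign E) :=
  Classical.epsilon_spec (O.exists_isSign E hk)

end DiskGraph.Weblike.Tagging

/-! ### Existence of taggings -/

namespace DiskGraph.Weblike

variable {n r : ℕ} {G : DiskGraph n} {lam : Fin n → ℕ} (W : G.Weblike r lam)

lemma nonempty_directions (hr : 1 ≤ r) : Nonempty W.Directions := by
  classical
  have h1 : ∀ w, ∃ e, G.white e = w ∧ 0 < W.mult e := fun w => by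
    have h : ∑ e with G.white e = w, (W.1 e : ℕ) ≠ 0 := by
      convert (show r ≠ 0 by omega)
      convert W.2.1 w
    obtain ⟨e, he, hm⟩ := Finset.exists_ne_zero_of_sum_ne_zero h
    exact ⟨e, by simpa using he, Nat.pos_of_ne_zero hm⟩
  have h2 : ∀ b, ∃ e, G.black e = Sum.inl b ∧ 0 < W.mult e := fun b => by
    have h : ∑ e with G.black e = Sum.inl b, (W.1 e : ℕ) ≠ 0 := by
      convert (show r ≠ 0 by omega)
      convert W.2.2.1 b
    obtain ⟨e, he, hm⟩ := Finset.exists_ne_zero_of_sum_ne_zero h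
    exact ⟨e, by simpa using he, Nat.pos_of_ne_zero hm⟩
  choose out ho1 ho2 using h1
  choose inc hi1 hi2 using h2
  exact ⟨⟨out, ho1, ho2, inc, hi1, hi2⟩⟩

variable {W}

open Classical in
/-- The white vertices whose outgoing edge is the incoming edge of a black vertex. -/
noncomputable def Directions.alignedVertices (D : W.Directions) : Finset G.White :=
  Finset.univ.filter fun w => D.WhiteToBlackAtBlack (D.out w)

/-- A cycle through `w` leaves it along an edge aligned with its black end and enters it along an
edge that is incoming at no black vertex. Choosing the latter as the outgoing edge of `w` removes
`w` from the aligned vertices and affects no other vertex. -/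
lemma Directions.exists_smaller_of_cycle (D : W.Directions) {w : G.White}
    (h : Relation.TransGen D.Flow (Sum.inl w) (Sum.inl w)) :
    ∃ D' : W.Directions, D'.alignedVertices.card < D.alignedVertices.card := by
  classical
  obtain ⟨x, hx, -⟩ := Relation.TransGen.head'_iff.1 h
  obtain ⟨y, -, hy⟩ := Relation.TransGen.tail'_iff.1 h
  have hx' : D.WhiteToBlackAtBlack (D.out w) := by
    generalize hv : (Sum.inl w : G.White ⊕ G.Black) = v at hx
    cases hx with
    | whiteToBlack e b hb hm h1 h2 =>
      obtain ⟨w', rfl⟩ := h1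
      rw [D.white_out] at hv
      simp only [Sum.inl.injEq] at hv
      rwa [hv]
    | blackToWhite e b hb hm h1 h2 => exact absurd hv (by simp)
  have hy' : ∃ e, G.white e = w ∧ 0 < W.mult e ∧ ¬ D.WhiteToBlackAtBlack e := by
    generalize hv : (Sum.inl w : G.White ⊕ G.Black) = v at hy
    cases hy with
    | whiteToBlack e b hb hm h1 h2 => exact absurd hv (by simp)
    | blackToWhite e b hb hm h1 h2 =>
      simp only [Sum.inl.injEq] at hv
      exact ⟨e, hv.symm, hm, h2⟩
  obtain ⟨e, he, hm, hb⟩ := hy'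
  refine ⟨{ D with
    out := Function.update D.out w e
    white_out := fun w' => ?_
    mult_out_pos := fun w' => ?_ }, ?_⟩
  · rcases eq_or_ne w' w with rfl | hne
    · rwa [Function.update_self]
    · rw [Function.update_of_ne hne, D.white_out]
  · rcases eq_or_ne w' w with rfl | hne
    · rwa [Function.update_self]
    · rw [Function.update_of_ne hne]; exact D.mult_out_pos w'
  · apply Finset.card_lt_card
    rw [Finset.ssubset_iff_of_subset]
    · refine ⟨w, by simpa [alignedVertices] using hx', ?_⟩
      simp only [alignedVertices, Finset.mem_filter, Function.update_self]
      exact fun hh => hb hh.2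
    · intro w' hw'
      simp only [alignedVertices, Finset.mem_filter, Finset.mem_univ, true_and] at hw' ⊢
      rcases eq_or_ne w' w with rfl | hne
      · exact hx'
      · rwa [Function.update_of_ne hne] at hw'

/-- Every weblike subgraph has a tagging. -/
theorem nonempty_tagging (W : G.Weblike r lam) (hr : 1 ≤ r) : Nonempty W.Tagging := by
  have := W.nonempty_directions hr
  -- Minimizing the number of aligned vertices excludes cycles through white vertices. An oriented
  -- cycle through a black vertex passes through a white one, since the flow leaving a black vertex
  -- ends at a white vertex.
  let D := Function.argmin fun D : W.Directions => D.alignedVertices.card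
  have hcyc : ∀ w, ¬ Relation.TransGen D.Flow (Sum.inl w) (Sum.inl w) := fun w h => by
    obtain ⟨D', hD'⟩ := D.exists_smaller_of_cycle h
    exact (Function.argmin_le (fun D : W.Directions => D.alignedVertices.card) D').not_gt hD'
  refine ⟨{ D with
    acyclic := ?_
    blackFirst := fun _ => true }⟩
  rintro (w | b) h
  · exact hcyc w h
  · obtain ⟨x, hx, hxb⟩ := Relation.TransGen.head'_iff.1 h
    rcases x with w | b'
    · exact hcyc w (Relation.TransGen.tail' hxb hx)
    · exact absurd hx (by rintro ⟨⟩)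

end DiskGraph.Weblike

/-! ### Webs in terms of boundary measurements -/

namespace DiskNetwork

open DiskGraph DiskGraph.Weblike

variable {n r : ℕ} {lam : Fin n → ℕ}

open Classical in
/-- The boundary vertices whose label contains a given color. -/
noncomputable def colorBoundary (S : ∀ i, Set.powersetCard (Fin r) (lam i)) (c : Fin r) :
    Finset (Fin n) :=
  Finset.univ.filter fun i => c ∈ (S i : Finset (Fin r))

lemma hasBoundary_colorClass_iff {G : DiskGraph n} {l : G.Edge → Finset (Fin r)}
    {S : ∀ i, Set.powersetCard (Fin r) (lam i)} :
    (∀ c, G.HasBoundary (colorClass l c) (colorBoundary S c)) ↔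
      HasBoundaryLabels l fun i => (S i : Finset (Fin r)) := by
  unfold HasBoundary HasBoundaryLabels colorBoundary
  simp only [Finset.mem_filter, Finset.mem_univ, true_and, mem_colorClass]
  constructor
  · intro h i c
    rw [h c i]
    exact exists_congr fun e => and_comm
  · intro h c i
    rw [h i c]
    exact exists_congr fun e => and_comm

open Classical in
lemma sum_card_of_isColoring {G : DiskGraph n} {l : G.Edge → Finset (Fin r)} (hl : IsColoring l)
    {s : Finset G.Edge} (T : Finset (Fin r)) (hT : ∀ c, c ∈ T ↔ ∃ e ∈ s, c ∈ l e)
    (hs : ∀ e ∈ s, ∀ e' ∈ s, G.black e = G.black e' ∨ G.white e = G.white e') :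
    ∑ e ∈ s, (l e).card = T.card := by
  rw [← Finset.card_biUnion]
  · congr 1
    ext c
    simp [hT]
  · intro e he e' he' hne
    rw [Function.onFun, Finset.disjoint_left]
    intro c h1 h2
    rcases hs e he e' he' with h | h
    · exact hne (hl.eq_of_black h1 h2 h)
    · exact hne (hl.eq_of_white h1 h2 h)

open Classical in
/-- A coloring is a consistent labeling of the weblike subgraph formed by its edges. -/
lemma exists_weblike {G : DiskGraph n} {l : G.Edge → Finset (Fin r)}
    {S : ∀ i, Set.powersetCard (Fin r) (lam i)} (hl : IsColoring l)
    (hS : HasBoundaryLabels l fun i => (S i : Finset (Fin r))) :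
    ∃ W : G.Weblike r lam, W.IsLabeling S l := by
  refine ⟨⟨fun e => ⟨(l e).card, Nat.lt_succ_iff.2 ((Finset.card_le_univ _).trans_eq
    (Fintype.card_fin r))⟩, fun w => ?_, fun b => ?_, fun i => ?_⟩,
    isLabeling_of_isColoring (fun e => rfl) hl hS⟩
  · have h := sum_card_of_isColoring hl (s := Finset.univ.filter fun e => G.white e = w) Finset.univ
      (fun c => by
        obtain ⟨e, ⟨he, hw⟩, -⟩ := (hl c).1 w
        exact iff_of_true (Finset.mem_univ _) ⟨e, by simpa using hw, by simpa using he⟩)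
      (fun e he e' he' => by simp_all)
    rw [Finset.card_univ, Fintype.card_fin] at h
    convert h
  · have h := sum_card_of_isColoring hl (s := Finset.univ.filter fun e => G.black e = Sum.inl b)
      Finset.univ
      (fun c => by
        obtain ⟨e, ⟨he, hw⟩, -⟩ := (hl c).2 b
        exact iff_of_true (Finset.mem_univ _) ⟨e, by simpa using hw, by simpa using he⟩)
      (fun e he e' he' => by simp_all)
    rw [Finset.card_univ, Fintype.card_fin] at h
    convert h
  · have h := sum_card_of_isColoring hl (s := Finset.univ.filter fun e => G.black e = Sum.inr i)
      (S i : Finset (Fin r)) (fun c => by rw [hS i c]; simp) (fun e he e' he' => by simp_all)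
    rw [show (S i : Finset (Fin r)).card = lam i from (S i).2] at h
    convert h

variable (N : DiskNetwork n)

-- The cardinalities of the labels determine the web, so each coloring with boundary `S` is counted
-- for exactly one `W`.
open Classical in
lemma sum_webWeight_mul_labelingCount (S : ∀ i, Set.powersetCard (Fin r) (lam i)) :
    ∑ W : N.Weblike r lam, N.webWeight W * W.labelingCount S =
      ∑ l : N.Edge → Finset (Fin r) with IsColoring l ∧
        HasBoundaryLabels l (fun i => (S i : Finset (Fin r))), ∏ e, N.weight e ^ (l e).card := by
  have h1 : ∀ W : N.Weblike r lam, N.webWeight W * W.labelingCount S =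
      ∑ l : N.Edge → Finset (Fin r), if W.IsLabeling S l then ∏ e, N.weight e ^ (l e).card
        else 0 := by
    intro W
    rw [← Finset.sum_filter, labelingCount_eq, mul_comm, ← nsmul_eq_mul, ← Finset.sum_const]
    refine Finset.sum_congr rfl fun l hl => ?_
    have hl := (Finset.mem_filter.1 hl).2
    simp only [hl.card_eq, webWeight]
  have h2 : ∀ l : N.Edge → Finset (Fin r),
      (∑ W : N.Weblike r lam, if W.IsLabeling S l then ∏ e, N.weight e ^ (l e).card else 0) =
      if IsColoring l ∧ HasBoundaryLabels l (fun i => (S i : Finset (Fin r)))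
        then ∏ e, N.weight e ^ (l e).card else 0 := by
    intro l
    split_ifs with h
    · obtain ⟨W, hW⟩ := exists_weblike h.1 h.2
      rw [Finset.sum_eq_single W]
      · rw [if_pos hW]
      · intro W' _ hne
        refine if_neg fun hW' => hne (Subtype.ext (funext fun e => Fin.ext ?_))
        exact (hW'.card_eq e).symm.trans (hW.card_eq e)
      · exact fun hn => absurd (Finset.mem_univ _) hn
    · exact Finset.sum_eq_zero fun W _ => if_neg fun hW =>
        h ⟨hW.isColoring, hW.hasBoundaryLabels⟩
  simp only [h1]
  rw [Finset.sum_comm]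
  simp only [h2]
  rw [← Finset.sum_filter]

open Classical in
/-- Overlaying dimer configurations, one of each color. -/
theorem sum_colorings_eq_prod (S : ∀ i, Set.powersetCard (Fin r) (lam i)) :
    ∑ l : N.Edge → Finset (Fin r) with IsColoring l ∧
      HasBoundaryLabels l (fun i => (S i : Finset (Fin r))), ∏ e, N.weight e ^ (l e).card =
      ∏ c, N.boundaryMeasurement (colorBoundary S c) := by
  simp only [boundaryMeasurement]
  rw [Finset.prod_univ_sum]
  -- A labeling of edges by sets of colors is the same datum as a set of edges for each color. The
  -- weight of an edge occurs once for every color in its label.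
  refine Finset.sum_bij (fun l _ => colorClass l) (fun l hl => ?_) (fun l _ l' _ h => ?_)
    (fun p hp => ?_) (fun l _ => ?_)
  · obtain ⟨-, h3, h4⟩ := Finset.mem_filter.1 hl
    rw [Fintype.mem_piFinset]
    exact fun c => Finset.mem_filter.2 ⟨Finset.mem_univ _, h3 c, hasBoundary_colorClass_iff.2 h4 c⟩
  · funext e
    ext c
    rw [← mem_colorClass, ← mem_colorClass, h]
  · rw [Fintype.mem_piFinset] at hp
    have hp' := fun c => (Finset.mem_filter.1 (hp c)).2
    have hcol : colorClass (fun e => Finset.univ.filter fun c => e ∈ p c) = p := by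
      funext c
      ext e
      simp
    refine ⟨fun e => Finset.univ.filter fun c => e ∈ p c, Finset.mem_filter.2
      ⟨Finset.mem_univ _, ?_, ?_⟩, hcol⟩
    · intro c
      rw [hcol]
      exact (hp' c).1
    · rw [← hasBoundary_colorClass_iff, hcol]
      exact fun c => (hp' c).2
  · simp only [colorClass, Finset.prod_filter]
    rw [Finset.prod_comm]
    refine Finset.prod_congr rfl fun e _ => ?_
    rw [← Finset.prod_filter, Finset.prod_const]
    congr
    ext c
    simp

variable {U : Type*} [AddCommGroup U] [Module ℂ U] (E : Module.Basis (Fin r) ℂ U)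

/-- The value of the `r`-fold boundary measurement at a basis tensor. -/
theorem web_basisTensor {k : ℕ} (hN : N.HasExcedance k) (O : ∀ W : N.Weblike r lam, W.Tagging)
    (S : ∀ i, Set.powersetCard (Fin r) (lam i)) :
    N.web E lam O (basisTensor E S) =
      ((subsetSign (List.ofFn fun i => (S i : Finset (Fin r))) : ℤ) : ℂ) *
        ∏ c, N.boundaryMeasurement (colorBoundary S c) := by
  rw [← sum_colorings_eq_prod, ← sum_webWeight_mul_labelingCount, web,
    LinearMap.sum_apply, Finset.mul_sum]
  refine Finset.sum_congr rfl fun W _ => ?_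
  have h := (O W).isSign_sign E hN S
  rw [LinearMap.smul_apply, Tagging.invariant, LinearMap.smul_apply, h, smul_eq_mul, smul_eq_mul]
  push_cast
  -- The sign occurs once in `invariant` and once in the value of the functional, so its square
  -- disappears and with it the tagging.
  have h2 : ((((O W).sign E : ℤˣ) : ℤ) : ℂ) * ((((O W).sign E : ℤˣ) : ℤ) : ℂ) = 1 := by
    rw [← Int.cast_mul, Int.units_coe_mul_self, Int.cast_one]
  linear_combination (N.webWeight W * ((subsetSign (List.ofFn fun i => (S i : Finset (Fin r))) : ℤ)
    : ℂ) * W.labelingCount S) * h2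

/-- A dimer configuration uses exactly `k` boundary edges, at distinct boundary vertices. The sets
`colorBoundary S c` may have other sizes, on which the cone point carries no coordinate. -/
lemma boundaryMeasurement_eq_zero {k : ℕ} (hN : N.HasExcedance k) {I : Finset (Fin n)}
    (hI : I.card ≠ k) : N.boundaryMeasurement I = 0 := by
  classical
  unfold boundaryMeasurement
  rw [Finset.filter_false_of_mem, Finset.sum_empty]
  rintro π - ⟨h1, h2⟩
  apply hI
  rw [← h1.card_boundary hN]
  symm
  have hi : ∀ e ∈ π.filter fun e => ∃ i, N.black e = Sum.inr i, ∃ i, N.black e = Sum.inr i :=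
    fun e he => (Finset.mem_filter.1 he).2
  refine Finset.card_bij (fun e he => (hi e he).choose) (fun e he => ?_)
    (fun e he e' he' h => ?_) (fun i hmem => ?_)
  · exact (h2 _).2 ⟨e, (Finset.mem_filter.1 he).1, (hi e he).choose_spec⟩
  · refine N.boundary_unique e e' _ (hi e he).choose_spec ?_
    rw [h]
    exact (hi e' he').choose_spec
  · obtain ⟨e, he, hb⟩ := (h2 i).1 hmem
    have hm : e ∈ π.filter fun e => ∃ i, N.black e = Sum.inr i :=
      Finset.mem_filter.2 ⟨he, i, hb⟩
    refine ⟨e, hm, ?_⟩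
    have h3 := (hi e hm).choose_spec
    exact (Sum.inr_injective (hb.symm.trans h3)).symm

lemma boundaryMeasurement_eq_of_conePoint_eq {k : ℕ} {N N' : DiskNetwork n}
    (hN : N.HasExcedance k) (hN' : N'.HasExcedance k) (hX : N.conePoint k = N'.conePoint k)
    (I : Finset (Fin n)) : N.boundaryMeasurement I = N'.boundaryMeasurement I := by
  by_cases hI : I.card = k
  · exact congrFun hX ⟨I, hI⟩
  · rw [boundaryMeasurement_eq_zero N hN hI, boundaryMeasurement_eq_zero N' hN' hI]

lemma functional_ext {f g : FundamentalTensor U lam →ₗ[ℂ] ℂ}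
    (h : ∀ S, f (basisTensor E S) = g (basisTensor E S)) : f = g := by
  refine (Basis.piTensorProduct fun i => E.exteriorPower (lam i)).ext fun S => ?_
  rw [Basis.piTensorProduct_apply]
  exact h S

theorem web_eq_of_conePoint_eq {k : ℕ} {N N' : DiskNetwork n}
    (hN : N.HasExcedance k) (hN' : N'.HasExcedance k) (hX : N.conePoint k = N'.conePoint k)
    (O : ∀ W : N.Weblike r lam, W.Tagging) (O' : ∀ W : N'.Weblike r lam, W.Tagging) :
    N.web E lam O = N'.web E lam O' := by
  refine functional_ext E fun S => ?_
  rw [web_basisTensor N E hN, web_basisTensor N' E hN']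
  simp only [boundaryMeasurement_eq_of_conePoint_eq hN hN' hX]

end DiskNetwork

/-! ### Invariant functionals from exterior products -/

section StackedSpace

open ExteriorAlgebra

variable {r m : ℕ} {U : Type*} [AddCommGroup U] [Module ℂ U] (E : Module.Basis (Fin r) ℂ U)

/-- The diagonal action of an endomorphism on `ℂ^m ⊗ U`. -/
def stackMap (m : ℕ) (g : U →ₗ[ℂ] U) : (Fin m → U) →ₗ[ℂ] (Fin m → U) :=
  LinearMap.pi fun a => g ∘ₗ LinearMap.proj a

/-- The map `u ↦ v ⊗ u` from `U` to `ℂ^m ⊗ U`. -/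
def stackVector (U : Type*) [AddCommGroup U] [Module ℂ U] (v : Fin m → ℂ) :
    U →ₗ[ℂ] (Fin m → U) :=
  LinearMap.pi fun a => v a • LinearMap.id

lemma stackMap_comp_stackVector (g : U →ₗ[ℂ] U) (v : Fin m → ℂ) :
    stackMap m g ∘ₗ stackVector U v = stackVector U v ∘ₗ g := by
  ext u a
  simp [stackMap, stackVector]

/-- The basis of `ℂ^m ⊗ U`, ordered lexicographically. -/
noncomputable def stackBasis (m : ℕ) : Module.Basis (Fin (m * r)) ℂ (Fin m → U) :=
  (Pi.basis fun _ : Fin m => E).reindex ((Equiv.sigmaEquivProd _ _).trans finProdFinEquiv)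

lemma stackBasis_apply (a : Fin m) (c : Fin r) :
    stackBasis E m (finProdFinEquiv (a, c)) = Pi.single a (E c) := by
  rw [stackBasis, Module.Basis.reindex_apply]
  simp

/-- The top form on `ℂ^m ⊗ U`, as a functional on the exterior algebra. -/
noncomputable def topForm (m : ℕ) : ExteriorAlgebra ℂ (Fin m → U) →ₗ[ℂ] ℂ :=
  liftAlternating (Pi.single (m * r) (stackBasis E m).det)

lemma topForm_ιMulti (v : Fin (m * r) → Fin m → U) :
    topForm E m (ιMulti ℂ (m * r) v) = (stackBasis E m).det v := by
  rw [topForm, liftAlternating_apply_ιMulti, Pi.single_eq_same]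

/-- The diagonal action on `m` copies of `U` has determinant (det g)^m, and in degrees other than `m
* r` the form is zero. -/
lemma topForm_map (g : U →ₗ[ℂ] U) (hg : LinearMap.det g = 1)
    (x : ExteriorAlgebra ℂ (Fin m → U)) :
    topForm E m (ExteriorAlgebra.map (stackMap m g) x) = topForm E m x := by
  have : Module.Finite ℂ U := Module.Finite.of_basis E
  have hdet : LinearMap.det (stackMap m g) = 1 := by
    rw [stackMap, LinearMap.det_pi]
    simp [hg]
  suffices h : topForm E m ∘ₗ (ExteriorAlgebra.map (stackMap m g)).toLinearMap = topForm E m from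
    LinearMap.congr_fun h x
  refine ExteriorAlgebra.lhom_ext fun i => ?_
  ext v
  simp only [LinearMap.compAlternatingMap_apply, LinearMap.comp_apply, AlgHom.toLinearMap_apply,
    ExteriorAlgebra.map_apply_ιMulti]
  rcases eq_or_ne i (m * r) with rfl | hi
  · rw [topForm_ιMulti, topForm_ιMulti, Module.Basis.det_comp, hdet, one_mul]
  · rw [topForm, liftAlternating_apply_ιMulti, liftAlternating_apply_ιMulti,
      Pi.single_eq_of_ne hi]
    rfl

/-- The top exterior power is one-dimensional: every alternating map in `r` vectors is `E.det` times
its value on the basis. -/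
lemma map_ιMulti_basis (g : U →ₗ[ℂ] U) :
    ExteriorAlgebra.map g (ιMulti ℂ r E) = LinearMap.det g • ιMulti ℂ r E := by
  have h : ιMulti ℂ r (M := U) =
      (LinearMap.toSpanSingleton ℂ _ (ιMulti ℂ r E)).compAlternatingMap E.det := by
    refine Module.Basis.ext_alternating E fun v hv => ?_
    let σ : Equiv.Perm (Fin r) := Equiv.ofBijective v (Finite.injective_iff_bijective.1 hv)
    have h1 : ιMulti ℂ r (E ∘ σ) =
        (LinearMap.toSpanSingleton ℂ _ (ιMulti ℂ r E)).compAlternatingMap E.det (E ∘ σ) := by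
      rw [AlternatingMap.map_perm, AlternatingMap.map_perm, LinearMap.compAlternatingMap_apply,
        Module.Basis.det_self, LinearMap.toSpanSingleton_apply, one_smul]
    exact h1
  rw [ExteriorAlgebra.map_apply_ιMulti, h, LinearMap.compAlternatingMap_apply,
    LinearMap.toSpanSingleton_apply, Module.Basis.det_comp, Module.Basis.det_self, mul_one, ← h]

lemma basis_exteriorAlgebra_univ : E.ExteriorAlgebra Finset.univ = ιMulti ℂ r E := by
  rw [basis_exteriorAlgebra_eq_prod, ιMulti_apply, Fin.sort_univ, List.ofFn_eq_map]

lemma coe_exteriorPower_map (k : ℕ) (g : U →ₗ[ℂ] U) (x : ⋀[ℂ]^k U) :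
    (exteriorPower.map k g x : ExteriorAlgebra ℂ U) =
      ExteriorAlgebra.map g (x : ExteriorAlgebra ℂ U) := by
  suffices h : (⋀[ℂ]^k U).subtype ∘ₗ exteriorPower.map k g =
      (ExteriorAlgebra.map g).toLinearMap ∘ₗ (⋀[ℂ]^k U).subtype from LinearMap.congr_fun h x
  refine exteriorPower.linearMap_ext ?_
  ext v
  simp [ExteriorAlgebra.map_apply_ιMulti]

variable {n : ℕ} (lam : Fin n → ℕ)

/-- The functional `⊗ x_i ↦ T (v_1 ⊗ x_1 ∧ ⋯ ∧ v_n ⊗ x_n ∧ ω)`, where `T` is the top form. -/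
noncomputable def wedgeFunctional (v : Fin n → Fin m → ℂ)
    (ω : ExteriorAlgebra ℂ (Fin m → U)) : FundamentalTensor U lam →ₗ[ℂ] ℂ :=
  PiTensorProduct.lift ((topForm E m ∘ₗ LinearMap.mulRight ℂ ω).compMultilinearMap
    ((MultilinearMap.mkPiAlgebraFin ℂ n (ExteriorAlgebra ℂ (Fin m → U))).compLinearMap fun i =>
      (ExteriorAlgebra.map (stackVector U (v i))).toLinearMap ∘ₗ (⋀[ℂ]^(lam i) U).subtype))

lemma wedgeFunctional_tprod (v : Fin n → Fin m → ℂ) (ω : ExteriorAlgebra ℂ (Fin m → U))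
    (x : ∀ i, ⋀[ℂ]^(lam i) U) :
    wedgeFunctional E lam v ω (PiTensorProduct.tprod ℂ x) =
      topForm E m ((List.ofFn fun i =>
        ExteriorAlgebra.map (stackVector U (v i)) (x i : ExteriorAlgebra ℂ U)).prod * ω) := by
  rw [wedgeFunctional, PiTensorProduct.lift.tprod]
  simp

/-- The action on `U` commutes with tensoring by the vectors `v i`, so it can be moved out of all
factors at once, fixing `ω` and then being absorbed by the top form. -/
lemma wedgeFunctional_mem (v : Fin n → Fin m → ℂ) {ω : ExteriorAlgebra ℂ (Fin m → U)}
    (hω : ∀ g : U →ₗ[ℂ] U, LinearMap.det g = 1 → ExteriorAlgebra.map (stackMap m g) ω = ω) :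
    wedgeFunctional E lam v ω ∈ tensorInvariants U lam := by
  intro g
  refine PiTensorProduct.ext (MultilinearMap.ext fun x => ?_)
  have hg : LinearMap.det ((g : U ≃ₗ[ℂ] U) : U →ₗ[ℂ] U) = 1 := SpecialLinearGroup.det_eq_one g
  simp only [LinearMap.compMultilinearMap_apply, LinearMap.comp_apply, PiTensorProduct.map_tprod,
    wedgeFunctional_tprod, coe_exteriorPower_map]
  conv_rhs => rw [← topForm_map E _ hg, map_mul, hω _ hg, map_list_prod, List.map_ofFn]
  congr 4
  funext i
  rw [Function.comp_apply, ← AlgHom.comp_apply, ← AlgHom.comp_apply,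
    ExteriorAlgebra.map_comp_map, ExteriorAlgebra.map_comp_map, stackMap_comp_stackVector]

/-- A product of volume forms is invariant. -/
lemma map_stackMap_volume (v : Fin m → ℂ) (g : U →ₗ[ℂ] U) (hg : LinearMap.det g = 1) :
    ExteriorAlgebra.map (stackMap m g)
      (ExteriorAlgebra.map (stackVector U v) (E.ExteriorAlgebra Finset.univ)) =
    ExteriorAlgebra.map (stackVector U v) (E.ExteriorAlgebra Finset.univ) := by
  rw [← AlgHom.comp_apply, ExteriorAlgebra.map_comp_map, stackMap_comp_stackVector,
    ← ExteriorAlgebra.map_comp_map, AlgHom.comp_apply, basis_exteriorAlgebra_univ,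
    map_ιMulti_basis, hg, one_smul]

lemma map_basis_exteriorAlgebra (v : Fin m → ℂ) (S : Finset (Fin r)) :
    ExteriorAlgebra.map (stackVector U v) (E.ExteriorAlgebra S) =
      ((S.sort (· ≤ ·)).map fun c => ι ℂ (stackVector U v (E c))).prod := by
  rw [basis_exteriorAlgebra_eq_prod, map_list_prod, List.map_map]
  simp [Function.comp_def]

lemma cast_wordInversions_ofFn {d : ℕ} {α : Type*} [LinearOrder α] (t : Fin d → α) :
    (wordInversions (List.ofFn t) : ZMod 2) = ∑ j, ∑ j', ltInd j j' * ltInd (t j') (t j) := by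
  have h : ∀ L : List (Fin d), (wordInversions (L.map t) : ZMod 2) =
      listPairSum (fun j j' => ltInd (t j') (t j)) L := by
    intro L
    induction L with
    | nil => rfl
    | cons a L ih =>
      rw [List.map_cons, wordInversions, listPairSum, Nat.cast_add, ih]
      congr 1
      clear ih
      induction L with
      | nil => rfl
      | cons b L ih =>
        rw [List.map_cons, List.countP_cons, Nat.cast_add, ih, List.map_cons, List.sum_cons,
          add_comm]
        congr 1
        simp [ltInd]
  rw [List.ofFn_eq_map, h, listPairSum_eq (p := fun j : Fin d => (j : ℕ)) _
    (List.pairwise_lt_finRange d)]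
  simp [ltInd]

open Classical in
/-- The top form on a product of basis vectors. -/
lemma topForm_ιMulti_basis (t : Fin (m * r) → Fin (m * r)) :
    topForm E m (ιMulti ℂ (m * r) fun j => stackBasis E m (t j)) =
      if Function.Injective t then
        paritySign (∑ j, ∑ j', ltInd j j' * ltInd (t j') (t j)) else 0 := by
  split_ifs with ht
  · have h1 : ιMulti ℂ (m * r) (fun j => stackBasis E m (t j)) =
        ((List.ofFn t).map fun j => ι ℂ (stackBasis E m j)).prod := by
      rw [ιMulti_apply, List.map_ofFn]; rfl
    -- An injective self-map of a finite set is a permutation, so sorting gives every index once.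
    have h2 : (List.ofFn t).insertionSort (· ≤ ·) = List.finRange (m * r) := by
      apply List.Perm.eq_of_pairwise (le := (· ≤ ·))
      · intro a b _ _ h1 h2; exact le_antisymm h1 h2
      · exact List.pairwise_insertionSort _ _
      · exact (List.pairwise_lt_finRange _).imp fun h => h.le
      · refine (List.perm_insertionSort _ _).trans ?_
        rw [List.perm_ext_iff_of_nodup (List.nodup_ofFn.2 ht) (List.nodup_finRange _)]
        intro a
        simpa using (Finite.injective_iff_surjective.1 ht) a
    have h3 : ((List.finRange (m * r)).map fun j => ι ℂ (stackBasis E m j)).prod =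
        ιMulti ℂ (m * r) (stackBasis E m) := by
      rw [ιMulti_apply, List.ofFn_eq_map]
    rw [h1, prod_map_eq_insertionSort fun a b => ι_mul_ι_eq_neg _ _, h2, h3,
      ← cast_wordInversions_ofFn, paritySign_natCast]
    have h4 : ((-1 : ExteriorAlgebra ℂ (Fin m → U)) ^ wordInversions (List.ofFn t)) *
        ιMulti ℂ (m * r) (stackBasis E m) =
        ((-1 : ℂ) ^ wordInversions (List.ofFn t)) • ιMulti ℂ (m * r) (stackBasis E m) := by
      rw [Algebra.smul_def, map_pow, map_neg, map_one]
    rw [h4, map_smul, topForm_ιMulti, Module.Basis.det_self, smul_eq_mul, mul_one]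
  · rw [topForm_ιMulti]
    refine AlternatingMap.map_eq_zero_of_not_injective _ _ fun h => ht ?_
    exact Function.Injective.of_comp h

end StackedSpace

/-! ### Webs are invariant -/

lemma ltInd_finProdFinEquiv {m r : ℕ} (a a' : Fin m) (c c' : Fin r) :
    ltInd (finProdFinEquiv (a, c)) (finProdFinEquiv (a', c')) =
      ltInd (toLex ((a : ℕ), c)) (toLex ((a' : ℕ), c')) := by
  have h : finProdFinEquiv (a, c) < finProdFinEquiv (a', c') ↔
      toLex ((a : ℕ), c) < toLex ((a' : ℕ), c') := by
    rw [Prod.Lex.toLex_lt_toLex, Fin.lt_def, finProdFinEquiv_apply_val, finProdFinEquiv_apply_val]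
    simp only
    have h1 := c.2
    have h2 := c'.2
    rcases lt_trichotomy (a : ℕ) a' with h | h | h
    · have : r * ((a : ℕ) + 1) ≤ r * a' := Nat.mul_le_mul_left r h
      rw [mul_add] at this
      exact iff_of_true (by omega) (Or.inl h)
    · rw [h]
      simp
    · have : r * ((a' : ℕ) + 1) ≤ r * a := Nat.mul_le_mul_left r h
      rw [mul_add] at this
      exact iff_of_false (by omega) (by omega)
  unfold ltInd
  simp only [h]

lemma prod_map_flatMap {α β A : Type*} [Monoid A] (L : List α) (f : α → List β) (F : β → A) :
    ((L.flatMap f).map F).prod = (L.map fun a => ((f a).map F).prod).prod := by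
  induction L with
  | nil => rfl
  | cons a L ih => simp [ih]

/-! ### Expansion of wedge products over colorings -/

namespace DiskGraph

variable {n r : ℕ} (G : DiskGraph n)

/-- The position of the white end of an edge. -/
noncomputable def whitePosition (e : G.Edge) : Fin (Fintype.card G.White) :=
  Fintype.equivFin G.White (G.white e)

/-- The labels at all black vertices when the interior ones carry all colors. -/
def blackLabels (S : Fin n → Finset (Fin r)) : G.Black ⊕ Fin n → Finset (Fin r) :=
  Sum.elim (fun _ => Finset.univ) S

variable {G}

lemma IsColoring.exists_edge {l : G.Edge → Finset (Fin r)} {S : Fin n → Finset (Fin r)}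
    (hl : IsColoring l) (hS : HasBoundaryLabels l S) (x : G.Black ⊕ Fin n) (c : Fin r) :
    c ∈ G.blackLabels S x ↔ ∃ e, G.black e = x ∧ c ∈ l e := by
  rcases x with b | i
  · obtain ⟨e, ⟨h1, h2⟩, -⟩ := (hl c).2 b
    exact iff_of_true (Finset.mem_univ c) ⟨e, h2, by simpa using h1⟩
  · exact hS i c

open Classical in
/-- The labeling that gives the color of each position to the edge at that position. -/
noncomputable def tupleLabeling {d : ℕ} (q : Fin d → (G.Black ⊕ Fin n) × Fin r)
    (p : Fin d → G.Edge) (e : G.Edge) : Finset (Fin r) :=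
  (Finset.univ.filter fun j => p j = e).image fun j => (q j).2

lemma mem_tupleLabeling {d : ℕ} {q : Fin d → (G.Black ⊕ Fin n) × Fin r}
    {p : Fin d → G.Edge} {e : G.Edge} {c : Fin r} :
    c ∈ tupleLabeling q p e ↔ ∃ j, p j = e ∧ (q j).2 = c := by
  simp [tupleLabeling]

section Tuples

variable {q : Fin (Fintype.card G.White * r) → (G.Black ⊕ Fin n) × Fin r}
  {S : Fin n → Finset (Fin r)} {p : Fin (Fintype.card G.White * r) → G.Edge}

lemma tuple_ext (hinj : Function.Injective q) (hp : ∀ j, G.black (p j) = (q j).1)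
    {j j' : Fin (Fintype.card G.White * r)} (h1 : p j = p j') (h2 : (q j).2 = (q j').2) :
    j = j' :=
  hinj (Prod.ext (by rw [← hp, ← hp, h1]) h2)

lemma hasBoundaryLabels_tupleLabeling (hq : ∀ x c, (∃ j, q j = (x, c)) ↔ c ∈ G.blackLabels S x)
    (hp : ∀ j, G.black (p j) = (q j).1) : HasBoundaryLabels (tupleLabeling q p) S := by
  intro i c
  simp only [mem_tupleLabeling]
  constructor
  · intro hc
    obtain ⟨j, hj⟩ := (hq (Sum.inr i) c).2 hc
    exact ⟨p j, by rw [hp, hj], j, rfl, by rw [hj]⟩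
  · rintro ⟨e, he, j, rfl, hc⟩
    rw [hp] at he
    exact (hq (Sum.inr i) c).1 ⟨j, Prod.ext he hc⟩

/-- There are as many positions as pairs of a white vertex and a color, so injectivity of `ht` makes
every such pair occur exactly once. At interior black vertices the same holds because `q` enumerates
all colors there. -/
lemma isColoring_tupleLabeling (hinj : Function.Injective q)
    (hq : ∀ x c, (∃ j, q j = (x, c)) ↔ c ∈ G.blackLabels S x)
    (hp : ∀ j, G.black (p j) = (q j).1)
    (ht : Function.Injective fun j => finProdFinEquiv (G.whitePosition (p j), (q j).2)) :
    IsColoring (tupleLabeling q p) := by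
  intro c
  simp only [IsDimer, mem_colorClass, mem_tupleLabeling]
  constructor
  · intro w
    obtain ⟨j, hj⟩ := (Finite.injective_iff_surjective.1 ht)
      (finProdFinEquiv (Fintype.equivFin G.White w, c))
    simp only [EmbeddingLike.apply_eq_iff_eq, Prod.mk.injEq, whitePosition] at hj
    refine ⟨p j, ⟨⟨j, rfl, hj.2⟩, hj.1⟩, ?_⟩
    rintro e ⟨⟨j', rfl, hc⟩, hw⟩
    have : j' = j := ht (by simp only [whitePosition, hw, hj.1, hc, hj.2])
    rw [this]
  · intro b
    obtain ⟨j, hj⟩ := (hq (Sum.inl b) c).2 (Finset.mem_univ c)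
    refine ⟨p j, ⟨⟨j, rfl, by rw [hj]⟩, by rw [hp, hj]⟩, ?_⟩
    rintro e ⟨⟨j', rfl, hc⟩, hw⟩
    have : j' = j := hinj (by rw [hj]; exact Prod.ext (by rw [← hp, hw]) hc)
    rw [this]

lemma sum_labelIndicator_tupleLabeling (hinj : Function.Injective q)
    (hp : ∀ j, G.black (p j) = (q j).1) (h : G.Edge × Fin r → ZMod 2) :
    ∑ a, labelIndicator (tupleLabeling q p) a * h a = ∑ j, h (p j, (q j).2) := by
  classical
  rw [← Finset.sum_image (g := fun j => (p j, (q j).2)) (f := h)]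
  · rw [← Finset.sum_subset (Finset.subset_univ
      (Finset.univ.image fun j => (p j, (q j).2)))]
    · refine Finset.sum_congr rfl fun a ha => ?_
      obtain ⟨j, -, rfl⟩ := Finset.mem_image.1 ha
      rw [labelIndicator, if_pos (mem_tupleLabeling.2 ⟨j, rfl, rfl⟩), one_mul]
    · intro a _ ha
      rw [labelIndicator, if_neg, zero_mul]
      rw [mem_tupleLabeling]
      rintro ⟨j, h1, h2⟩
      exact ha (Finset.mem_image.2 ⟨j, Finset.mem_univ _, Prod.ext h1 h2⟩)
  · intro j _ j' _ hjj
    simp only [Prod.mk.injEq] at hjj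
    exact tuple_ext hinj hp hjj.1 hjj.2

/-- Positions are in the order of (black end, color) and basis indices in the order of (white end,
color), so the sign of the reordering compares the two ends of the edges. -/
lemma invSum_tupleLabeling (hinj : Function.Injective q)
    (hmono : ∀ j j', j < j' ↔ (toLex (G.blackIndex (q j).1, (q j).2) : ℕ ×ₗ Fin r) <
      toLex (G.blackIndex (q j').1, (q j').2))
    (hp : ∀ j, G.black (p j) = (q j).1) :
    ∑ j, ∑ j', ltInd j j' * ltInd (finProdFinEquiv (G.whitePosition (p j'), (q j').2))
        (finProdFinEquiv (G.whitePosition (p j), (q j).2)) =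
      invSum (labelIndicator (tupleLabeling q p))
        (fun a => (toLex (G.whiteIndex (G.white a.1), a.2) : ℕ ×ₗ Fin r))
        (fun a => (toLex (G.blackIndex (G.black a.1), a.2) : ℕ ×ₗ Fin r)) := by
  rw [invSum_comm]
  unfold invSum
  simp only [mul_assoc, ← Finset.mul_sum, sum_labelIndicator_tupleLabeling hinj hp]
  refine Finset.sum_congr rfl fun j _ => Finset.sum_congr rfl fun j' _ => ?_
  rw [ltInd_finProdFinEquiv, hp, hp]
  congr 1
  unfold ltInd
  simp only [hmono]

lemma prod_tuple (hinj : Function.Injective q) (hp : ∀ j, G.black (p j) = (q j).1)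
    (s : G.Edge → ℂ) : ∏ j, s (p j) = ∏ e, s e ^ (tupleLabeling q p e).card := by
  classical
  rw [← Finset.prod_fiberwise Finset.univ p fun j => s (p j)]
  refine Finset.prod_congr rfl fun e _ => ?_
  rw [Finset.prod_congr rfl fun j hj => by rw [(Finset.mem_filter.1 hj).2], Finset.prod_const,
    tupleLabeling, Finset.card_image_of_injOn]
  intro j hj j' hj' h
  have h1 : p j = e := by simpa using hj
  have h2 : p j' = e := by simpa using hj'
  exact tuple_ext hinj hp (h1.trans h2.symm) h

open Classical in
/-- Expansions of products over the black ends are sums over colorings. -/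
theorem sum_tuples_eq_sum_colorings (hinj : Function.Injective q)
    (hq : ∀ x c, (∃ j, q j = (x, c)) ↔ c ∈ G.blackLabels S x)
    (hmono : ∀ j j', j < j' ↔ (toLex (G.blackIndex (q j).1, (q j).2) : ℕ ×ₗ Fin r) <
      toLex (G.blackIndex (q j').1, (q j').2))
    (s : G.Edge → ℂ) :
    ∑ p ∈ Fintype.piFinset fun j => Finset.univ.filter fun e => G.black e = (q j).1,
      (∏ j, s (p j)) *
        (if Function.Injective fun j => finProdFinEquiv (G.whitePosition (p j), (q j).2) then
          paritySign (∑ j, ∑ j', ltInd j j' *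
            ltInd (finProdFinEquiv (G.whitePosition (p j'), (q j').2))
              (finProdFinEquiv (G.whitePosition (p j), (q j).2))) else 0) =
    ∑ l : G.Edge → Finset (Fin r) with IsColoring l ∧ HasBoundaryLabels l S,
      (∏ e, s e ^ (l e).card) * paritySign (invSum (labelIndicator l)
        (fun a => (toLex (G.whiteIndex (G.white a.1), a.2) : ℕ ×ₗ Fin r))
        (fun a => (toLex (G.blackIndex (G.black a.1), a.2) : ℕ ×ₗ Fin r))) := by
  simp only [mul_ite, mul_zero]
  rw [← Finset.sum_filter]
  have hmem : ∀ p ∈ (Fintype.piFinset fun j => Finset.univ.filter fun e =>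
      G.black e = (q j).1).filter fun p => Function.Injective fun j =>
        finProdFinEquiv (G.whitePosition (p j), (q j).2),
      (∀ j, G.black (p j) = (q j).1) ∧
        Function.Injective fun j => finProdFinEquiv (G.whitePosition (p j), (q j).2) := by
    intro p hp
    rw [Finset.mem_filter, Fintype.mem_piFinset] at hp
    exact ⟨fun j => by simpa using hp.1 j, hp.2⟩
  refine Finset.sum_bij (fun p _ => tupleLabeling q p) (fun p hp => ?_)
    (fun p hp p' hp' h => ?_) (fun l hl => ?_) (fun p hp => ?_)
  · obtain ⟨h1, h2⟩ := hmem p hp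
    exact Finset.mem_filter.2 ⟨Finset.mem_univ _, isColoring_tupleLabeling hinj hq h1 h2,
      hasBoundaryLabels_tupleLabeling hq h1⟩
  · funext j
    have hj : (q j).2 ∈ tupleLabeling q p (p j) := mem_tupleLabeling.2 ⟨j, rfl, rfl⟩
    rw [h, mem_tupleLabeling] at hj
    obtain ⟨j', h1, h2⟩ := hj
    have : j' = j := hinj (Prod.ext (by
      rw [← (hmem p' hp').1, h1, (hmem p hp).1]) h2)
    rw [← h1, this]
  · obtain ⟨-, hc, hS⟩ := Finset.mem_filter.1 hl
    have hex : ∀ j, ∃ e, G.black e = (q j).1 ∧ (q j).2 ∈ l e := fun j =>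
      (hc.exists_edge hS _ _).1 ((hq _ _).1 ⟨j, rfl⟩)
    choose p hp1 hp2 using hex
    refine ⟨p, ?_, ?_⟩
    · rw [Finset.mem_filter, Fintype.mem_piFinset]
      refine ⟨fun j => by simpa using hp1 j, fun j j' h => ?_⟩
      simp only [EmbeddingLike.apply_eq_iff_eq, Prod.mk.injEq, whitePosition] at h
      have h3 := hp2 j'
      rw [← h.2] at h3
      exact tuple_ext hinj hp1 (hc.eq_of_white (hp2 j) h3 h.1) h.2
    · funext e
      ext c
      rw [mem_tupleLabeling]
      constructor
      · rintro ⟨j, rfl, rfl⟩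
        exact hp2 j
      · intro he
        obtain ⟨j, hj⟩ := (hq (G.black e) c).2 ((hc.exists_edge hS _ _).2 ⟨e, rfl, he⟩)
        have h2 : (q j).2 = c := by rw [hj]
        have h3 := hp2 j
        rw [h2] at h3
        exact ⟨j, hc.eq_of_black h3 he (by rw [hp1, hj]), h2⟩
  · obtain ⟨h1, h2⟩ := hmem p hp
    rw [prod_tuple hinj h1, invSum_tupleLabeling hinj hmono h1]

end Tuples

end DiskGraph

/-! ### The Kasteleyn functional and invariance of the web sum -/

namespace DiskNetwork

open DiskGraph ExteriorAlgebra

variable {n r : ℕ} {U : Type*} [AddCommGroup U] [Module ℂ U] (E : Module.Basis (Fin r) ℂ U)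

section Enumeration

variable (G : DiskGraph n)

/-- All black vertices in their order. -/
noncomputable def blackList : List (G.Black ⊕ Fin n) :=
  (List.finRange n).map Sum.inr ++
    (List.finRange (Fintype.card G.Black)).map fun b =>
      Sum.inl ((Fintype.equivFin G.Black).symm b)

lemma mem_blackList (x : G.Black ⊕ Fin n) : x ∈ blackList G := by
  rcases x with b | i
  · exact List.mem_append_right _
      (List.mem_map.2 ⟨Fintype.equivFin G.Black b, by simp, by simp⟩)
  · exact List.mem_append_left _ (by simp)

lemma pairwise_blackList :
    (blackList G).Pairwise fun x y => G.blackIndex x < G.blackIndex y := by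
  rw [blackList, List.pairwise_append, List.pairwise_map, List.pairwise_map]
  refine ⟨List.pairwise_lt_finRange n, ?_, ?_⟩
  · refine (List.pairwise_lt_finRange _).imp fun {b b'} h => ?_
    have : (b : ℕ) < b' := h
    simpa [blackIndex] using this
  · simp only [List.mem_map, List.mem_finRange, true_and]
    rintro _ ⟨i, rfl⟩ _ ⟨b, rfl⟩
    simp only [blackIndex]
    omega

/-- The word of the labels at the black vertices. -/
noncomputable def labelWord (S : Fin n → Finset (Fin r)) : List ((G.Black ⊕ Fin n) × Fin r) :=
  (blackList G).flatMap fun x => ((G.blackLabels S x).sort (· ≤ ·)).map fun c => (x, c)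

lemma mem_labelWord {S : Fin n → Finset (Fin r)} {x : G.Black ⊕ Fin n} {c : Fin r} :
    (x, c) ∈ labelWord G S ↔ c ∈ G.blackLabels S x := by
  simp [labelWord, mem_blackList]

lemma pairwise_labelWord (S : Fin n → Finset (Fin r)) :
    (labelWord G S).Pairwise fun a b => (toLex (G.blackIndex a.1, a.2) : ℕ ×ₗ Fin r) <
      toLex (G.blackIndex b.1, b.2) := by
  rw [labelWord, List.pairwise_flatMap]
  constructor
  · intro x _
    rw [List.pairwise_map]
    refine (Finset.sortedLT_sort _).pairwise.imp fun {c c'} h => ?_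
    rw [Prod.Lex.toLex_lt_toLex]
    exact Or.inr ⟨rfl, h⟩
  · refine (pairwise_blackList G).imp fun {x y} h => ?_
    simp only [List.mem_map]
    rintro _ ⟨c, -, rfl⟩ _ ⟨c', -, rfl⟩
    rw [Prod.Lex.toLex_lt_toLex]
    exact Or.inl h

lemma length_labelWord (S : Fin n → Finset (Fin r)) :
    (labelWord G S).length = ∑ i, (S i).card + Fintype.card G.Black * r := by
  rw [labelWord, List.length_flatMap]
  simp only [List.length_map, Finset.length_sort, blackList, List.map_append, List.map_map,
    List.sum_append, blackLabels, Function.comp_def, Sum.elim_inr, Sum.elim_inl]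
  congr 1
  simp

end Enumeration

variable {lam : Fin n → ℕ} (N : DiskNetwork n) (s : N.Edge → ℂ)

open Classical in
/-- The column of the Kasteleyn matrix at a black vertex, for given signed edge weights. -/
noncomputable def kasteleynColumn (x : N.Black ⊕ Fin n) : Fin (Fintype.card N.White) → ℂ :=
  ∑ e with N.black e = x, s e • Pi.single (N.whitePosition e) 1

open Classical in
lemma stackVector_kasteleynColumn (x : N.Black ⊕ Fin n) (c : Fin r) :
    stackVector U (N.kasteleynColumn s x) (E c) = ∑ e with N.black e = x,
      s e • stackBasis E (Fintype.card N.White) (finProdFinEquiv (N.whitePosition e, c)) := by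
  funext a
  change N.kasteleynColumn s x a • E c = _
  rw [kasteleynColumn, Finset.sum_apply, Finset.sum_apply, Finset.sum_smul]
  refine Finset.sum_congr rfl fun e _ => ?_
  rw [stackBasis_apply]
  by_cases h : a = N.whitePosition e
  · subst h; simp
  · simp [h]

/-- The product of the volume forms at the interior black vertices. -/
noncomputable def interiorForm : ExteriorAlgebra ℂ (Fin (Fintype.card N.White) → U) :=
  (List.ofFn fun b : Fin (Fintype.card N.Black) =>
    ExteriorAlgebra.map
      (stackVector U (N.kasteleynColumn s (Sum.inl ((Fintype.equivFin N.Black).symm b))))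
      (E.ExteriorAlgebra Finset.univ)).prod

/-- The invariant functional attached to signed edge weights. -/
noncomputable def kasteleynFunctional (lam : Fin n → ℕ) : FundamentalTensor U lam →ₗ[ℂ] ℂ :=
  wedgeFunctional E lam (fun i => N.kasteleynColumn s (Sum.inr i)) (N.interiorForm E s)

lemma kasteleynFunctional_mem : N.kasteleynFunctional E s lam ∈ tensorInvariants U lam := by
  refine wedgeFunctional_mem E lam _ fun g hg => ?_
  rw [interiorForm, map_list_prod, List.map_ofFn]
  congr 2
  funext b
  exact map_stackMap_volume E _ g hg

lemma kasteleynFunctional_basisTensor (S : ∀ i, Set.powersetCard (Fin r) (lam i)) :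
    N.kasteleynFunctional E s lam (basisTensor E S) = topForm E (Fintype.card N.White)
      ((labelWord N.toDiskGraph fun i => (S i : Finset (Fin r))).map fun a =>
        ι ℂ (stackVector U (N.kasteleynColumn s a.1) (E a.2))).prod := by
  have h : ∀ i, (E.exteriorPower (lam i) (S i) : ExteriorAlgebra ℂ U) =
      E.ExteriorAlgebra (S i : Finset (Fin r)) := fun i => by
    rw [exteriorPower.basis_apply, exteriorPower.ιMulti_family_apply_coe,
      ExteriorAlgebra.basis_apply_ofCard E (S i).2]
    rfl
  rw [kasteleynFunctional, basisTensor, wedgeFunctional_tprod]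
  simp only [h, interiorForm, map_basis_exteriorAlgebra]
  rw [labelWord, prod_map_flatMap, blackList, List.map_append, List.prod_append, List.ofFn_eq_map,
    List.ofFn_eq_map]
  simp [Function.comp_def, blackLabels]

open Classical in
/-- The invariant functional as a sum over colorings. -/
lemma kasteleynFunctional_eq_sum {k : ℕ} (hN : N.HasExcedance k) (hsum : ∑ i, lam i = k * r)
    (S : ∀ i, Set.powersetCard (Fin r) (lam i)) :
    N.kasteleynFunctional E s lam (basisTensor E S) =
      ∑ l : N.Edge → Finset (Fin r) with IsColoring l ∧
          HasBoundaryLabels l (fun i => (S i : Finset (Fin r))),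
        (∏ e, s e ^ (l e).card) * paritySign (invSum (labelIndicator l)
          (fun a => (toLex (N.whiteIndex (N.white a.1), a.2) : ℕ ×ₗ Fin r))
          (fun a => (toLex (N.blackIndex (N.black a.1), a.2) : ℕ ×ₗ Fin r))) := by
  -- The word has top degree: `k * r` letters come from the boundary by `hsum` and `r` from each
  -- interior black vertex, which is `r` for each white vertex by the excedance.
  have hlen : (labelWord N.toDiskGraph fun i => (S i : Finset (Fin r))).length =
      Fintype.card N.White * r := by
    rw [length_labelWord, show Fintype.card N.White = Fintype.card N.Black + k from hN, add_mul,
      add_comm, ← hsum]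
    congr 1
    exact Finset.sum_congr rfl fun i _ => (S i).2
  obtain ⟨q, hq⟩ : ∃ q : Fin (Fintype.card N.White * r) → (N.Black ⊕ Fin n) × Fin r,
      List.ofFn q = labelWord N.toDiskGraph fun i => (S i : Finset (Fin r)) := by
    rw [← hlen]
    exact ⟨_, List.ofFn_get _⟩
  have hlt : ∀ j j', j < j' → (toLex (N.blackIndex (q j).1, (q j).2) : ℕ ×ₗ Fin r) <
      toLex (N.blackIndex (q j').1, (q j').2) := by
    have h := pairwise_labelWord N.toDiskGraph fun i => (S i : Finset (Fin r))
    rw [← hq, List.pairwise_ofFn] at h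
    exact fun j j' hj => h hj
  have hmono : StrictMono fun j => (toLex (N.blackIndex (q j).1, (q j).2) : ℕ ×ₗ Fin r) :=
    fun j j' h => hlt j j' h
  have hinj : Function.Injective q := fun j j' h => hmono.injective (by simp only [h])
  have hrange : ∀ x c, (∃ j, q j = (x, c)) ↔
      c ∈ N.blackLabels (fun i => (S i : Finset (Fin r))) x := fun x c => by
    rw [← mem_labelWord, ← hq, List.mem_ofFn]
  rw [← sum_tuples_eq_sum_colorings hinj hrange (fun j j' => hmono.lt_iff_lt.symm) s,
    kasteleynFunctional_basisTensor, ← hq, List.map_ofFn]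
  simp only [Function.comp_def, stackVector_kasteleynColumn]
  rw [← ιMulti_apply]
  -- Each column is a sum over the edges at its black vertex, so expanding the product chooses one
  -- edge for every pair of a black end and a color.
  have h := (ιMulti ℂ (Fintype.card N.White * r)).toMultilinearMap.map_sum_finset
    (fun j e => s e • stackBasis E (Fintype.card N.White)
      (finProdFinEquiv (N.whitePosition e, (q j).2)))
    (fun j => Finset.univ.filter fun e => N.black e = (q j).1)
  refine (congrArg (topForm E _) h).trans ?_
  rw [map_sum]
  refine Finset.sum_congr rfl fun p _ => ?_
  rw [MultilinearMap.map_smul_univ, map_smul, smul_eq_mul]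
  congr 1
  exact topForm_ιMulti_basis E _

/-- The `r`-fold boundary measurement is an invariant functional. -/
theorem web_mem_tensorInvariants {k : ℕ} (hN : N.HasExcedance k) (hsum : ∑ i, lam i = k * r)
    (O : ∀ W : N.Weblike r lam, W.Tagging) : N.web E lam O ∈ tensorInvariants U lam := by
  classical
  obtain ⟨κ, c, hκ⟩ := exists_coloring_sign (r := r) (G := N.toDiskGraph) hN
  -- Twisting the weights by the Kasteleyn signs turns the reordering sign of each coloring into
  -- sign(S) times the global sign `paritySign c`.
  suffices h : N.web E lam O = paritySign c •
      N.kasteleynFunctional E (fun e => paritySign (κ e) * N.weight e) lam by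
    rw [h]
    exact Submodule.smul_mem _ _ (N.kasteleynFunctional_mem E _)
  refine functional_ext E fun S => ?_
  rw [web_basisTensor N E hN, LinearMap.smul_apply, N.kasteleynFunctional_eq_sum E _ hN hsum,
    ← sum_colorings_eq_prod, Finset.mul_sum, Finset.smul_sum]
  refine Finset.sum_congr rfl fun l hl => ?_
  obtain ⟨-, hl, hS⟩ := Finset.mem_filter.1 hl
  have hpow : ∀ (x : ZMod 2) (m : ℕ), paritySign x ^ m = paritySign (m * x) := fun x m => by
    induction m with
    | zero => simp
    | succ m ih => rw [pow_succ, ih, ← paritySign_add, Nat.cast_succ, add_mul, one_mul]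
  simp only [mul_pow, Finset.prod_mul_distrib, hpow, ← paritySign_sum, paritySign_inversions,
    smul_eq_mul]
  have h := hκ l _ hl hS
  rw [mul_right_comm, ← paritySign_add, ← mul_assoc, ← paritySign_add]
  congr 2
  rw [← h]
  have z1 := zmod_two_add_self (∑ e, ((l e).card : ZMod 2) * κ e)
  have z2 := zmod_two_add_self (invSum (labelIndicator l)
    (fun a => (toLex (N.whiteIndex (N.white a.1), a.2) : ℕ ×ₗ Fin r))
    (fun a => (toLex (N.blackIndex (N.black a.1), a.2) : ℕ ×ₗ Fin r)))
  linear_combination -z1 - z2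

/-- Taggings and signs of webs exist. -/
theorem websWellDefined {k : ℕ} (hr : 1 ≤ r) (hN : N.HasExcedance k) :
    N.WebsWellDefined E lam :=
  fun W => ⟨W.nonempty_tagging hr, fun O => O.isSign_sign E hN⟩

end DiskNetwork

/-- If two networks have the same point in the affine cone over `Gr(k,n)`, then their `r`-fold
boundary measurements are equal, as elements of the space of tensor invariants, whatever the
taggings used to compute them. -/
theorem theorem4p2 {n k r : ℕ} (hr : 1 ≤ r) {U : Type*} [AddCommGroup U] [Module ℂ U]
    (E : Module.Basis (Fin r) ℂ U) (lam : Fin n → ℕ) (hlam : ∀ i, lam i ≤ r)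
    (hsum : ∑ i, lam i = k * r) (N N' : DiskNetwork n)
    (hN : N.HasExcedance k) (hN' : N'.HasExcedance k) (hX : N.conePoint k = N'.conePoint k) :
    N.WebsWellDefined E lam ∧ N'.WebsWellDefined E lam ∧
      ∀ (O : ∀ W : N.Weblike r lam, W.Tagging) (O' : ∀ W : N'.Weblike r lam, W.Tagging),
        N.web E lam O ∈ tensorInvariants U lam ∧ N.web E lam O = N'.web E lam O' := by
  exact ⟨N.websWellDefined E hr hN, N'.websWellDefined E hr hN', fun O O' =>
    ⟨N.web_mem_tensorInvariants E hN hsum O,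
      DiskNetwork.web_eq_of_conePoint_eq E hN hN' hX O O'⟩⟩
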